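/- **Conventions.** $q\ge p$ means that the condition $q$ extends (is stronger than) $p$. $Reg$ is the class of (infinite) regular cardinals; a singular ordinal is a limit ordinal that is not a regular cardinal. A cardinal $\lambda$ is Mahlo if it is inaccessible and $\lambda\cap Reg$ is stationary in $\lambda$. $H_\theta$ is the set of sets whose transitive closure has size $<\theta$. **The forcing.** Let $[\lambda]^{<\lambda}$ be the set of sequences $s$ of ordinals below $\lambda$, of length $\mathrm{lh}(s)<\lambda$, that are increasing apart from their values at regular cardinals (i.e. $s(\beta)<s(\gamma)$ whenever $\beta<\gamma<\mathrm{lh}(s)$ are not regular cardinals). A condition of $\mathbb M_\lambda$ is a nonempty tree $p\subseteq[\lambda]^{<\lambda}$ (closed under initial segments) such that, with $C_p(s)=\{\gamma<\lambda: s^\frown\langle\gamma\rangle\in p\}$: (1) if $s\in[\lambda]^{<\lambda}$ has limit length and all its proper initial segments are in $p$ then $s\in p$; (2) for each $s\in p$, $C_p(s)$ is a singleton or a co-bounded subset of $\lambda$, and in the latter case $s$ is called a splitting node of $p$; (3) if $s\in p$ and $\mathrm{lh}(s)$ is a regular cardinal then $C_p(s)=\{0\}$; (4) every $s\in p$ is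 an initial segment of a splitting node of $p$; (5) if $\alpha<\lambda$ is singular, $s\in p\cap{}^\alpha\alpha$ and unboundedly many proper initial segments of $s$ are splitting nodes of $p$, then $s$ is a splitting node of $p$. Put $p\ge q$ iff $p\subseteq q$. For $\nu<\lambda$, $\mathrm{Split}_\nu(p)$ is the set of minimal nodes $s\in p$ such that the set of splitting nodes $t\subsetneq s$ of $p$ has order type $\nu$; $p\ge_\nu q$ means $p\ge q$ and $\mathrm{Split}_\nu(p)=\mathrm{Split}_\nu(q)$. A $\nu$-fusion sequence is a $\le$-increasing sequence $\langle p_\alpha:\alpha<\lambda\rangle$ of conditions with $p_{\alpha+1}\ge_{\nu+\alpha}p_\alpha$ for all $\alpha<\lambda$ and $p_\delta=\bigcap_{\alpha<\delta}p_\alpha$ for limit $\delta<\lambda$. **Continuous fusion.** Let $\mathbb Q$ be a poset. For a set $X$, a set $G\subseteq X\cap\mathbb Q$ is $X$-generic if any two elements of $G$ have a common extension in $G$ and $G$ meets every $D\in X$ that is dense in $\mathbb Q$; $q$ is a generic condition for $X$ if $q$ forces that $\dot G_{\mathbb Q}\cap X$ is $X$-generic. A condition $r$ is an exact upper bound of a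 set $Z$ of conditions if $r$ extends every element of $Z$ and every condition extending all elements of $Z$ extends $r$. A continuous elementary chain in a structure $H$ is a sequence $\vec X=\langle X_\alpha:\alpha<\kappa\rangle$ with $X_\alpha\prec H$, $\alpha\subseteq X_\alpha$, $X_\alpha\subseteq X_\beta$ for $\alpha<\beta$, and $X_\delta=\bigcup_{\alpha<\delta}X_\alpha$ for limit $\delta$; it is internally approachable if $\langle X_\alpha:\alpha\le\delta\rangle\in X_{\delta+1}$ for all $\delta<\kappa$. Let $\kappa$ be regular, $S\subseteq\kappa$ stationary, $\vec D=\langle D_\alpha:\alpha<\kappa\rangle$ a sequence of dense open subsets of $\mathbb Q$, $q^*\in\mathbb Q$, $C\subseteq\kappa$ a club and $\vec X$ a continuous elementary chain; the requirements (a)-(c) are: (a) $|X_\alpha|<\kappa$ for all $\alpha<\kappa$; (b) for every $\alpha\in S\cap C$ and every $X_\alpha$-generic set $G$ all of whose elements are compatible with $q^*$, the set $G\cup\{q^*\}$ has an exact upper bound, and it belongs to $D_\alpha$; (c) $q^*$ is a generic condition for $\bigcup_{\alpha<\kappa}X_\alpha$. The poset $\mathbb Q$ has the $\kappa$-Continuous-Fusion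 property with respect to $S$ if $|\mathbb Q|\ge\kappa$ and for all $q\in\mathbb Q$, all such $\vec D$, every well-order $<_{wo}$ of $H_{|\mathbb Q|^+}$ and every $A\subseteq H_{|\mathbb Q|^+}$ there are $q^*\ge q$, a club $C\subseteq\kappa$ and a continuous elementary chain $\vec X=\langle X_\alpha:\alpha<\kappa\rangle$ in $(H_{|\mathbb Q|^+},\in,<_{wo},\mathbb Q,\vec D,A)$ satisfying (a)-(c). **Lemma.** Let $\lambda$ be a Mahlo cardinal. Then $\mathbb M_\lambda$ has the $\lambda$-Continuous-Fusion property with respect to $\lambda\cap Reg$. Moreover, for every $\nu<\lambda$, $p\in\mathbb M_\lambda$, sequence $\vec D=\langle D_\alpha:\alpha<\lambda\rangle$ of dense open subsets of $\mathbb M_\lambda$, well-order $<_{wo}$ of $H_{|\mathbb M_\lambda|^+}$ and $A\subseteq H_{|\mathbb M_\lambda|^+}$, there are a condition $q^*\ge_\nu p$, a club $C\subseteq\lambda$ and a continuous, internally approachable elementary chain $\vec X$ in $(H_{|\mathbb M_\lambda|^+},\in,<_{wo},\mathbb M_\lambda,\vec D,A)$ satisfying (a)-(c) with $S=\lambda\cap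 Reg$, such that $q^*=\bigcap_{\alpha<\lambda}p_\alpha$ for some $\nu$-fusion sequence $\langle p_\alpha:\alpha<\lambda\rangle$ with $p_0=p$ and $p_\alpha,p_{\alpha+1}\in X_{\alpha+1}$ for all $\alpha<\lambda$. -/

import Mathlib

universe u

noncomputable section

namespace MillerFusion

open Cardinal

/-! ### Large cardinals

The universe of sets is `ZFSet.{u}`; ordinals and cardinals are `Ordinal.{u}`, `Cardinal.{u}`, and
an ordinal `a` is the set `a.toZFSet`. -/

/-- The ordinal `a` is a regular cardinal (in particular infinite). -/
def IsRegularOrd (a : Ordinal.{u}) : Prop := ∃ c : Cardinal.{u}, c.IsRegular ∧ c.ord = a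

/-- The ordinal `a` is a singular ordinal: a limit ordinal which is not a regular cardinal. -/
def IsSingularOrd (a : Ordinal.{u}) : Prop := Order.IsSuccLimit a ∧ ¬ IsRegularOrd a

/-- The set `kappa ∩ Reg` of regular cardinals below `kappa`. -/
def regularsBelow (kappa : Cardinal.{u}) : Set (Set.Iio kappa.ord) := {a | IsRegularOrd a.1}

/-- `kappa` is Mahlo: inaccessible, with stationarily many regular cardinals below. -/
def IsMahlo (kappa : Cardinal.{u}) : Prop :=
  kappa.IsInaccessible ∧ IsStationary (regularsBelow kappa)

/-! ### Forcing posets, dense sets, generic sets -/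

/-- A poset in the universe of sets; `ext p q` is `p ≥ q`: `p` extends (is stronger than) `q`. -/
structure ForcingPoset : Type (u + 1) where
  carrier : ZFSet.{u}
  ext : ZFSet.{u} → ZFSet.{u} → Prop
  refl : ∀ p ∈ carrier, ext p p
  trans : ∀ p ∈ carrier, ∀ q ∈ carrier, ∀ r ∈ carrier, ext p q → ext q r → ext p r
  antisymm : ∀ p ∈ carrier, ∀ q ∈ carrier, ext p q → ext q p → p = q

namespace ForcingPoset

variable (Q : ForcingPoset.{u})

/-- `p` and `q` have a common extension. -/
def Compatible (p q : ZFSet.{u}) : Prop := ∃ r ∈ Q.carrier, Q.ext r p ∧ Q.ext r q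

/-- `D` is a dense subset of the poset. -/
def IsDense (D : ZFSet.{u}) : Prop := D ⊆ Q.carrier ∧ ∀ p ∈ Q.carrier, ∃ d ∈ D, Q.ext d p

/-- `D` is a dense open subset of the poset. -/
def IsDenseOpen (D : ZFSet.{u}) : Prop :=
  Q.IsDense D ∧ ∀ d ∈ D, ∀ p ∈ Q.carrier, Q.ext p d → p ∈ D

/-- `r` is an upper bound of `Z`. -/
def IsUpperBound (Z : Set ZFSet.{u}) (r : ZFSet.{u}) : Prop :=
  r ∈ Q.carrier ∧ ∀ z ∈ Z, Q.ext r z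

/-- `r` is an exact upper bound of `Z`: every condition extending all of `Z` extends `r`. -/
def IsExactUpperBound (Z : Set ZFSet.{u}) (r : ZFSet.{u}) : Prop :=
  Q.IsUpperBound Z r ∧ ∀ r', Q.IsUpperBound Z r' → Q.ext r' r

/-- `G` is an `X`-generic set. -/
def IsGenericSet (X : Set ZFSet.{u}) (G : Set ZFSet.{u}) : Prop :=
  (∀ g ∈ G, g ∈ X ∧ g ∈ Q.carrier) ∧
  (∀ a ∈ G, ∀ b ∈ G, ∃ c ∈ G, Q.ext c a ∧ Q.ext c b) ∧
  ∀ D ∈ X, Q.IsDense D → ∃ g ∈ G, g ∈ D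

/-! #### The forcing relation

A statement about the generic filter is given by the set of conditions forcing it, following the
usual recursive clauses of the forcing relation. Quantifiers range over ground model sets. -/

/-- `p ⊩ a ∈ Ġ`. -/
def forcesMem (a p : ZFSet.{u}) : Prop :=
  ∀ r ∈ Q.carrier, Q.ext r p → ∃ s ∈ Q.carrier, Q.ext s r ∧ Q.ext s a

/-- `p ⊩ φ → ψ`. -/
def forcesImp (φ ψ : ZFSet.{u} → Prop) (p : ZFSet.{u}) : Prop :=
  ∀ r ∈ Q.carrier, Q.ext r p → φ r → ψ r

/-- `p ⊩ ∃ i ∈ I, φ i`. -/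
def forcesEx (I : Set ZFSet.{u}) (φ : ZFSet.{u} → ZFSet.{u} → Prop) (p : ZFSet.{u}) : Prop :=
  ∀ r ∈ Q.carrier, Q.ext r p → ∃ s ∈ Q.carrier, Q.ext s r ∧ ∃ i ∈ I, φ i s

/-- `q` is a generic condition for `X`: `q` forces that `Ġ ∩ X` is an `X`-generic set. -/
def IsGenericCondition (X : Set ZFSet.{u}) (q : ZFSet.{u}) : Prop :=
  (∀ a ∈ X, a ∈ Q.carrier → ∀ b ∈ X, b ∈ Q.carrier →
    Q.forcesImp (fun p => Q.forcesMem a p ∧ Q.forcesMem b p)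
      (Q.forcesEx {c | c ∈ X ∧ c ∈ Q.carrier ∧ Q.ext c a ∧ Q.ext c b} Q.forcesMem) q) ∧
  ∀ D ∈ X, Q.IsDense D → Q.forcesEx {d | d ∈ X ∧ d ∈ D} Q.forcesMem q

end ForcingPoset

/-! ### Elementary chains in `H_θ` -/

/-- `H_θ` (for infinite `θ`): the sets whose transitive closure has cardinality `< θ`, i.e. which
are contained in a transitive set of cardinality `< θ`. -/
def HSet (θ : Cardinal.{u}) : Set ZFSet.{u} :=
  {x | ∃ t : ZFSet.{u}, t.IsTransitive ∧ x ⊆ t ∧ t.card < θ}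

/-- The relation symbols of the structures `(H_θ, ∈, <_wo, Q, ≤_Q, D, A)`. -/
inductive FusionRel : ℕ → Type
  | mem : FusionRel 2
  | wo : FusionRel 2
  | poset : FusionRel 1
  | ext : FusionRel 2
  | dense : FusionRel 2
  | extra : FusionRel 1

/-- The first-order language of the structures `(H_θ, ∈, <_wo, Q, ≤_Q, D, A)`. -/
def fusionLang : FirstOrder.Language.{0, 0} := ⟨fun _ => Empty, FusionRel⟩

/-- The cardinal `|Q|⁺`. -/
def ForcingPoset.succCard (Q : ForcingPoset.{u}) : Cardinal.{u} := Order.succ Q.carrier.card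

/-- The structure `(H_{|Q|⁺}, ∈, <_wo, Q, ≤_Q, D, A)`, where `D = ⟨D a | a < kappa⟩`. -/
@[reducible] def fusionStructure (Q : ForcingPoset.{u}) (kappa : Cardinal.{u})
    (D : Ordinal.{u} → ZFSet.{u}) (wo : HSet Q.succCard → HSet Q.succCard → Prop)
    (A : Set (HSet Q.succCard)) : fusionLang.Structure (HSet Q.succCard) where
  funMap := fun f _ => Empty.elim f
  RelMap := fun {n} (r : FusionRel n) =>
    match r with
    | .mem => fun v => (v 0).1 ∈ (v 1).1
    | .wo => fun v => wo (v 0) (v 1)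
    | .poset => fun v => (v 0).1 ∈ Q.carrier
    | .ext => fun v => (v 0).1 ∈ Q.carrier ∧ (v 1).1 ∈ Q.carrier ∧ Q.ext (v 0).1 (v 1).1
    | .dense => fun v => ∃ a < kappa.ord, (v 0).1 = a.toZFSet ∧ (v 1).1 ∈ D a
    | .extra => fun v => v 0 ∈ A

/-- `X ≺ H`, where `s` is a structure on the set `H`. -/
def IsElementarySubset {H : Set ZFSet.{u}} (s : fusionLang.Structure H) (X : ZFSet.{u}) : Prop :=
  (∀ x ∈ X, x ∈ H) ∧ ∃ N : fusionLang.ElementarySubstructure H, ∀ x : H, x ∈ N ↔ x.1 ∈ X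

/-- `⟨X a | a < kappa⟩` is a continuous elementary chain in the structure `s`. -/
def IsContinuousElementaryChain {H : Set ZFSet.{u}} (s : fusionLang.Structure H)
    (kappa : Cardinal.{u}) (X : Ordinal.{u} → ZFSet.{u}) : Prop :=
  (∀ a < kappa.ord, IsElementarySubset s (X a)) ∧
  (∀ a < kappa.ord, a.toZFSet ⊆ X a) ∧
  (∀ b < kappa.ord, ∀ a < b, X a ⊆ X b) ∧
  ∀ d < kappa.ord, Order.IsSuccLimit d → ∀ x, x ∈ X d ↔ ∃ a < d, x ∈ X a

/-- The chain is internally approachable: `⟨X a | a ≤ d⟩ ∈ X (d + 1)` whenever `d + 1 < kappa`. -/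
def IsInternallyApproachable (kappa : Cardinal.{u}) (X : Ordinal.{u} → ZFSet.{u}) : Prop :=
  ∀ d, d + 1 < kappa.ord → ∃ f ∈ X (d + 1),
    ∀ z, z ∈ f ↔ ∃ a ≤ d, z = ZFSet.pair a.toZFSet (X a)

/-! ### The continuous fusion property -/

/-- The requirements (a), (b), (c) on a continuous fusion witness `q` for the chain `X`, the dense
open sets `D`, and the club `C`, with respect to `S`. -/
def IsFusionWitness (Q : ForcingPoset.{u}) (kappa : Cardinal.{u}) (S : Set (Set.Iio kappa.ord))
    (D X : Ordinal.{u} → ZFSet.{u}) (C : Set (Set.Iio kappa.ord)) (q : ZFSet.{u}) : Prop :=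
  (∀ a < kappa.ord, (X a).card < kappa) ∧
  (∀ a ∈ S ∩ C, ∀ G : Set ZFSet.{u}, Q.IsGenericSet {x | x ∈ X a.1} G →
    (∀ g ∈ G, Q.Compatible g q) →
      ∃ r, Q.IsExactUpperBound (insert q G) r ∧ r ∈ D a.1) ∧
  Q.IsGenericCondition {x | ∃ a < kappa.ord, x ∈ X a} q

/-- The `kappa`-Continuous-Fusion property of `Q` with respect to `S`. -/
def HasContinuousFusion (Q : ForcingPoset.{u}) (kappa : Cardinal.{u})
    (S : Set (Set.Iio kappa.ord)) : Prop :=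
  kappa ≤ Q.carrier.card ∧
  ∀ q ∈ Q.carrier, ∀ D : Ordinal.{u} → ZFSet.{u}, (∀ a < kappa.ord, Q.IsDenseOpen (D a)) →
  ∀ wo : HSet Q.succCard → HSet Q.succCard → Prop, IsWellOrder _ wo →
  ∀ A : Set (HSet Q.succCard),
    ∃ qs ∈ Q.carrier, Q.ext qs q ∧
    ∃ C : Set (Set.Iio kappa.ord), IsClub C ∧
    ∃ X : Ordinal.{u} → ZFSet.{u},
      IsContinuousElementaryChain (fusionStructure Q kappa D wo A) kappa X ∧
      IsFusionWitness Q kappa S D X C qs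

/-! ### Generalized Miller forcing -/

/-- `s` is a sequence of length `a` of ordinals below `lam` (as a set of pairs). Thus for two
sequences, `t ⊆ s` says that `t` is an initial segment of `s`. -/
def IsSeq (lam : Cardinal.{u}) (a : Ordinal.{u}) (s : ZFSet.{u}) : Prop :=
  ZFSet.IsFunc a.toZFSet lam.ord.toZFSet s

/-- The sequence `s` of ordinals is increasing, apart from its values at regular cardinals (where
the nodes of the trees below take the value `0`). -/
def IsIncreasingSeq (s : ZFSet.{u}) : Prop :=
  ∀ b c x y : Ordinal.{u}, b < c → ¬ IsRegularOrd b → ¬ IsRegularOrd c →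
    ZFSet.pair b.toZFSet x.toZFSet ∈ s → ZFSet.pair c.toZFSet y.toZFSet ∈ s → x < y

/-- `C_p(s) = {c | s ⌢ ⟨c⟩ ∈ p}`. -/
def nextSet (lam : Cardinal.{u}) (p s : ZFSet.{u}) : Set Ordinal.{u} :=
  {c | ∃ a, IsSeq lam a s ∧ insert (ZFSet.pair a.toZFSet c.toZFSet) s ∈ p}

/-- `C` is a co-bounded subset of `lam`. -/
def IsCobounded (lam : Cardinal.{u}) (C : Set Ordinal.{u}) : Prop :=
  (∀ c ∈ C, c < lam.ord) ∧ ∃ b < lam.ord, ∀ c, b ≤ c → c < lam.ord → c ∈ C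

/-- `s` is a splitting node of `p`. -/
def IsSplitting (lam : Cardinal.{u}) (p s : ZFSet.{u}) : Prop :=
  s ∈ p ∧ IsCobounded lam (nextSet lam p s)

/-- `p` is a condition of the generalized Miller forcing at `lam`. -/
structure IsMillerCondition (lam : Cardinal.{u}) (p : ZFSet.{u}) : Prop where
  nonempty : ∃ s, s ∈ p
  seq : ∀ s ∈ p, ∃ a < lam.ord, IsSeq lam a s ∧ IsIncreasingSeq s
  tree : ∀ s ∈ p, ∀ t a, IsSeq lam a t → t ⊆ s → t ∈ p
  closure : ∀ a < lam.ord, Order.IsSuccLimit a → ∀ s, IsSeq lam a s →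
    (∀ t, ∀ b < a, IsSeq lam b t → t ⊆ s → t ∈ p) → s ∈ p
  splitting : ∀ s ∈ p, (∃ c, nextSet lam p s = {c}) ∨ IsCobounded lam (nextSet lam p s)
  regular : ∀ s ∈ p, ∀ a, IsRegularOrd a → IsSeq lam a s → nextSet lam p s = {0}
  dense : ∀ s ∈ p, ∃ t, s ⊆ t ∧ IsSplitting lam p t
  singular : ∀ a < lam.ord, IsSingularOrd a → ∀ s ∈ p,
    ZFSet.IsFunc a.toZFSet a.toZFSet s →
    (∀ b < a, ∃ c, b ≤ c ∧ c < a ∧ ∃ t, IsSeq lam c t ∧ t ⊆ s ∧ IsSplitting lam p t) →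
    IsSplitting lam p s

/-- The generalized Miller forcing `M_lam`, ordered by reverse inclusion. -/
def millerForcing (lam : Cardinal.{u}) : ForcingPoset.{u} where
  carrier := ZFSet.sep (IsMillerCondition lam)
    (ZFSet.powerset (ZFSet.powerset (ZFSet.prod lam.ord.toZFSet lam.ord.toZFSet)))
  ext p q := p ⊆ q
  refl _ _ := fun _ h => h
  trans _ _ _ _ _ _ h₁ h₂ := fun _ h => h₂ (h₁ h)
  antisymm _ _ _ _ h₁ h₂ := ZFSet.ext fun _ => ⟨fun h => h₁ h, fun h => h₂ h⟩

/-- Membership in the carrier is exactly being a condition. -/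
theorem mem_millerForcing_carrier {lam : Cardinal.{u}} {p : ZFSet.{u}} :
    p ∈ (millerForcing lam).carrier ↔ IsMillerCondition lam p := by
  simp only [millerForcing, ZFSet.mem_sep, and_iff_right_iff_imp]
  intro h
  rw [ZFSet.mem_powerset]
  intro s hs
  rw [ZFSet.mem_powerset]
  obtain ⟨a, ha, hsa, -⟩ := h.seq s hs
  intro z hz
  obtain ⟨x, hx, y, hy, rfl⟩ := ZFSet.mem_prod.1 (hsa.1 hz)
  exact ZFSet.mem_prod.2 ⟨x, Ordinal.toZFSet_monotone ha.le hx, y, hy, rfl⟩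

/-- The splitting nodes of `p` that are proper initial segments of `s`. -/
def splittingBelow (lam : Cardinal.{u}) (p s : ZFSet.{u}) : Set ZFSet.{u} :=
  {t | IsSplitting lam p t ∧ t ⊆ s ∧ t ≠ s}

/-- The set of splitting nodes of `p` properly below `s`, ordered by end-extension, has order type
`a`. -/
def HasSplittingType (lam : Cardinal.{u}) (p s : ZFSet.{u}) (a : Ordinal.{u}) : Prop :=
  Nonempty ((fun x y : splittingBelow lam p s => x.1 ⊆ y.1) ≃r
    (fun x y : Set.Iio a => x ≤ y))

/-- `Split_a(p)`: the minimal nodes of `p` with splitting type `a`. -/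
def split (lam : Cardinal.{u}) (a : Ordinal.{u}) (p : ZFSet.{u}) : Set ZFSet.{u} :=
  {s | s ∈ p ∧ HasSplittingType lam p s a ∧
    ∀ t ∈ p, t ⊆ s → HasSplittingType lam p t a → t = s}

/-- `p ≥_n q`: `p` extends `q` and `Split_n(p) = Split_n(q)`. -/
def ExtendsAt (lam : Cardinal.{u}) (n : Ordinal.{u}) (p q : ZFSet.{u}) : Prop :=
  (millerForcing lam).ext p q ∧ split lam n p = split lam n q

/-- `⟨P a | a < lam⟩` is an `n`-fusion sequence of conditions. -/
structure IsFusionSeq (lam : Cardinal.{u}) (n : Ordinal.{u}) (P : Ordinal.{u} → ZFSet.{u}) :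
    Prop where
  mem : ∀ a < lam.ord, P a ∈ (millerForcing lam).carrier
  increasing : ∀ b < lam.ord, ∀ a ≤ b, (millerForcing lam).ext (P b) (P a)
  succ : ∀ a < lam.ord, ExtendsAt lam (n + a) (P (a + 1)) (P a)
  limit : ∀ d < lam.ord, Order.IsSuccLimit d → ∀ s, s ∈ P d ↔ ∀ a < d, s ∈ P a

end MillerFusion

end

universe v

noncomputable section

namespace MillerFusion

open Cardinal

section

/-! ### Ordinals -/

/-! A fusion sequence `P a` and a chain of models `X a` of size below `lam` are built by
simultaneous recursion. Call a condition good for `X a` if it lies in `D a`, decides every condition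
in `X a` and extends an element of every dense set in `X a` (`IsGood`). Intersections of chains of
fewer than `lam` conditions are conditions (`isMillerCondition_inter`), so fewer than `lam` dense
open sets have dense intersection (`exists_mem_all`) and good conditions are dense
(`exists_isGood`). The front of `P a` at level `n + a` is an antichain met by every extension of `P
a`. Above each of its nodes, `P a` is replaced by a good condition; the result `P (a + 1)` is a
condition that agrees with `P a` up to that level (`exists_fusion_step`). The model `X (a + 1)`
comes from Löwenheim–Skolem, with the objects needed later put in by hand. The intersection `q` of
all `P a` is a condition, because the status of a node `s` is settled from stage `len s + 1` on.

For requirement (b), let `a` be a regular cardinal in the club of closure points and `G` an `X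
a`-generic set whose elements are compatible with `q`. For each `b < a`, `G` selects one node of the
front of `P b`; these nodes form a chain, and their union is a node `s` of `q` of length exactly `a`
(`exists_generic_branch`). Nodes of regular length do not split, so `s` has nothing left to choose
and is itself on the front of `P a` (`mem_front_of_branch`). Hence `restr (P (a + 1)) s` is in `D
a`, and so is its extension `restr q s`. The latter is the exact upper bound: it extends `G` because
goodness at earlier stages decides each element of `G`, and it is extended by every upper bound
because `G` pins down the branch `s`.

For requirement (c), any extension of `q` contains a node `t` of the front of `P b`, so it has a
further extension below `restr (P (b + 1)) t`. That condition is good for `X b` and belongs to a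
later model (`exists_isGood_mem_chain`). -/

theorem exists_bound {lam : Cardinal.{u}} (hlam : lam.IsRegular) {ι : Type v} [Small.{u} ι]
    (hι : Cardinal.lift.{u} #ι < Cardinal.lift.{v} lam) (f : ι → Ordinal.{u})
    (hf : ∀ i, f i < lam.ord) : ∃ b < lam.ord, ∀ i, f i < b := by
  refine ⟨⨆ i, f i + 1, Ordinal.lift_iSup_add_one_lt_of_lt_cof ?_ hf, fun i => ?_⟩
  · rwa [← Ordinal.lift_cof, hlam.cof_ord]
  · exact Order.lt_add_one_iff.2 le_rfl |>.trans_le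
      (le_ciSup (f := fun i => f i + 1) Ordinal.bddAbove_of_small i)

theorem exists_bound_Iio {lam : Cardinal.{u}} (hlam : lam.IsRegular) {i : Ordinal.{u}}
    (hi : i < lam.ord) (f : Ordinal.{u} → Ordinal.{u}) (hf : ∀ j < i, f j < lam.ord) :
    ∃ b < lam.ord, ∀ j < i, f j < b := by
  obtain ⟨b, hb, h⟩ := exists_bound hlam (ι := Set.Iio i)
    (by simpa [Cardinal.lt_ord, ← Ordinal.lift_card] using hi) (fun j => f j.1) fun j => hf j.1 j.2
  exact ⟨b, hb, fun j hj => h ⟨j, hj⟩⟩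

theorem exists_bound_mem {lam : Cardinal.{u}} (hlam : lam.IsRegular) {x : ZFSet.{u}}
    (hx : x.card < lam) (f : ZFSet.{u} → Ordinal.{u}) (hf : ∀ z ∈ x, f z < lam.ord) :
    ∃ b < lam.ord, ∀ z ∈ x, f z < b := by
  obtain ⟨b, hb, h⟩ := exists_bound hlam (ι := x)
    (by simpa [ZFSet.cardinalMk_coe_sort] using hx) (fun j => f j.1) fun j => hf j.1 j.2
  exact ⟨b, hb, fun j hj => h ⟨j, hj⟩⟩

theorem exists_bound_nat {lam : Cardinal.{u}} (hlam : lam.IsRegular) (h : ℵ₀ < lam)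
    (f : ℕ → Ordinal.{u}) (hf : ∀ n, f n < lam.ord) : ∃ b < lam.ord, ∀ n, f n < b :=
  exists_bound hlam (by simpa using h) f hf

theorem _root_.Cardinal.IsRegular.isSuccLimit_ord {lam : Cardinal.{u}} (hlam : lam.IsRegular) :
    Order.IsSuccLimit lam.ord :=
  Cardinal.isSuccLimit_ord hlam.aleph0_le

theorem IsRegularOrd.isSuccLimit {a : Ordinal.{u}} (h : IsRegularOrd a) : Order.IsSuccLimit a := by
  obtain ⟨c, hc, rfl⟩ := h
  exact hc.isSuccLimit_ord

/-- A limit of a countable sequence is singular if it is greater than `ω`. -/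
theorem isSingularOrd_of_nat_seq {a : Ordinal.{u}} (ha : Ordinal.omega0 < a) (f : ℕ → Ordinal.{u})
    (hf : ∀ n, f n < a) (hc : ∀ x < a, ∃ n, x < f n) : IsSingularOrd a := by
  refine ⟨?_, ?_⟩
  · rw [Ordinal.isSuccLimit_iff, Order.isSuccPrelimit_iff_succ_lt]
    refine ⟨(Ordinal.omega0_pos.trans ha).ne', fun b hb => ?_⟩
    obtain ⟨n, hn⟩ := hc b hb
    exact (Order.succ_le_of_lt hn).trans_lt (hf n)
  · rintro ⟨c, hc', rfl⟩
    obtain ⟨b, hb, h⟩ := exists_bound_nat hc' (by simpa [Cardinal.lt_ord] using ha) f hf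
    obtain ⟨n, hn⟩ := hc b hb
    exact (hn.trans (h n)).false

/-- A function from `lam` to `lam` has unboundedly many closure points. -/
theorem exists_closure_point {lam : Cardinal.{u}} (hlam : lam.IsRegular) (h : ℵ₀ < lam)
    (g : Ordinal.{u} → Ordinal.{u}) (hg : ∀ x < lam.ord, g x < lam.ord) {b : Ordinal.{u}}
    (hb : b < lam.ord) : ∃ a < lam.ord, b < a ∧ ∀ x < a, g x < a := by
  have hstep : ∀ c : Set.Iio lam.ord, ∃ d : Set.Iio lam.ord, c < d ∧ ∀ x < c.1, g x < d.1 := by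
    rintro ⟨c, hc⟩
    obtain ⟨d, hd, hd'⟩ := exists_bound_Iio hlam hc g fun j hj => hg j (hj.trans hc)
    refine ⟨⟨max d (c + 1), max_lt hd (hlam.isSuccLimit_ord.add_one_lt hc)⟩, ?_, fun x hx => ?_⟩
    · exact lt_max_of_lt_right (Order.lt_add_one_iff.2 le_rfl : c < c + 1)
    · exact lt_max_of_lt_left (hd' x hx)
  choose s hs hs' using hstep
  let f : ℕ → Set.Iio lam.ord := fun n => s^[n] ⟨b, hb⟩
  have hf : ∀ n, f (n + 1) = s (f n) := fun n => Function.iterate_succ_apply' _ _ _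
  have hbd : BddAbove (Set.range fun n => (f n).1) := Ordinal.bddAbove_of_small
  obtain ⟨b', hb', hfb'⟩ := exists_bound_nat hlam h (fun n => (f n).1) fun n => (f n).2
  have hlt : ∀ n, (f n).1 < ⨆ n, (f n).1 := fun n => by
    refine lt_of_lt_of_le ?_ (le_ciSup hbd (n + 1))
    rw [hf]
    exact hs _
  refine ⟨⨆ n, (f n).1, (ciSup_le fun n => (hfb' n).le).trans_lt hb', hlt 0, fun x hx => ?_⟩
  obtain ⟨n, hn⟩ := (lt_ciSup_iff hbd).1 hx
  refine lt_trans ?_ (hlt (n + 1))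
  rw [hf]
  exact hs' _ _ hn

/-- Transfinite ascent: requirements that persist upward are met one at a time, passing to upper
bounds of what has been built. It serves to lengthen nodes, to raise their splitting rank and, in
the reversed order of conditions, to prove distributivity. -/
theorem exists_le_forall {P : Type*} [Preorder P] (x₀ : P) (δ : Ordinal.{u})
    (Φ : Ordinal.{u} → P → Prop) (up : ∀ i x y, x ≤ y → Φ i x → Φ i y)
    (step : ∀ i < δ, ∀ x, x₀ ≤ x → (∀ j < i, Φ j x) → ∃ y, x ≤ y ∧ Φ i y)
    (ub : ∀ i ≤ δ, ∀ f : Ordinal.{u} → P, (∀ j < i, x₀ ≤ f j) →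
      (∀ j k, j ≤ k → k < i → f j ≤ f k) → ∃ y, x₀ ≤ y ∧ ∀ j < i, f j ≤ y) :
    ∃ y, x₀ ≤ y ∧ ∀ j < δ, Φ j y := by
  classical
  have : Nonempty P := ⟨x₀⟩
  -- The choice is arbitrary when no suitable `y` exists; `main` shows by induction that below `δ`
  -- this never happens.
  let R : Ordinal.{u} → P := WellFounded.fix (C := fun _ => P) (wellFounded_lt)
    fun i F => Classical.epsilon fun y => x₀ ≤ y ∧ (∀ j (h : j < i), F j h ≤ y) ∧ Φ i y
  have hR : ∀ i, R i = Classical.epsilon fun y => x₀ ≤ y ∧ (∀ j < i, R j ≤ y) ∧ Φ i y := by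
    intro i
    exact WellFounded.fix_eq _ _ i
  have key : ∀ i ≤ δ, (∀ k < i, x₀ ≤ R k ∧ (∀ j < k, R j ≤ R k) ∧ Φ k (R k)) →
      ∃ y, x₀ ≤ y ∧ (∀ j < i, R j ≤ y) ∧ ∀ j < i, Φ j y := by
    intro i hi hk
    obtain ⟨y, hy0, hy⟩ := ub i hi R (fun j hj => (hk j hj).1) (fun j k hjk hki => by
      rcases hjk.eq_or_lt with rfl | h
      · exact le_rfl
      · exact (hk k hki).2.1 j h)
    exact ⟨y, hy0, hy, fun j hj => up j _ _ (hy j hj) (hk j hj).2.2⟩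
  have main : ∀ i < δ, x₀ ≤ R i ∧ (∀ j < i, R j ≤ R i) ∧ Φ i (R i) := by
    intro i
    induction i using WellFoundedLT.induction with
    | ind i ih =>
      intro hi
      obtain ⟨y, hy0, hyR, hy⟩ := key i hi.le fun k hk => ih k hk (hk.trans hi)
      obtain ⟨z, hz, hz'⟩ := step i hi y hy0 hy
      have := Classical.epsilon_spec (p := fun y => x₀ ≤ y ∧ (∀ j < i, R j ≤ y) ∧ Φ i y)
        ⟨z, hy0.trans hz, fun j hj => (hyR j hj).trans hz, hz'⟩
      rwa [← hR i] at this
  obtain ⟨y, hy0, -, hy⟩ := key δ le_rfl main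
  exact ⟨y, hy0, hy⟩

/-! ### Order types of sets of ordinals. -/

/-- The transitive collapse of the set `A` of ordinals, evaluated at `b`: the order type of
`A ∩ b`. -/
def cnt (A : Set Ordinal.{u}) (b : Ordinal.{u}) : Ordinal.{u} :=
  sInf {x | ∀ c (_ : c < b), c ∈ A → cnt A c < x}
termination_by b

theorem cnt_def (A : Set Ordinal.{u}) (b : Ordinal.{u}) :
    cnt A b = sInf {x | ∀ c < b, c ∈ A → cnt A c < x} := by
  rw [cnt]

theorem cnt_le_self (A : Set Ordinal.{u}) (b : Ordinal.{u}) : cnt A b ≤ b := by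
  induction b using WellFoundedLT.induction with
  | ind b ih =>
    rw [cnt_def]
    exact csInf_le' fun c hc _ => (ih c hc).trans_lt hc

theorem cnt_lt_cnt {A : Set Ordinal.{u}} {b c : Ordinal.{u}} (h : c < b) (hc : c ∈ A) :
    cnt A c < cnt A b := by
  have := csInf_mem (s := {x | ∀ c < b, c ∈ A → cnt A c < x})
    ⟨b, fun c hc _ => (cnt_le_self A c).trans_lt hc⟩
  rw [← cnt_def] at this
  exact this c h hc

theorem cnt_le_iff {A : Set Ordinal.{u}} {b x : Ordinal.{u}} :
    cnt A b ≤ x ↔ ∀ c < b, c ∈ A → cnt A c < x := by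
  refine ⟨fun h c hc hA => (cnt_lt_cnt hc hA).trans_le h, fun h => ?_⟩
  rw [cnt_def]
  exact csInf_le' h

theorem cnt_mono (A : Set Ordinal.{u}) {b c : Ordinal.{u}} (h : b ≤ c) : cnt A b ≤ cnt A c :=
  cnt_le_iff.2 fun _ hd hA => cnt_lt_cnt (hd.trans_le h) hA

/-- The values of the collapse form an initial segment: if `x` were omitted, a larger value at some
`c < b` would yield `x` below `c` by induction, so all values would be below `x`. -/
theorem exists_cnt_eq {A : Set Ordinal.{u}} {b x : Ordinal.{u}} (h : x < cnt A b) :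
    ∃ c < b, c ∈ A ∧ cnt A c = x := by
  induction b using WellFoundedLT.induction with
  | ind b ih =>
    by_contra! hx
    have : cnt A b ≤ x := cnt_le_iff.2 fun c hc hA => by
      rcases lt_trichotomy (cnt A c) x with h' | h' | h'
      · exact h'
      · exact (hx c hc hA h').elim
      · obtain ⟨d, hd, hdA, hdx⟩ := ih c hc h'
        exact (hx d (hd.trans hc) hdA hdx).elim
    exact (this.trans_lt h).false

theorem cnt_congr {A B : Set Ordinal.{u}} {b : Ordinal.{u}} (h : ∀ c < b, c ∈ A ↔ c ∈ B) :
    cnt A b = cnt B b := by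
  induction b using WellFoundedLT.induction with
  | ind b ih =>
    rw [cnt_def, cnt_def]
    congr 1
    ext x
    refine forall₂_congr fun c hc => ?_
    rw [h c hc, ih c hc fun d hd => h d (hd.trans hc)]

theorem cnt_le_cnt {A B : Set Ordinal.{u}} {b : Ordinal.{u}} (h : ∀ c < b, c ∈ A → c ∈ B) :
    cnt A b ≤ cnt B b := by
  induction b using WellFoundedLT.induction with
  | ind b ih =>
    exact cnt_le_iff.2 fun c hc hA => (ih c hc fun d hd => h d (hd.trans hc)).trans_lt
      (cnt_lt_cnt hc (h c hc hA))

/-- The collapse is an isomorphism of `A ∩ b` onto `cnt A b`. -/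
theorem nonempty_cnt_iso (A : Set Ordinal.{u}) (b : Ordinal.{u}) :
    Nonempty ({c // c ∈ A ∧ c < b} ≃o Set.Iio (cnt A b)) := by
  let f : {c // c ∈ A ∧ c < b} → Set.Iio (cnt A b) := fun c => ⟨cnt A c.1, cnt_lt_cnt c.2.2 c.2.1⟩
  have hf : StrictMono f := fun c d hcd => cnt_lt_cnt (A := A) hcd c.2.1
  refine ⟨hf.orderIsoOfSurjective f fun x => ?_⟩
  obtain ⟨c, hc, hA, hx⟩ := exists_cnt_eq x.2
  exact ⟨⟨c, hA, hc⟩, Subtype.ext hx⟩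

theorem eq_of_Iio_iso {a b : Ordinal.{u}} (e : Set.Iio a ≃o Set.Iio b) : a = b := by
  have := e.toRelIsoLT.ordinalType_congr
  simpa using this

end

section

/-! ### Sequences of ordinals -/

/-- The restriction of the sequence `s` to `b`. -/
def res (s : ZFSet.{u}) (b : Ordinal.{u}) : ZFSet.{u} :=
  ZFSet.sep (fun z => ∃ x < b, ∃ y, z = ZFSet.pair x.toZFSet y) s

/-- The length of a sequence. -/
def len (s : ZFSet.{u}) : Ordinal.{u} :=
  sInf {a | ∀ z ∈ s, ∃ x < a, ∃ y, z = ZFSet.pair x.toZFSet y}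

/-- The sequence `s ⌢ ⟨c⟩`. -/
def snoc (s : ZFSet.{u}) (c : Ordinal.{u}) : ZFSet.{u} :=
  insert (ZFSet.pair (len s).toZFSet c.toZFSet) s

variable {lam : Cardinal.{u}} {a b c : Ordinal.{u}} {s t r : ZFSet.{u}}

theorem isSeq_iff : IsSeq lam a s ↔
    (∀ z ∈ s, ∃ x < a, ∃ y < lam.ord, z = ZFSet.pair x.toZFSet y.toZFSet) ∧
    (∀ x < a, ∃ y : Ordinal.{u}, ZFSet.pair x.toZFSet y.toZFSet ∈ s) ∧
    ∀ x y y' : Ordinal.{u}, ZFSet.pair x.toZFSet y.toZFSet ∈ s →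
      ZFSet.pair x.toZFSet y'.toZFSet ∈ s → y = y' := by
  constructor
  · rintro ⟨h1, h2⟩
    have h3 : ∀ z ∈ s, ∃ x < a, ∃ y < lam.ord, z = ZFSet.pair x.toZFSet y.toZFSet := by
      intro z hz
      obtain ⟨x, hx, y, hy, rfl⟩ := ZFSet.mem_prod.1 (h1 hz)
      obtain ⟨x, hx, rfl⟩ := Ordinal.mem_toZFSet_iff.1 hx
      obtain ⟨y, hy, rfl⟩ := Ordinal.mem_toZFSet_iff.1 hy
      exact ⟨x, Ordinal.toZFSet_mem_toZFSet_iff.1 hx, y, Ordinal.toZFSet_mem_toZFSet_iff.1 hy, rfl⟩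
    refine ⟨h3, fun x hx => ?_, fun x y y' hy hy' => ?_⟩
    · obtain ⟨w, hw, -⟩ := h2 x.toZFSet (Ordinal.toZFSet_mem_toZFSet_iff.2 hx)
      obtain ⟨x', hx', y, hy, h⟩ := h3 _ hw
      obtain ⟨-, rfl⟩ := ZFSet.pair_inj.1 h
      exact ⟨y, hw⟩
    · obtain ⟨x', hx', y, hy, h⟩ := h3 _ hy
      obtain ⟨hxx, hh⟩ := ZFSet.pair_inj.1 h
      obtain rfl := Ordinal.toZFSet_injective hxx
      have := h2 x.toZFSet (Ordinal.toZFSet_mem_toZFSet_iff.2 hx')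
      exact Ordinal.toZFSet_injective (this.unique (by assumption) hy')
  · rintro ⟨h1, h2, h3⟩
    refine ⟨fun z hz => ?_, fun z hz => ?_⟩
    · obtain ⟨x, hx, y, hy, rfl⟩ := h1 z hz
      exact ZFSet.pair_mem_prod.2 ⟨Ordinal.toZFSet_mem_toZFSet_iff.2 hx,
        Ordinal.toZFSet_mem_toZFSet_iff.2 hy⟩
    · obtain ⟨x, hx, rfl⟩ := Ordinal.mem_toZFSet_iff.1 hz
      obtain ⟨y, hy⟩ := h2 x hx
      refine ⟨y.toZFSet, hy, fun w hw => ?_⟩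
      obtain ⟨x', hx', y', hy', h⟩ := h1 _ hw
      obtain ⟨hxx, rfl⟩ := ZFSet.pair_inj.1 h
      rw [h3 x y y' hy hw]

theorem IsSeq.exists_eq_pair (h : IsSeq lam a s) {z : ZFSet.{u}} (hz : z ∈ s) :
    ∃ x < a, ∃ y < lam.ord, z = ZFSet.pair x.toZFSet y.toZFSet :=
  (isSeq_iff.1 h).1 z hz

theorem IsSeq.total (h : IsSeq lam a s) (hb : b < a) :
    ∃ y : Ordinal.{u}, ZFSet.pair b.toZFSet y.toZFSet ∈ s :=
  (isSeq_iff.1 h).2.1 b hb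

theorem IsSeq.functional (h : IsSeq lam a s) {x y y' : Ordinal.{u}}
    (hy : ZFSet.pair x.toZFSet y.toZFSet ∈ s) (hy' : ZFSet.pair x.toZFSet y'.toZFSet ∈ s) :
    y = y' :=
  (isSeq_iff.1 h).2.2 x y y' hy hy'

theorem IsSeq.lt (h : IsSeq lam a s) {x y : Ordinal.{u}}
    (hy : ZFSet.pair x.toZFSet y.toZFSet ∈ s) : x < a ∧ y < lam.ord := by
  obtain ⟨x', hx, y', hy, h⟩ := h.exists_eq_pair hy
  obtain ⟨h1, h2⟩ := ZFSet.pair_inj.1 h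
  obtain rfl := Ordinal.toZFSet_injective h1
  obtain rfl := Ordinal.toZFSet_injective h2
  exact ⟨hx, hy⟩

theorem pair_mem_res {x : Ordinal.{u}} {y : ZFSet.{u}} :
    ZFSet.pair x.toZFSet y ∈ res s b ↔ x < b ∧ ZFSet.pair x.toZFSet y ∈ s := by
  rw [res, ZFSet.mem_sep, and_comm]
  refine and_congr_left fun _ => ⟨?_, fun h => ⟨x, h, y, rfl⟩⟩
  rintro ⟨x', hx', y', h⟩
  obtain ⟨h1, -⟩ := ZFSet.pair_inj.1 h
  rwa [Ordinal.toZFSet_injective h1]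

theorem res_subset (s : ZFSet.{u}) (b : Ordinal.{u}) : res s b ⊆ s := ZFSet.sep_subset

theorem IsSeq.len_eq (h : IsSeq lam a s) : len s = a := by
  refine le_antisymm (csInf_le' fun z hz => ?_) (le_csInf ⟨a, fun z hz => ?_⟩ fun b hb => ?_)
  · obtain ⟨x, hx, y, -, rfl⟩ := h.exists_eq_pair hz
    exact ⟨x, hx, _, rfl⟩
  · obtain ⟨x, hx, y, -, rfl⟩ := h.exists_eq_pair hz
    exact ⟨x, hx, _, rfl⟩
  · by_contra! hlt
    obtain ⟨y, hy⟩ := h.total hlt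
    obtain ⟨x, hx, y', h'⟩ := hb _ hy
    have := Ordinal.toZFSet_injective (ZFSet.pair_inj.1 h').1
    exact (this ▸ hx).false

theorem IsSeq.len (h : IsSeq lam a s) : IsSeq lam (len s) s := by rwa [h.len_eq]

theorem IsSeq.res (h : IsSeq lam a s) (hb : b ≤ a) : IsSeq lam b (res s b) := by
  refine isSeq_iff.2 ⟨fun z hz => ?_, fun x hx => ?_, fun x y y' hy hy' => ?_⟩
  · obtain ⟨x, hx, y, hy, rfl⟩ := h.exists_eq_pair (res_subset _ _ hz)
    exact ⟨x, (pair_mem_res.1 hz).1, y, hy, rfl⟩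
  · obtain ⟨y, hy⟩ := h.total (hx.trans_le hb)
    exact ⟨y, pair_mem_res.2 ⟨hx, hy⟩⟩
  · exact h.functional (res_subset _ _ hy) (res_subset _ _ hy')

theorem IsSeq.le_of_subset (hs : IsSeq lam a s) (ht : IsSeq lam b t) (h : t ⊆ s) : b ≤ a := by
  by_contra! hlt
  obtain ⟨y, hy⟩ := ht.total hlt
  exact (hs.lt (h hy)).1.false

/-- An initial segment is determined by its length, which turns inclusions between nodes on a common
branch into comparisons of ordinals. -/
theorem IsSeq.eq_res (hs : IsSeq lam a s) (ht : IsSeq lam b t) (h : t ⊆ s) :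
    t = MillerFusion.res s b := by
  ext z
  constructor
  · intro hz
    obtain ⟨x, hx, y, hy, rfl⟩ := ht.exists_eq_pair hz
    exact pair_mem_res.2 ⟨hx, h hz⟩
  · intro hz
    obtain ⟨x, hx, y, hy, rfl⟩ := hs.exists_eq_pair (res_subset _ _ hz)
    obtain ⟨hxb, hz⟩ := pair_mem_res.1 hz
    obtain ⟨y', hy'⟩ := ht.total hxb
    rwa [hs.functional hz (h hy')]

theorem IsSeq.res_self (hs : IsSeq lam a s) : MillerFusion.res s a = s :=
  (hs.eq_res hs fun _ h => h).symm

theorem IsSeq.eq_of_subset (hs : IsSeq lam a s) (ht : IsSeq lam a t) (h : t ⊆ s) : t = s := by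
  rw [hs.eq_res ht h, hs.res_self]

theorem res_mono (s : ZFSet.{u}) (h : b ≤ c) : res s b ⊆ res s c := by
  intro z hz
  rw [res, ZFSet.mem_sep] at hz ⊢
  obtain ⟨hz, x, hx, y, rfl⟩ := hz
  exact ⟨hz, x, hx.trans_le h, y, rfl⟩

theorem res_res (s : ZFSet.{u}) (h : b ≤ c) : res (res s c) b = res s b := by
  ext z
  simp only [res, ZFSet.mem_sep]
  constructor
  · rintro ⟨⟨h1, h2⟩, h3⟩
    exact ⟨h1, h3⟩
  · rintro ⟨h1, x, hx, y, rfl⟩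
    exact ⟨⟨h1, x, hx.trans_le h, y, rfl⟩, x, hx, y, rfl⟩

/-- Initial segments of the same sequence are comparable. -/
theorem IsSeq.subset_of_len_le (hr : IsSeq lam c r) (hs : IsSeq lam a s) (ht : IsSeq lam b t)
    (hsr : s ⊆ r) (htr : t ⊆ r) (h : a ≤ b) : s ⊆ t := by
  rw [hr.eq_res hs hsr, hr.eq_res ht htr]
  exact res_mono _ h

theorem IsSeq.res_eq_of_subset (hs : IsSeq lam a s) (ht : IsSeq lam b t) (h : t ⊆ s)
    (hc : c ≤ b) : MillerFusion.res t c = MillerFusion.res s c := by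
  rw [hs.eq_res ht h, res_res _ hc]

theorem subset_snoc (s : ZFSet.{u}) (c : Ordinal.{u}) : s ⊆ snoc s c :=
  fun _ h => ZFSet.mem_insert_of_mem _ h

theorem IsSeq.snoc (hs : IsSeq lam a s) (hc : c < lam.ord) : IsSeq lam (a + 1) (snoc s c) := by
  have hmem : ∀ z, z ∈ MillerFusion.snoc s c ↔ z = ZFSet.pair a.toZFSet c.toZFSet ∨ z ∈ s := by
    intro z
    rw [MillerFusion.snoc, hs.len_eq, ZFSet.mem_insert_iff]
  refine isSeq_iff.2 ⟨fun z hz => ?_, fun x hx => ?_, fun x y y' hy hy' => ?_⟩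
  · rcases (hmem z).1 hz with rfl | hz
    · exact ⟨a, Order.lt_add_one_iff.2 le_rfl, c, hc, rfl⟩
    · obtain ⟨x, hx, y, hy, rfl⟩ := hs.exists_eq_pair hz
      exact ⟨x, hx.trans (Order.lt_add_one_iff.2 le_rfl), y, hy, rfl⟩
  · rcases (Order.lt_add_one_iff.1 hx).eq_or_lt with rfl | hx
    · exact ⟨c, (hmem _).2 (Or.inl rfl)⟩
    · obtain ⟨y, hy⟩ := hs.total hx
      exact ⟨y, (hmem _).2 (Or.inr hy)⟩
  · rcases (hmem _).1 hy with h | h <;> rcases (hmem _).1 hy' with h' | h'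
    · rw [ZFSet.pair_inj] at h h'
      exact Ordinal.toZFSet_injective (h.2.trans h'.2.symm)
    · rw [ZFSet.pair_inj] at h
      rw [h.1] at h'
      exact ((hs.lt h').1.false).elim
    · rw [ZFSet.pair_inj] at h'
      rw [h'.1] at h
      exact ((hs.lt h).1.false).elim
    · exact hs.functional h h'

theorem pair_mem_snoc (hs : IsSeq lam a s) (c : Ordinal.{u}) :
    ZFSet.pair a.toZFSet c.toZFSet ∈ snoc s c := by
  rw [snoc, hs.len_eq]
  exact ZFSet.mem_insert _ _

theorem IsSeq.snoc_injective (hs : IsSeq lam a s) {c c' : Ordinal.{u}} (hc : c < lam.ord)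
    (h : MillerFusion.snoc s c = MillerFusion.snoc s c') : c = c' := by
  refine (hs.snoc hc).functional (pair_mem_snoc hs c) ?_
  rw [h]
  exact pair_mem_snoc hs c'

theorem IsSeq.lt_of_snoc (hs : IsSeq lam a s) (hb : IsSeq lam b (MillerFusion.snoc s c)) :
    c < lam.ord := (hb.lt (pair_mem_snoc hs c)).2

theorem IsSeq.res_succ (hs : IsSeq lam a s) {y : Ordinal.{u}}
    (hy : ZFSet.pair c.toZFSet y.toZFSet ∈ s) :
    MillerFusion.res s (c + 1) = MillerFusion.snoc (MillerFusion.res s c) y := by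
  have hc := hs.lt hy
  have h1 := hs.res hc.1.le
  symm
  refine hs.eq_res (h1.snoc hc.2) fun z hz => ?_
  rw [MillerFusion.snoc, h1.len_eq, ZFSet.mem_insert_iff] at hz
  rcases hz with rfl | hz
  · exact hy
  · exact res_subset _ _ hz

theorem IsSeq.exists_snoc (hs : IsSeq lam a s) (hc : c < a) : ∃ y < lam.ord,
    ZFSet.pair c.toZFSet y.toZFSet ∈ s ∧
    MillerFusion.res s (c + 1) = MillerFusion.snoc (MillerFusion.res s c) y := by
  obtain ⟨y, hy⟩ := hs.total hc
  exact ⟨y, (hs.lt hy).2, hy, hs.res_succ hy⟩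

/-- A proper initial segment. -/
theorem IsSeq.exists_snoc_subset (hs : IsSeq lam a s) (ht : IsSeq lam b t) (h : t ⊆ s)
    (hba : b < a) : ∃ y < lam.ord, MillerFusion.snoc t y ⊆ s := by
  obtain ⟨y, hy, -, h'⟩ := hs.exists_snoc hba
  refine ⟨y, hy, ?_⟩
  rw [hs.eq_res ht h, ← h']
  exact res_subset _ _

theorem IsSeq.lt_of_ssubset (hs : IsSeq lam a s) (ht : IsSeq lam b t) (h : t ⊆ s) (hne : t ≠ s) :
    b < a := by
  refine (hs.le_of_subset ht h).lt_of_ne ?_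
  rintro rfl
  exact hne (hs.eq_of_subset ht h)

/-- The first difference of two incomparable sequences. -/
theorem IsSeq.exists_first_diff (hs : IsSeq lam a s) (ht : IsSeq lam b t) (h1 : ¬ s ⊆ t)
    (h2 : ¬ t ⊆ s) : ∃ c y y', c < a ∧ c < b ∧ y ≠ y' ∧
      MillerFusion.res s c = MillerFusion.res t c ∧
      MillerFusion.res s (c + 1) = MillerFusion.snoc (MillerFusion.res s c) y ∧
      MillerFusion.res t (c + 1) = MillerFusion.snoc (MillerFusion.res s c) y' := by
  have hex : ∃ c y y' : Ordinal.{u}, y ≠ y' ∧ ZFSet.pair c.toZFSet y.toZFSet ∈ s ∧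
      ZFSet.pair c.toZFSet y'.toZFSet ∈ t := by
    -- If the two sequences never disagree, the shorter one is contained in the longer one.
    by_contra! hno
    rcases le_total a b with hab | hab
    · refine h1 fun z hz => ?_
      obtain ⟨x, hx, y, hy, rfl⟩ := hs.exists_eq_pair hz
      obtain ⟨y', hy'⟩ := ht.total (hx.trans_le hab)
      by_cases hyy : y = y'
      · rwa [hyy]
      · exact (hno x y y' hyy hz hy').elim
    · refine h2 fun z hz => ?_
      obtain ⟨x, hx, y, hy, rfl⟩ := ht.exists_eq_pair hz
      obtain ⟨y', hy'⟩ := hs.total (hx.trans_le hab)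
      by_cases hyy : y' = y
      · rwa [← hyy]
      · exact (hno x y' y hyy hy' hz).elim
  let c := sInf {c : Ordinal.{u} | ∃ y y' : Ordinal.{u}, y ≠ y' ∧ ZFSet.pair c.toZFSet y.toZFSet ∈ s ∧
      ZFSet.pair c.toZFSet y'.toZFSet ∈ t}
  obtain ⟨y, y', hne, hy, hy'⟩ : ∃ y y' : Ordinal.{u}, y ≠ y' ∧
    ZFSet.pair c.toZFSet y.toZFSet ∈ s ∧ ZFSet.pair c.toZFSet y'.toZFSet ∈ t := csInf_mem hex
  have hca := (hs.lt hy).1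
  have hcb := (ht.lt hy').1
  have hres : MillerFusion.res s c = MillerFusion.res t c := by
    refine ht.eq_res (hs.res hca.le) fun z hz => ?_
    obtain ⟨x, hx, w, hw, rfl⟩ := (hs.res hca.le).exists_eq_pair hz
    obtain ⟨w', hw'⟩ := ht.total (hx.trans hcb)
    have : w = w' := by
      by_contra hne
      exact notMem_of_lt_csInf' hx ⟨w, w', hne, res_subset _ _ hz, hw'⟩
    rwa [this]
  exact ⟨c, y, y', hca, hcb, hne, hres, hs.res_succ hy, hres ▸ ht.res_succ hy'⟩

/-- The union of a chain of sequences. -/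
theorem isSeq_iUnion {ι : Type v} [Small.{u} ι] {f : ι → ZFSet.{u}} {g : ι → Ordinal.{u}}
    (hf : ∀ i, IsSeq lam (g i) (f i)) (hc : ∀ i j, f i ⊆ f j ∨ f j ⊆ f i)
    (h1 : ∀ i, g i ≤ a) (h2 : ∀ x < a, ∃ i, x < g i) : IsSeq lam a (ZFSet.iUnion f) := by
  refine isSeq_iff.2 ⟨fun z hz => ?_, fun x hx => ?_, fun x y y' hy hy' => ?_⟩
  · obtain ⟨i, hi⟩ := ZFSet.mem_iUnion.1 hz
    obtain ⟨x, hx, y, hy, rfl⟩ := (hf i).exists_eq_pair hi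
    exact ⟨x, hx.trans_le (h1 i), y, hy, rfl⟩
  · obtain ⟨i, hi⟩ := h2 x hx
    obtain ⟨y, hy⟩ := (hf i).total hi
    exact ⟨y, ZFSet.mem_iUnion.2 ⟨i, hy⟩⟩
  · obtain ⟨i, hi⟩ := ZFSet.mem_iUnion.1 hy
    obtain ⟨j, hj⟩ := ZFSet.mem_iUnion.1 hy'
    rcases hc i j with h | h
    · exact (hf j).functional (h hi) hj
    · exact (hf i).functional hi (h hj)

theorem isSeq_zero_empty : IsSeq lam 0 ∅ :=
  isSeq_iff.2 ⟨fun z hz => (ZFSet.notMem_empty z hz).elim, fun _ hx => (not_lt_bot hx).elim,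
    fun _ _ _ hy => (ZFSet.notMem_empty _ hy).elim⟩

theorem mem_nextSet {p : ZFSet.{u}} (hs : IsSeq lam a s) : c ∈ nextSet lam p s ↔ snoc s c ∈ p := by
  constructor
  · rintro ⟨b, hb, h⟩
    rwa [snoc, hb.len_eq]
  · intro h
    exact ⟨a, hs, by rwa [snoc, hs.len_eq] at h⟩

end

section

/-! ### Trees -/

/-- A nonempty-successor tree of sequences of length less than `lam`, closed at limits. -/
structure IsTree (lam : Cardinal.{u}) (p : ZFSet.{u}) : Prop where
  seq : ∀ s ∈ p, ∃ a < lam.ord, IsSeq lam a s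
  tree : ∀ s ∈ p, ∀ t a, IsSeq lam a t → t ⊆ s → t ∈ p
  closure : ∀ a < lam.ord, Order.IsSuccLimit a → ∀ s, IsSeq lam a s →
    (∀ t, ∀ b < a, IsSeq lam b t → t ⊆ s → t ∈ p) → s ∈ p
  next : ∀ s ∈ p, (nextSet lam p s).Nonempty

theorem IsCobounded.nonempty {lam : Cardinal.{u}} {C : Set Ordinal.{u}} (h : IsCobounded lam C) :
    C.Nonempty := by
  obtain ⟨-, b, hb, h⟩ := h
  exact ⟨b, h b le_rfl hb⟩

/-- A co-bounded set contains two consecutive ordinals. This makes the two alternatives in clause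
(2) of the definition of a condition exclusive. -/
theorem IsCobounded.ne_singleton {lam : Cardinal.{u}} (hlam : lam.IsRegular)
    {C : Set Ordinal.{u}} (h : IsCobounded lam C) (c : Ordinal.{u}) : C ≠ {c} := by
  rintro rfl
  obtain ⟨-, b, hb, h⟩ := h
  have h1 := h b le_rfl hb
  have h2 := h (b + 1) (Order.le_succ b) (hlam.isSuccLimit_ord.add_one_lt hb)
  rw [Set.mem_singleton_iff] at h1 h2
  have : b < b + 1 := Order.lt_add_one_iff.2 le_rfl
  rw [h2, h1] at this
  exact this.false

theorem IsCobounded.mono {lam : Cardinal.{u}} {C C' : Set Ordinal.{u}} (h : IsCobounded lam C)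
    (hC : C ⊆ C') (h' : ∀ c ∈ C', c < lam.ord) : IsCobounded lam C' := by
  obtain ⟨-, b, hb, h⟩ := h
  exact ⟨h', b, hb, fun c hc hc' => hC (h c hc hc')⟩

theorem isCobounded_iInter {lam : Cardinal.{u}} (hlam : lam.IsRegular) {ι : Type v} [Small.{u} ι]
    [Nonempty ι] (hι : Cardinal.lift.{u} #ι < Cardinal.lift.{v} lam) {C : ι → Set Ordinal.{u}}
    (hC : ∀ i, IsCobounded lam (C i)) : IsCobounded lam (⋂ i, C i) := by
  choose h1 b hb h2 using hC
  obtain ⟨d, hd, hbd⟩ := exists_bound hlam hι b hb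
  refine ⟨fun c hc => h1 (Classical.arbitrary ι) c (Set.mem_iInter.1 hc _), d, hd, fun c hc hc' => ?_⟩
  exact Set.mem_iInter.2 fun i => h2 i c ((hbd i).le.trans hc) hc'

theorem IsMillerCondition.isTree {lam : Cardinal.{u}} {p : ZFSet.{u}}
    (hp : IsMillerCondition lam p) : IsTree lam p where
  seq s hs := by
    obtain ⟨a, ha, h, -⟩ := hp.seq s hs
    exact ⟨a, ha, h⟩
  tree := hp.tree
  closure := hp.closure
  next s hs := by
    rcases hp.splitting s hs with ⟨c, hc⟩ | h
    · exact ⟨c, hc ▸ rfl⟩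
    · exact h.nonempty

variable {lam : Cardinal.{u}} {p p' s t : ZFSet.{u}} {a b c : Ordinal.{u}}

theorem IsTree.isSeq (hp : IsTree lam p) (hs : s ∈ p) : IsSeq lam (len s) s := by
  obtain ⟨a, -, h⟩ := hp.seq s hs
  exact h.len

theorem IsTree.len_lt (hp : IsTree lam p) (hs : s ∈ p) : len s < lam.ord := by
  obtain ⟨a, ha, h⟩ := hp.seq s hs
  rwa [h.len_eq]

theorem IsTree.res_mem (hp : IsTree lam p) (hs : s ∈ p) (hb : b ≤ len s) : res s b ∈ p :=
  hp.tree s hs _ b ((hp.isSeq hs).res hb) (res_subset _ _)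

theorem IsTree.len_le (hp : IsTree lam p) (hs : s ∈ p) (ht : t ∈ p) (h : t ⊆ s) :
    len t ≤ len s :=
  (hp.isSeq hs).le_of_subset (hp.isSeq ht) h

theorem IsTree.snoc_lt (hp : IsTree lam p) (hs : s ∈ p) (h : snoc s c ∈ p) : c < lam.ord :=
  (hp.isSeq hs).lt_of_snoc (hp.isSeq h)

theorem IsTree.nextSet_lt (hp : IsTree lam p) : ∀ c ∈ nextSet lam p s, c < lam.ord := by
  rintro c ⟨a, ha, h⟩
  refine ha.lt_of_snoc (c := c) (hp.isSeq ?_)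
  rwa [snoc, ha.len_eq]

theorem IsTree.len_snoc (hp : IsTree lam p) (hs : s ∈ p) (h : snoc s c ∈ p) :
    len (snoc s c) = len s + 1 :=
  ((hp.isSeq hs).snoc (hp.snoc_lt hs h)).len_eq

theorem IsTree.exists_snoc (hp : IsTree lam p) (hs : s ∈ p) : ∃ c, snoc s c ∈ p := by
  obtain ⟨c, hc⟩ := hp.next s hs
  exact ⟨c, (mem_nextSet (hp.isSeq hs)).1 hc⟩

/-- A tree is closed under unions of chains of length less than `lam`. -/
theorem IsTree.iUnion_mem (hp : IsTree lam p) {ι : Type v} [Small.{u} ι] [Nonempty ι]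
    {f : ι → ZFSet.{u}} (hf : ∀ i, f i ∈ p) (hc : ∀ i j, f i ⊆ f j ∨ f j ⊆ f i)
    (h1 : ∀ i, len (f i) ≤ a) (h2 : ∀ x < a, ∃ i, x < len (f i)) (ha : a < lam.ord) :
    ZFSet.iUnion f ∈ p := by
  have hU : IsSeq lam a (ZFSet.iUnion f) := isSeq_iUnion (fun i => hp.isSeq (hf i)) hc h1 h2
  -- Either the longest length is attained, and the union is a member of the chain, or `a` is a
  -- limit and closure at limits applies.
  by_cases hex : ∃ i, len (f i) = a
  · obtain ⟨i, rfl⟩ := hex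
    rw [← hU.eq_of_subset (hp.isSeq (hf i)) (ZFSet.subset_iUnion f i)]
    exact hf i
  · push Not at hex
    have hlt : ∀ i, len (f i) < a := fun i => (h1 i).lt_of_ne (hex i)
    refine hp.closure a ha ?_ _ hU fun t b hb ht hts => ?_
    · rw [Ordinal.isSuccLimit_iff, Order.isSuccPrelimit_iff_succ_lt]
      refine ⟨(pos_of_gt (hlt (Classical.arbitrary ι))).ne', fun b hb => ?_⟩
      obtain ⟨i, hi⟩ := h2 b hb
      exact (Order.succ_le_of_lt hi).trans_lt (hlt i)
    · obtain ⟨i, hi⟩ := h2 b hb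
      refine hp.tree _ (hf i) _ _ ht ?_
      exact hU.subset_of_len_le ht (hp.isSeq (hf i)) hts (ZFSet.subset_iUnion f i) hi.le

/-- The upper-bound hypothesis of `exists_le_forall` for nodes ordered by end-extension; regularity
keeps the union shorter than `lam`. -/
theorem IsTree.exists_chain_bound (hlam : lam.IsRegular) (hp : IsTree lam p) (x₀ : {s // s ∈ p})
    {i : Ordinal.{u}} (hi : i < lam.ord) (f : Ordinal.{u} → {s // s ∈ p})
    (h0 : ∀ j < i, x₀ ≤ f j) (hf : ∀ j k, j ≤ k → k < i → f j ≤ f k) :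
    ∃ y, x₀ ≤ y ∧ ∀ j < i, f j ≤ y := by
  rcases eq_or_ne i 0 with rfl | hi0
  · exact ⟨x₀, le_rfl, fun j hj => (not_lt_bot hj).elim⟩
  have hpos : 0 < i := pos_iff_ne_zero.2 hi0
  have : Nonempty (Set.Iio i) := ⟨⟨0, hpos⟩⟩
  obtain ⟨b, hb, hfb⟩ := exists_bound_Iio hlam hi (fun j => len (f j).1)
    fun j _ => hp.len_lt (f j).2
  let g : Set.Iio i → ZFSet.{u} := fun j => (f j.1).1
  have hbd : BddAbove (Set.range fun j : Set.Iio i => len (g j)) := Ordinal.bddAbove_of_small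
  have hU : ZFSet.iUnion g ∈ p := by
    refine hp.iUnion_mem (a := ⨆ j, len (g j)) (fun j => (f j.1).2) (fun j k => ?_)
      (fun j => le_ciSup hbd j) (fun x hx => (lt_ciSup_iff hbd).1 hx) ?_
    · have hle : ∀ j k : {s // s ∈ p}, j ≤ k → j.1 ⊆ k.1 := fun j k h => h
      rcases le_total j.1 k.1 with h | h
      · exact Or.inl (hle _ _ (hf j.1 k.1 h k.2))
      · exact Or.inr (hle _ _ (hf k.1 j.1 h j.2))
    · have hle : ∀ j : Set.Iio i, len (g j) ≤ b := fun j => (hfb j.1 j.2).le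
      exact lt_of_le_of_lt (ciSup_le hle) hb
  have hsub : ∀ j (hj : j < i), (f j).1 ⊆ ZFSet.iUnion g := fun j hj =>
    ZFSet.subset_iUnion g ⟨j, hj⟩
  exact ⟨⟨_, hU⟩, fun z hz => hsub 0 hpos (h0 0 hpos hz), fun j hj => hsub j hj⟩

/-- Every node has extensions of all lengths below `lam`. -/
theorem IsTree.exists_le_len (hlam : lam.IsRegular) (hp : IsTree lam p) (hs : s ∈ p)
    (hb : b < lam.ord) : ∃ u ∈ p, s ⊆ u ∧ b ≤ len u := by
  have hb1 : b + 1 < lam.ord := hlam.isSuccLimit_ord.add_one_lt hb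
  obtain ⟨y, hy, h⟩ := exists_le_forall (P := {s // s ∈ p}) ⟨s, hs⟩ (b + 1)
    (fun i u => i ≤ len u.1) (fun i x y hxy hx => hx.trans (hp.len_le y.2 x.2 hxy))
    (fun i hi x _ hx => by
      obtain ⟨c, hc⟩ := hp.exists_snoc x.2
      refine ⟨⟨_, hc⟩, subset_snoc _ _, ?_⟩
      -- Otherwise `len x + 1` is an index below `i`, and `x` would already have that length.
      by_contra! hlt
      rw [hp.len_snoc x.2 hc] at hlt
      exact (Order.lt_add_one_iff.2 le_rfl).not_ge (hx _ hlt))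
    (fun i hi f h0 hf => hp.exists_chain_bound hlam _ (hi.trans_lt hb1) f h0 hf)
  exact ⟨y.1, y.2, hy, h b (Order.lt_add_one_iff.2 le_rfl)⟩

/-- A sequence which is comparable with all nodes is a node. -/
theorem IsTree.mem_of_comparable (hlam : lam.IsRegular) (hp : IsTree lam p) (hs : s ∈ p)
    (ht : IsSeq lam a t) (ha : a < lam.ord) (h : ∀ u ∈ p, u ⊆ t ∨ t ⊆ u) : t ∈ p := by
  obtain ⟨u, hu, -, hl⟩ := hp.exists_le_len hlam hs (hlam.isSuccLimit_ord.add_one_lt ha)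
  rcases h u hu with h | h
  · have := ht.le_of_subset (hp.isSeq hu) h
    exact ((Order.lt_add_one_iff.2 le_rfl).not_ge (hl.trans this)).elim
  · exact hp.tree u hu t a ht h

theorem IsTree.subset_or_subset (hp : IsTree lam p) {u v w : ZFSet.{u}} (hu : u ∈ p) (hv : v ∈ p)
    (hw : w ∈ p) (huw : u ⊆ w) (hvw : v ⊆ w) : u ⊆ v ∨ v ⊆ u := by
  rcases le_total (len u) (len v) with h | h
  · exact Or.inl ((hp.isSeq hw).subset_of_len_le (hp.isSeq hu) (hp.isSeq hv) huw hvw h)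
  · exact Or.inr ((hp.isSeq hw).subset_of_len_le (hp.isSeq hv) (hp.isSeq hu) hvw huw h)

theorem IsTree.eq_of_subset (hp : IsTree lam p) (hs : s ∈ p) (ht : t ∈ p) (h : t ⊆ s)
    (hl : len s ≤ len t) : t = s :=
  by_contra fun hne => hl.not_gt ((hp.isSeq hs).lt_of_ssubset (hp.isSeq ht) h hne)

theorem IsTree.empty_mem (hp : IsTree lam p) (hs : s ∈ p) : ∅ ∈ p :=
  hp.tree s hs _ 0 isSeq_zero_empty (ZFSet.empty_subset s)

theorem nextSet_mono (h : p' ⊆ p) : nextSet lam p' s ⊆ nextSet lam p s :=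
  fun _ ⟨a, ha, hc⟩ => ⟨a, ha, h hc⟩

theorem nextSet_congr (hs : IsSeq lam a s) (h : ∀ c, snoc s c ∈ p' ↔ snoc s c ∈ p) :
    nextSet lam p' s = nextSet lam p s := by
  ext c
  rw [mem_nextSet hs, mem_nextSet hs, h]

/-! ### Splitting nodes of conditions -/

theorem IsMillerCondition.isSplitting_of_ne (hp : IsMillerCondition lam p) (hs : s ∈ p)
    {y y' : Ordinal.{u}} (hne : y ≠ y') (hy : snoc s y ∈ p) (hy' : snoc s y' ∈ p) :
    IsSplitting lam p s := by
  have h := hp.isTree.isSeq hs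
  refine ⟨hs, (hp.splitting s hs).resolve_left ?_⟩
  rintro ⟨c, hc⟩
  have h1 : y ∈ nextSet lam p s := (mem_nextSet h).2 hy
  have h2 : y' ∈ nextSet lam p s := (mem_nextSet h).2 hy'
  rw [hc, Set.mem_singleton_iff] at h1 h2
  exact hne (h1.trans h2.symm)

/-- Successor sets grow with the tree, so the one in the larger tree is again co-bounded and not a
singleton. Thus extending a condition never creates splitting nodes. -/
theorem IsSplitting.of_subset (hlam : lam.IsRegular) (hp : IsMillerCondition lam p)
    (h : p' ⊆ p) (hs : IsSplitting lam p' s) : IsSplitting lam p s := by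
  have hs' := h hs.1
  refine ⟨hs', (hp.splitting s hs').resolve_left ?_⟩
  rintro ⟨c, hc⟩
  exact (hs.2.mono (nextSet_mono h) hp.isTree.nextSet_lt).ne_singleton hlam c hc

/-- The fact that makes regular cardinals special in requirement (b): at a branch of regular length
there is no successor left to choose. -/
theorem IsMillerCondition.not_isRegularOrd_len (hlam : lam.IsRegular)
    (hp : IsMillerCondition lam p) (hs : IsSplitting lam p s) : ¬ IsRegularOrd (len s) :=
  fun h => hs.2.ne_singleton hlam 0 (hp.regular s hs.1 _ h (hp.isTree.isSeq hs.1))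

/-- The least splitting node extending a given node; it is comparable with all nodes extending the
given one. -/
theorem IsMillerCondition.exists_next_splitting (hp : IsMillerCondition lam p) (hs : s ∈ p) :
    ∃ v, s ⊆ v ∧ IsSplitting lam p v ∧ (∀ w, IsSplitting lam p w → s ⊆ w → w ⊆ v → w = v) ∧
      ∀ w ∈ p, s ⊆ w → w ⊆ v ∨ v ⊆ w := by
  let A : Set Ordinal.{u} := {c | ∃ v, s ⊆ v ∧ IsSplitting lam p v ∧ len v = c}
  have hA : A.Nonempty := by
    obtain ⟨t, ht, ht'⟩ := hp.dense s hs
    exact ⟨_, t, ht, ht', rfl⟩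
  obtain ⟨v, hsv, hv, hl⟩ := csInf_mem hA
  have hT := hp.isTree
  have hmin : ∀ w, IsSplitting lam p w → s ⊆ w → w ⊆ v → w = v := by
    intro w hw hsw hwv
    refine hT.eq_of_subset hv.1 hw.1 hwv ?_
    rw [hl]
    exact csInf_le' ⟨w, hsw, hw, rfl⟩
  refine ⟨v, hsv, hv, hmin, fun w hw hsw => ?_⟩
  by_contra! hno
  obtain ⟨c, y, y', hcw, hcv, hne, heq, h1, h2⟩ :=
    (hT.isSeq hw).exists_first_diff (hT.isSeq hv.1) hno.1 hno.2
  -- Both `w` and `v` extend `s`, so they cannot differ below its length. At their first difference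
  -- `p` splits, and this happens between `s` and `v`, against the minimality of `v`.
  have hcs : len s ≤ c := by
    by_contra! hlt
    have e1 := (hT.isSeq hw).res_eq_of_subset (hT.isSeq hs) hsw
      (Order.add_one_le_iff.2 hlt)
    have e2 := (hT.isSeq hv.1).res_eq_of_subset (hT.isSeq hs) hsv
      (Order.add_one_le_iff.2 hlt)
    have e3 : snoc (res w c) y = snoc (res w c) y' := by rw [← h1, ← h2, ← e1, ← e2]
    have hy : y < lam.ord := by
      refine ((hT.isSeq hw).res hcw.le).lt_of_snoc (b := c + 1) ?_
      exact h1 ▸ (hT.isSeq hw).res (Order.add_one_le_iff.2 hcw)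
    exact hne (((hT.isSeq hw).res hcw.le).snoc_injective hy e3)
  have hsplit : IsSplitting lam p (res v c) := by
    refine hp.isSplitting_of_ne (hT.res_mem hv.1 hcv.le) hne ?_ ?_
    · rw [← heq, ← h1]
      exact hT.res_mem hw (Order.add_one_le_iff.2 hcw)
    · rw [← heq, ← h2]
      exact hT.res_mem hv.1 (Order.add_one_le_iff.2 hcv)
  have hsub : s ⊆ res v c := by
    rw [(hT.isSeq hv.1).eq_res (hT.isSeq hs) hsv]
    exact res_mono _ hcs
  have := hmin _ hsplit hsub (res_subset _ _)
  have hl := ((hT.isSeq hv.1).res hcv.le).len_eq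
  rw [this] at hl
  exact hcv.ne hl.symm

/-- A node comparable with all nodes of `p` is not longer than any splitting node. -/
theorem IsSplitting.len_le_of_comparable (hlam : lam.IsRegular) (hp : IsTree lam p)
    (hs : IsSplitting lam p s) (ht : t ∈ p) (h : ∀ u ∈ p, u ⊆ t ∨ t ⊆ u) :
    len t ≤ len s := by
  by_contra! hlt
  have hsq := hp.isSeq hs.1
  -- If `t` were longer than `s`, every immediate successor of `s` would lie below `t`, but `t` has
  -- only one value at `len s`.
  have key : ∀ y ∈ nextSet lam p s, snoc s y ⊆ t := by
    intro y hy
    have hy' := (mem_nextSet hsq).1 hy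
    rcases h _ hy' with h' | h'
    · exact h'
    · have := hp.len_le hy' ht h'
      rw [hp.len_snoc hs.1 hy'] at this
      rw [hp.eq_of_subset hy' ht h' (by rw [hp.len_snoc hs.1 hy']; exact Order.add_one_le_iff.2 hlt)]
  obtain ⟨-, b, hb, hC⟩ := hs.2
  have h1 := key b (hC b le_rfl hb)
  have hb' := hlam.isSuccLimit_ord.add_one_lt hb
  have h2 := key (b + 1) (hC _ (Order.le_succ b) hb')
  have := (hp.isSeq ht).functional (h1 (pair_mem_snoc hsq b)) (h2 (pair_mem_snoc hsq (b + 1)))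
  have h3 : b < b + 1 := Order.lt_add_one_iff.2 le_rfl
  exact h3.ne this

theorem IsSeq.exists_value_bound (hlam : lam.IsRegular) (hs : IsSeq lam a s) (ha : a < lam.ord) :
    ∃ b < lam.ord, ∀ x y : Ordinal.{u}, ZFSet.pair x.toZFSet y.toZFSet ∈ s → y < b := by
  have : ∀ x, ∃ y : Ordinal.{u}, x < a → ZFSet.pair x.toZFSet y.toZFSet ∈ s := fun x => by
    by_cases hx : x < a
    · obtain ⟨y, hy⟩ := hs.total hx
      exact ⟨y, fun _ => hy⟩
    · exact ⟨0, fun h => (hx h).elim⟩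
  choose f hf using this
  obtain ⟨b, hb, h⟩ := exists_bound_Iio hlam ha f fun j hj => (hs.lt (hf j hj)).2
  refine ⟨b, hb, fun x y hy => ?_⟩
  have hx := (hs.lt hy).1
  rw [hs.functional hy (hf x hx)]
  exact h x hx

/-! ### Intersections of short chains of conditions -/

section Inter

variable {ι : Type v} {f : ι → ZFSet.{u}}

theorem nextSet_inter [Nonempty ι] (hp : ∀ s, s ∈ p ↔ ∀ i, s ∈ f i) (s : ZFSet.{u}) :
    nextSet lam p s = ⋂ i, nextSet lam (f i) s := by
  ext c
  rw [Set.mem_iInter]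
  constructor
  · rintro ⟨a, ha, h⟩ i
    exact ⟨a, ha, (hp _).1 h i⟩
  · intro h
    obtain ⟨a, ha, -⟩ := h (Classical.arbitrary ι)
    refine ⟨a, ha, (hp _).2 fun i => ?_⟩
    obtain ⟨a', ha', h'⟩ := h i
    rwa [← ha.len_eq, ha'.len_eq]

/-- Successor sets cause no trouble: fewer than `lam` co-bounded sets have co-bounded intersection,
and one singleton in the chain forces the intersection to be that singleton. The work is in finding
splitting nodes of the intersection. A branch is built in `ω` steps that passes splitting nodes of
every `f i` cofinally; its limit has singular length and values below that length, so by clause (5)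
it splits in every `f i` at once. -/
theorem isMillerCondition_inter (hlam : lam.IsRegular) (hlam' : ℵ₀ < lam) [Small.{u} ι]
    [Nonempty ι] (hι : Cardinal.lift.{u} #ι < Cardinal.lift.{v} lam)
    (hf : ∀ i, IsMillerCondition lam (f i)) (hc : ∀ i j, f i ⊆ f j ∨ f j ⊆ f i)
    (hp : ∀ s, s ∈ p ↔ ∀ i, s ∈ f i) : IsMillerCondition lam p := by
  let i₀ := Classical.arbitrary ι
  have hcob : ∀ s, (∀ i, IsSplitting lam (f i) s) → IsSplitting lam p s := by
    intro s hs
    refine ⟨(hp s).2 fun i => (hs i).1, ?_⟩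
    rw [nextSet_inter hp]
    exact isCobounded_iInter hlam hι fun i => (hs i).2
  have hsplit : ∀ s ∈ p, (∃ c, nextSet lam p s = {c}) ∨ IsCobounded lam (nextSet lam p s) := by
    intro s hs
    rw [nextSet_inter hp]
    by_cases hall : ∀ i, IsCobounded lam (nextSet lam (f i) s)
    · exact Or.inr (isCobounded_iInter hlam hι hall)
    push Not at hall
    obtain ⟨i, hi⟩ := hall
    obtain ⟨c, hci⟩ := ((hf i).splitting s ((hp s).1 hs i)).resolve_right hi
    refine Or.inl ⟨c, Set.Subset.antisymm ?_ ?_⟩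
    · rw [← hci]
      exact Set.iInter_subset _ i
    · rw [Set.singleton_subset_iff, Set.mem_iInter]
      intro j
      -- If `f j` is the smaller tree, its nonempty successor set is contained in `{c}`.
      rcases hc i j with h | h
      · have hcc : c ∈ nextSet lam (f i) s := hci ▸ rfl
        exact nextSet_mono h hcc
      · obtain ⟨d, hd⟩ := (hf j).isTree.next s ((hp s).1 hs j)
        have := nextSet_mono h hd
        rw [hci, Set.mem_singleton_iff] at this
        rwa [← this]
  have hclosure : ∀ a < lam.ord, Order.IsSuccLimit a → ∀ s, IsSeq lam a s →
      (∀ t, ∀ b < a, IsSeq lam b t → t ⊆ s → t ∈ p) → s ∈ p := fun a ha hl s hs h =>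
    (hp s).2 fun i => (hf i).closure a ha hl s hs fun t b hb ht hts => (hp t).1 (h t b hb ht hts) i
  have htree : ∀ s ∈ p, ∀ t a, IsSeq lam a t → t ⊆ s → t ∈ p := fun s hs t a ht hts =>
    (hp t).2 fun i => (hf i).tree s ((hp s).1 hs i) t a ht hts
  have hseq : ∀ s ∈ p, ∃ a < lam.ord, IsSeq lam a s ∧ IsIncreasingSeq s := fun s hs =>
    (hf i₀).seq s ((hp s).1 hs i₀)
  have hT : IsTree lam p :=
    { seq := fun s hs => (hf i₀).isTree.seq s ((hp s).1 hs i₀)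
      tree := htree
      closure := hclosure
      next := fun s hs => by
        rcases hsplit s hs with ⟨c, hc⟩ | h
        · exact ⟨c, hc ▸ rfl⟩
        · exact h.nonempty }
  refine ⟨⟨∅, (hp _).2 fun i => ?_⟩, hseq, htree, hclosure, hsplit, ?_, ?_, ?_⟩
  · obtain ⟨s, hs⟩ := (hf i).nonempty
    exact (hf i).isTree.empty_mem hs
  · intro s hs a ha hsa
    rw [nextSet_inter hp]
    simp only [fun i => (hf i).regular s ((hp s).1 hs i) a ha hsa, Set.iInter_const]
  · intro s hs
    -- One step of the interleaving: `u'` passes the next splitting node above `u` of every `f i`.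
    -- Its length also exceeds all values of `u`, so that the limit maps its length into itself as
    -- clause (5) requires.
    have hstep : ∀ u : {u // u ∈ p}, ∃ u' : {u // u ∈ p}, u.1 ⊆ u'.1 ∧ len u.1 < len u'.1 ∧
        (∀ i, ∃ v, u.1 ⊆ v ∧ v ⊆ u'.1 ∧ IsSplitting lam (f i) v) ∧
        ∀ x y : Ordinal.{u}, ZFSet.pair x.toZFSet y.toZFSet ∈ u.1 → y < len u'.1 := by
      rintro ⟨u, hu⟩
      choose v huv hv _ hcomp using fun i => (hf i).exists_next_splitting ((hp u).1 hu i)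
      obtain ⟨b₁, hb₁, h₁⟩ := exists_bound hlam hι (fun i => len (v i))
        fun i => (hf i).isTree.len_lt (hv i).1
      obtain ⟨b₂, hb₂, h₂⟩ := (hT.isSeq hu).exists_value_bound hlam (hT.len_lt hu)
      have hlu := hlam.isSuccLimit_ord.add_one_lt (hT.len_lt hu)
      obtain ⟨u', hu', huu', hl⟩ := hT.exists_le_len hlam hu
        (max_lt (max_lt hb₁ hb₂) hlu)
      have hl1 : b₁ ≤ len u' := ((le_max_left _ _).trans (le_max_left _ _)).trans hl
      have hl2 : b₂ ≤ len u' := ((le_max_right _ _).trans (le_max_left _ _)).trans hl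
      refine ⟨⟨u', hu'⟩, huu', Order.add_one_le_iff.1 ((le_max_right _ _).trans hl),
        fun i => ⟨v i, huv i, ?_, hv i⟩, fun x y hxy => (h₂ x y hxy).trans_le hl2⟩
      rcases hcomp i u' ((hp u').1 hu' i) huu' with h | h
      · have := (hf i).isTree.len_le (hv i).1 ((hp u').1 hu' i) h
        exact (((h₁ i).trans_le hl1).not_ge this).elim
      · exact h
    choose g hg1 hg2 hg3 hg4 using hstep
    have hω : Ordinal.omega0.{u} < lam.ord := by simpa [Cardinal.lt_ord] using hlam'
    -- Starting above `ω` is essential: a limit of length `ω` would be regular and could not split.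
    obtain ⟨u₀, hu₀, hsu₀, hlu₀⟩ := hT.exists_le_len hlam hs
      (hlam.isSuccLimit_ord.add_one_lt hω)
    let F : ℕ → {u // u ∈ p} := fun n => g^[n] ⟨u₀, hu₀⟩
    have hF : ∀ n, F (n + 1) = g (F n) := fun n => Function.iterate_succ_apply' _ _ _
    have hmono : ∀ m n, m ≤ n → (F m).1 ⊆ (F n).1 := by
      intro m n hmn
      induction n, hmn using Nat.le_induction with
      | base => exact fun _ h => h
      | succ n _ ih =>
        intro z hz
        rw [hF]
        exact hg1 _ (ih hz)
    have hbd : BddAbove (Set.range fun n => len (F n).1) := Ordinal.bddAbove_of_small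
    obtain ⟨b, hb, hFb⟩ := exists_bound_nat hlam hlam' (fun n => len (F n).1)
      fun n => hT.len_lt (F n).2
    obtain ⟨a, ha⟩ : ∃ a, a = ⨆ n, len (F n).1 := ⟨_, rfl⟩
    have hle : ∀ n, len (F n).1 ≤ a := fun n => ha ▸ le_ciSup hbd n
    have hcof : ∀ x < a, ∃ n, x < len (F n).1 := fun x hx => (lt_ciSup_iff hbd).1 (ha ▸ hx)
    have hlt : ∀ n, len (F n).1 < a := fun n => by
      refine lt_of_lt_of_le ?_ (hle (n + 1))
      rw [hF]
      exact hg2 _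
    have halam : a < lam.ord := by
      rw [ha]
      exact (ciSup_le fun n => (hFb n).le).trans_lt hb
    have hchain : ∀ m n, (F m).1 ⊆ (F n).1 ∨ (F n).1 ⊆ (F m).1 := fun m n =>
      (le_total m n).imp (hmono m n) (hmono n m)
    let G : ℕ → ZFSet.{u} := fun n => (F n).1
    have hU : ZFSet.iUnion G ∈ p := hT.iUnion_mem (fun n => (F n).2) hchain hle hcof halam
    have hUseq : IsSeq lam a (ZFSet.iUnion G) :=
      isSeq_iUnion (fun n => hT.isSeq (F n).2) hchain hle hcof
    have hGU : ∀ n, (F n).1 ⊆ ZFSet.iUnion G := fun n => ZFSet.subset_iUnion G n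
    have hsing : IsSingularOrd a := by
      refine isSingularOrd_of_nat_seq ?_ _ hlt hcof
      refine lt_trans ?_ (hlt 0)
      exact Order.add_one_le_iff.1 hlu₀
    refine ⟨ZFSet.iUnion G, fun z hz => hGU 0 (hsu₀ hz), hcob _ fun i => ?_⟩
    refine (hf i).singular a halam hsing _ ((hp _).1 hU i) ⟨fun z hz => ?_, hUseq.2⟩ ?_
    · obtain ⟨x, hx, y, hy, rfl⟩ := hUseq.exists_eq_pair hz
      refine ZFSet.pair_mem_prod.2 ⟨Ordinal.toZFSet_mem_toZFSet_iff.2 hx,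
        Ordinal.toZFSet_mem_toZFSet_iff.2 ?_⟩
      obtain ⟨n, hn⟩ := ZFSet.mem_iUnion.1 hz
      have h4 := hg4 _ _ _ hn
      rw [← hF] at h4
      exact h4.trans (hlt _)
    · intro b hb
      obtain ⟨n, hn⟩ := hcof b hb
      obtain ⟨v, hv1, hv2, hv3⟩ := hg3 (F n) i
      rw [← hF] at hv2
      have hT' := (hf i).isTree
      have hFi : ∀ n, (F n).1 ∈ f i := fun n => (hp _).1 (F n).2 i
      exact ⟨len v, hn.le.trans (hT'.len_le hv3.1 (hFi n) hv1),
        (hT'.len_le (hFi (n + 1)) hv3.1 hv2).trans_lt (hlt _), v, hT'.isSeq hv3.1,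
        fun z hz => hGU _ (hv2 hz), hv3⟩
  · intro a ha hsing s hs hsa h
    refine hcob s fun i => (hf i).singular a ha hsing s ((hp s).1 hs i) hsa fun b hb => ?_
    obtain ⟨c, hc1, hc2, t, ht, hts, hspl⟩ := h b hb
    exact ⟨c, hc1, hc2, t, ht, hts, hspl.of_subset hlam (hf i) fun z hz => (hp z).1 hz i⟩

end Inter

end

section

variable {lam : Cardinal.{u}} {p p' p'' r s t : ZFSet.{u}} {a b c mu : Ordinal.{u}}

/-! ### Restricting a condition to a node -/

/-- The nodes of `p` comparable with `t`. -/
def restr (p t : ZFSet.{u}) : ZFSet.{u} := ZFSet.sep (fun u => u ⊆ t ∨ t ⊆ u) p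

theorem mem_restr : s ∈ restr p t ↔ s ∈ p ∧ (s ⊆ t ∨ t ⊆ s) := ZFSet.mem_sep

theorem restr_subset : restr p t ⊆ p := ZFSet.sep_subset

theorem restr_mono (h : p' ⊆ p) : restr p' t ⊆ restr p t := fun _ hu =>
  mem_restr.2 ⟨h (mem_restr.1 hu).1, (mem_restr.1 hu).2⟩

theorem self_mem_restr (ht : t ∈ p) : t ∈ restr p t := mem_restr.2 ⟨ht, Or.inl fun _ h => h⟩

theorem nextSet_restr_of_subset (hs : IsSeq lam a s) (h : t ⊆ s) :
    nextSet lam (restr p t) s = nextSet lam p s :=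
  nextSet_congr hs fun c => by
    rw [mem_restr, and_iff_left]
    exact Or.inr fun z hz => subset_snoc s c (h hz)

theorem nextSet_restr_of_ssubset (hp : IsTree lam p) (ht : t ∈ p) (hs : s ∈ p) (h : s ⊆ t)
    (hne : s ≠ t) : ∃ y, snoc s y ∈ p ∧ nextSet lam (restr p t) s = {y} := by
  have hs' := hp.isSeq hs
  have ht' := hp.isSeq ht
  have hlt := ht'.lt_of_ssubset hs' h hne
  obtain ⟨y, hy, hyt⟩ := ht'.exists_snoc_subset hs' h hlt
  have hyp := hp.tree t ht _ _ (hs'.snoc hy) hyt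
  refine ⟨y, hyp, ?_⟩
  ext c
  rw [mem_nextSet hs', mem_restr, Set.mem_singleton_iff]
  constructor
  · rintro ⟨hc, hct⟩
    have hsub : snoc s c ⊆ t := by
      rcases hct with hct | hct
      · exact hct
      · rw [hp.eq_of_subset hc ht hct (by rw [hp.len_snoc hs hc]; exact Order.add_one_le_iff.2 hlt)]
    exact ht'.functional (hsub (pair_mem_snoc hs' c)) (hyt (pair_mem_snoc hs' y))
  · rintro rfl
    exact ⟨hyp, Or.inl hyt⟩

/-- Strictly below `t` the only remaining successor is the one leading to `t`; from `t` on nothing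
is removed. -/
theorem isSplitting_restr_iff (hlam : lam.IsRegular) (hp : IsTree lam p) (ht : t ∈ p) :
    IsSplitting lam (restr p t) s ↔ IsSplitting lam p s ∧ t ⊆ s := by
  constructor
  · rintro ⟨h1, h2⟩
    obtain ⟨hs, hst⟩ := mem_restr.1 h1
    have hsub : t ⊆ s := by
      by_contra hno
      obtain ⟨y, -, hy⟩ := nextSet_restr_of_ssubset hp ht hs (hst.resolve_right hno)
        (fun h => hno (h ▸ fun _ h => h))
      exact h2.ne_singleton hlam y hy
    refine ⟨⟨hs, ?_⟩, hsub⟩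
    rwa [nextSet_restr_of_subset (hp.isSeq hs) hsub] at h2
  · rintro ⟨h1, h2⟩
    refine ⟨mem_restr.2 ⟨h1.1, Or.inr h2⟩, ?_⟩
    rw [nextSet_restr_of_subset (hp.isSeq h1.1) h2]
    exact h1.2

theorem isMillerCondition_restr (hlam : lam.IsRegular) (hp : IsMillerCondition lam p)
    (ht : t ∈ p) : IsMillerCondition lam (restr p t) := by
  have hT := hp.isTree
  have ht' := hT.isSeq ht
  refine ⟨⟨t, self_mem_restr ht⟩, fun s hs => hp.seq s (restr_subset hs), ?_, ?_, ?_, ?_, ?_, ?_⟩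
  · intro s hs v a hv hvs
    obtain ⟨hs, hst⟩ := mem_restr.1 hs
    have hvp := hp.tree s hs v a hv hvs
    refine mem_restr.2 ⟨hvp, ?_⟩
    rcases hst with h | h
    · exact Or.inl fun z hz => h (hvs hz)
    · exact hT.subset_or_subset hvp ht hs hvs h
  · intro a ha hl s hs h
    have hsp := hp.closure a ha hl s hs fun v b hb hv hvs => restr_subset (h v b hb hv hvs)
    refine mem_restr.2 ⟨hsp, ?_⟩
    have hres : ∀ b < a, res s b ⊆ t ∨ t ⊆ res s b := fun b hb =>
      (mem_restr.1 (h _ b hb (hs.res hb.le) (res_subset _ _))).2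
    rcases le_or_gt a (len t) with hat | hat
    · left
      intro z hz
      obtain ⟨x, hx, y, hy, rfl⟩ := hs.exists_eq_pair hz
      have hx1 := hl.add_one_lt hx
      have hmem : ZFSet.pair x.toZFSet y.toZFSet ∈ res s (x + 1) :=
        pair_mem_res.2 ⟨Order.lt_add_one_iff.2 le_rfl, hz⟩
      rcases hres _ hx1 with h' | h'
      · exact h' hmem
      · have := (hs.res hx1.le).le_of_subset ht' h'
        exact ((this.trans_lt hx1).not_ge hat).elim
    · right
      rcases hres _ hat with h' | h'
      · rw [← ht'.eq_of_subset (hs.res hat.le) h']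
        exact res_subset _ _
      · exact fun z hz => res_subset _ _ (h' hz)
  · intro s hs
    obtain ⟨hs, hst⟩ := mem_restr.1 hs
    by_cases h : t ⊆ s
    · rw [nextSet_restr_of_subset (hT.isSeq hs) h]
      exact hp.splitting s hs
    · obtain ⟨y, -, hy⟩ := nextSet_restr_of_ssubset hT ht hs (hst.resolve_right h)
        (fun h' => h (h' ▸ fun _ h => h))
      exact Or.inl ⟨y, hy⟩
  · intro s hs a ha hsa
    obtain ⟨hs, hst⟩ := mem_restr.1 hs
    have hreg := hp.regular s hs a ha hsa
    by_cases h : t ⊆ s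
    · rw [nextSet_restr_of_subset (hT.isSeq hs) h, hreg]
    · obtain ⟨y, hy1, hy⟩ := nextSet_restr_of_ssubset hT ht hs (hst.resolve_right h)
        (fun h' => h (h' ▸ fun _ h => h))
      have : y ∈ nextSet lam p s := (mem_nextSet (hT.isSeq hs)).2 hy1
      rw [hreg, Set.mem_singleton_iff] at this
      rw [hy, this]
  · intro s hs
    obtain ⟨hs, hst⟩ := mem_restr.1 hs
    rcases hst with h | h
    · obtain ⟨v, hv, hv'⟩ := hp.dense t ht
      exact ⟨v, fun z hz => hv (h hz), (isSplitting_restr_iff hlam hT ht).2 ⟨hv', hv⟩⟩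
    · obtain ⟨v, hv, hv'⟩ := hp.dense s hs
      exact ⟨v, hv, (isSplitting_restr_iff hlam hT ht).2 ⟨hv', fun z hz => hv (h hz)⟩⟩
  · intro a ha hsing s hs hsa h
    have hpos : 0 < a := hsing.1.bot_lt
    -- A single splitting node of the restriction below `s` already places `s` above `t`, where
    -- clause (5) for `p` applies.
    obtain ⟨c, -, hca, v, hv, hvs, hv'⟩ := h 0 hpos
    have hts := ((isSplitting_restr_iff hlam hT ht).1 hv').2
    refine (isSplitting_restr_iff hlam hT ht).2 ⟨?_, fun z hz => hvs (hts hz)⟩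
    refine hp.singular a ha hsing s (restr_subset hs) hsa fun b hb => ?_
    obtain ⟨c, hbc, hca, v, hv, hvs, hv'⟩ := h b hb
    exact ⟨c, hbc, hca, v, hv, hvs, ((isSplitting_restr_iff hlam hT ht).1 hv').1⟩

/-! ### The splitting rank of a node -/

/-- The lengths of the splitting initial segments of `s`. -/
def spl (lam : Cardinal.{u}) (p s : ZFSet.{u}) : Set Ordinal.{u} :=
  {b | IsSplitting lam p (res s b)}

/-- The order type of the set of splitting nodes properly below `s`. -/
def tau (lam : Cardinal.{u}) (p s : ZFSet.{u}) : Ordinal.{u} := cnt (spl lam p s) (len s)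

/-- The ranks along one branch are all values of the collapse of one set of lengths, so monotonicity
of `tau` reduces to that of `cnt`. -/
theorem tau_res (hs : IsSeq lam a s) (hb : b ≤ a) : tau lam p (res s b) = cnt (spl lam p s) b := by
  rw [tau, (hs.res hb).len_eq]
  refine cnt_congr fun c hc => ?_
  rw [spl, spl, Set.mem_ofPred_eq, Set.mem_ofPred_eq, res_res _ hc.le]

theorem tau_eq (hs : IsSeq lam a s) : tau lam p s = cnt (spl lam p s) a := by
  rw [tau, hs.len_eq]

theorem tau_mono (hs : IsSeq lam a s) (ht : IsSeq lam b t) (h : t ⊆ s) :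
    tau lam p t ≤ tau lam p s := by
  have hba := hs.le_of_subset ht h
  rw [hs.eq_res ht h, tau_res hs hba, tau_eq hs]
  exact cnt_mono _ hba

theorem tau_lt_tau (hs : IsSeq lam a s) (ht : IsSeq lam b t) (h : t ⊆ s) (hba : b < a)
    (hsplit : IsSplitting lam p t) : tau lam p t < tau lam p s := by
  have hres := hs.eq_res ht h
  have hb : b ∈ spl lam p s := by rwa [spl, Set.mem_ofPred_eq, ← hres]
  rw [hres, tau_res hs hba.le, tau_eq hs]
  exact cnt_lt_cnt hba hb

theorem tau_le_len (hs : IsSeq lam a s) : tau lam p s ≤ a := by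
  rw [tau_eq hs]
  exact cnt_le_self _ _

theorem tau_le_tau_of_subset (hlam : lam.IsRegular) (hp : IsMillerCondition lam p) (h : p' ⊆ p) :
    tau lam p' s ≤ tau lam p s :=
  cnt_le_cnt fun _ _ hc => IsSplitting.of_subset hlam hp h hc

/-- Splitting nodes below `s` correspond to their lengths, and the collapse identifies these lengths
with an ordinal, which is unique. From here on the order type is handled as an ordinal-valued rank.
-/
theorem hasSplittingType_iff (hp : IsTree lam p) (hs : s ∈ p) :
    HasSplittingType lam p s a ↔ tau lam p s = a := by
  have hs' := hp.isSeq hs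
  let f : {c // c ∈ spl lam p s ∧ c < len s} → splittingBelow lam p s := fun c =>
    ⟨res s c.1, c.2.1, res_subset _ _, fun h => by
      have := (hs'.res c.2.2.le).len_eq
      rw [h] at this
      exact c.2.2.ne this.symm⟩
  have hlenf : ∀ c, len (f c).1 = c.1 := fun c => (hs'.res c.2.2.le).len_eq
  have hf : Function.Bijective f := by
    constructor
    · intro c d hcd
      apply Subtype.ext
      rw [← hlenf c, hcd, hlenf d]
    · rintro ⟨t, ht, hts, hne⟩
      have ht' := hp.isSeq ht.1
      have hres := hs'.eq_res ht' hts
      refine ⟨⟨len t, ?_, hs'.lt_of_ssubset ht' hts hne⟩, Subtype.ext hres.symm⟩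
      rwa [spl, Set.mem_ofPred_eq, ← hres]
  let e : (fun c d : {c // c ∈ spl lam p s ∧ c < len s} => c ≤ d) ≃r
      (fun x y : splittingBelow lam p s => x.1 ⊆ y.1) :=
    ⟨Equiv.ofBijective f hf, fun {c d} => by
      constructor
      · intro h
        have := hp.len_le (f d).2.1.1 (f c).2.1.1 h
        rwa [hlenf, hlenf] at this
      · intro h
        exact res_mono _ h⟩
  obtain ⟨g⟩ := nonempty_cnt_iso (spl lam p s) (len s)
  constructor
  · rintro ⟨k⟩
    exact eq_of_Iio_iso (RelIso.trans g.symm (RelIso.trans e k))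
  · rintro rfl
    exact ⟨RelIso.trans e.symm g⟩

/-! ### Fronts -/

/-- `s` is a minimal node of `p` of splitting rank at least `mu`. -/
def IsMinNode (lam : Cardinal.{u}) (mu : Ordinal.{u}) (p s : ZFSet.{u}) : Prop :=
  s ∈ p ∧ mu ≤ tau lam p s ∧ ∀ b < len s, tau lam p (res s b) < mu

/-- The rank is the least strict upper bound of the ranks of the splitting nodes below, and
minimality puts all of these below `mu`. -/
theorem IsMinNode.tau_eq (hp : IsTree lam p) (hs : IsMinNode lam mu p s) : tau lam p s = mu := by
  refine le_antisymm (cnt_le_iff.2 fun c hc hcs => ?_) hs.2.1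
  rw [← tau_res (hp.isSeq hs.1) hc.le]
  exact hs.2.2 c hc

theorem exists_isMinNode (hp : IsTree lam p) (hs : s ∈ p) (h : mu ≤ tau lam p s) :
    ∃ b ≤ len s, IsMinNode lam mu p (res s b) := by
  have hs' := hp.isSeq hs
  have hne : {b | b ≤ len s ∧ mu ≤ tau lam p (res s b)}.Nonempty :=
    ⟨len s, le_rfl, by rwa [hs'.res_self]⟩
  obtain ⟨h1, h2⟩ := csInf_mem hne
  refine ⟨_, h1, hp.res_mem hs h1, h2, fun c hc => ?_⟩
  rw [(hs'.res h1).len_eq] at hc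
  rw [res_res _ hc.le]
  by_contra! hge
  exact notMem_of_lt_csInf' hc ⟨hc.le.trans h1, hge⟩

theorem IsMinNode.eq_of_subset (hp : IsTree lam p) (hs : IsMinNode lam mu p s)
    (ht : IsMinNode lam mu p t) (h : t ⊆ s) : t = s := by
  by_contra hne
  have hs' := hp.isSeq hs.1
  have ht' := hp.isSeq ht.1
  have := hs.2.2 _ (hs'.lt_of_ssubset ht' h hne)
  rw [← hs'.eq_res ht' h] at this
  exact this.not_ge ht.2.1

theorem mem_split_iff (hp : IsTree lam p) : s ∈ split lam mu p ↔ IsMinNode lam mu p s := by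
  constructor
  · rintro ⟨hs, hst, hmin⟩
    have htau := (hasSplittingType_iff hp hs).1 hst
    have hs' := hp.isSeq hs
    refine ⟨hs, htau.ge, fun b hb => lt_of_le_of_ne ?_ fun heq => ?_⟩
    · rw [← htau]
      exact tau_mono hs' (hs'.res hb.le) (res_subset _ _)
    · have hm := hp.res_mem hs hb.le
      have := hmin _ hm (res_subset _ _) ((hasSplittingType_iff hp hm).2 heq)
      have hl := (hs'.res hb.le).len_eq
      rw [this] at hl
      exact hb.ne hl.symm
  · intro hs
    refine ⟨hs.1, (hasSplittingType_iff hp hs.1).2 (hs.tau_eq hp), fun t ht hts htt => ?_⟩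
    by_contra hne
    have hs' := hp.isSeq hs.1
    have ht' := hp.isSeq ht
    have := hs.2.2 _ (hs'.lt_of_ssubset ht' hts hne)
    rw [← hs'.eq_res ht' hts, (hasSplittingType_iff hp ht).1 htt] at this
    exact this.false

/-- The front of `p` at level `mu`: the nonsplitting minimal nodes of rank `mu` and the immediate
successors of the splitting ones. -/
def front (lam : Cardinal.{u}) (mu : Ordinal.{u}) (p : ZFSet.{u}) : Set ZFSet.{u} :=
  {t | t ∈ p ∧ ∃ s, IsMinNode lam mu p s ∧
    ((t = s ∧ ¬ IsSplitting lam p s) ∨ (IsSplitting lam p s ∧ ∃ c, t = snoc s c))}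

theorem exists_isMinNode_subset_of_mem_front (ht : t ∈ front lam mu p) :
    ∃ s, s ⊆ t ∧ IsMinNode lam mu p s := by
  obtain ⟨-, s, hs, ⟨rfl, -⟩ | ⟨-, c, rfl⟩⟩ := ht
  · exact ⟨t, fun _ h => h, hs⟩
  · exact ⟨s, subset_snoc s c, hs⟩

/-- Minimal nodes on a common branch coincide. Two front nodes on it are therefore both equal to
that node or both one longer than it, hence of equal length. -/
theorem front_antichain (hp : IsTree lam p) {u : ZFSet.{u}} (hu : u ∈ p)
    (ht : t ∈ front lam mu p) (hs : s ∈ front lam mu p) (htu : t ⊆ u) (hsu : s ⊆ u) : t = s := by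
  obtain ⟨htp, t', ht', hT⟩ := ht
  obtain ⟨hsp, s', hs', hS⟩ := hs
  have ht't : t' ⊆ t := by
    rcases hT with ⟨rfl, -⟩ | ⟨-, c, rfl⟩
    · exact fun _ h => h
    · exact subset_snoc _ _
  have hs's : s' ⊆ s := by
    rcases hS with ⟨rfl, -⟩ | ⟨-, c, rfl⟩
    · exact fun _ h => h
    · exact subset_snoc _ _
  have heq : t' = s' := by
    rcases hp.subset_or_subset ht'.1 hs'.1 hu (fun z hz => htu (ht't hz))
      (fun z hz => hsu (hs's hz)) with h | h
    · exact hs'.eq_of_subset hp ht' h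
    · exact (ht'.eq_of_subset hp hs' h).symm
  subst heq
  have hlen : len t = len s := by
    rcases hT with ⟨rfl, h1⟩ | ⟨h1, c, rfl⟩ <;> rcases hS with ⟨rfl, h2⟩ | ⟨h2, d, rfl⟩
    · rfl
    · exact (h1 h2).elim
    · exact (h2 h1).elim
    · rw [hp.len_snoc ht'.1 htp, hp.len_snoc ht'.1 hsp]
  rcases hp.subset_or_subset htp hsp hu htu hsu with h | h
  · exact hp.eq_of_subset hsp htp h hlen.ge
  · exact (hp.eq_of_subset htp hsp h hlen.le).symm

/-- This is why the front passes to the successors of splitting minimal nodes: replacing the tree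
above a splitting node of limit length could violate clause (5). -/
theorem not_isSplitting_of_mem_front (hp : IsTree lam p) (ht : t ∈ front lam mu p)
    (hl : Order.IsSuccLimit (len t)) : ¬ IsSplitting lam p t := by
  obtain ⟨htp, s, hs, ⟨rfl, h⟩ | ⟨-, c, rfl⟩⟩ := ht
  · exact h
  · rw [hp.len_snoc hs.1 htp] at hl
    exact (hl.add_one_lt (Order.lt_add_one_iff.2 le_rfl)).false.elim

theorem le_tau_of_mem_front (hp : IsTree lam p) (ht : t ∈ front lam mu p) :
    mu ≤ tau lam p t := by
  obtain ⟨s, hst, hs⟩ := exists_isMinNode_subset_of_mem_front ht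
  exact hs.2.1.trans (tau_mono (hp.isSeq ht.1) (hp.isSeq hs.1) hst)

theorem exists_mem_front_subset (hp : IsTree lam p) (hs : s ∈ p) (h : mu < tau lam p s) :
    ∃ t ∈ front lam mu p, t ⊆ s := by
  obtain ⟨b, hb, hmin⟩ := exists_isMinNode hp hs h.le
  have hs' := hp.isSeq hs
  by_cases hsplit : IsSplitting lam p (res s b)
  · have hlt : b < len s := by
      refine hb.lt_of_ne ?_
      rintro rfl
      rw [hs'.res_self] at hmin
      exact h.ne (hmin.tau_eq hp).symm
    obtain ⟨y, -, -, hy⟩ := hs'.exists_snoc hlt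
    exact ⟨res s (b + 1), ⟨hp.res_mem hs (Order.add_one_le_iff.2 hlt), _, hmin,
      Or.inr ⟨hsplit, y, hy⟩⟩, res_subset _ _⟩
  · exact ⟨res s b, ⟨hmin.1, _, hmin, Or.inl ⟨rfl, hsplit⟩⟩, res_subset _ _⟩

/-- Conditions have nodes of arbitrary splitting rank below `lam`. -/
theorem exists_le_tau (hlam : lam.IsRegular) (hp : IsMillerCondition lam p) (hmu : mu < lam.ord) :
    ∃ s ∈ p, mu ≤ tau lam p s := by
  have hT := hp.isTree
  obtain ⟨s₀, hs₀⟩ := hp.nonempty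
  have hmu1 : mu + 1 < lam.ord := hlam.isSuccLimit_ord.add_one_lt hmu
  obtain ⟨y, -, h⟩ := exists_le_forall (P := {s // s ∈ p}) ⟨s₀, hs₀⟩ (mu + 1)
    (fun i u => i ≤ tau lam p u.1)
    (fun i x y hxy hx => hx.trans (tau_mono (hT.isSeq y.2) (hT.isSeq x.2) hxy))
    (fun i hi x _ hx => by
      obtain ⟨w, hxw, hw⟩ := hp.dense x.1 x.2
      obtain ⟨c, hc⟩ := hT.exists_snoc hw.1
      refine ⟨⟨_, hc⟩, fun z hz => subset_snoc _ _ (hxw hz), ?_⟩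
      by_contra! hlt
      have h1 := hx _ hlt
      have h2 : tau lam p x.1 ≤ tau lam p w := tau_mono (hT.isSeq hw.1) (hT.isSeq x.2) hxw
      have h3 : tau lam p w < tau lam p (snoc w c) :=
        tau_lt_tau (hT.isSeq hc) (hT.isSeq hw.1) (subset_snoc _ _)
          (by rw [hT.len_snoc hw.1 hc]; exact Order.lt_add_one_iff.2 le_rfl) hw
      exact ((h1.trans h2).trans_lt h3).false)
    (fun i hi f h0 hf => hT.exists_chain_bound hlam _ (hi.trans_lt hmu1) f h0 hf)
  exact ⟨y.1, y.2, h mu (Order.lt_add_one_iff.2 le_rfl)⟩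

/-- Every extension passes through the front: a node of rank at least `mu + 1` in `r` has rank above
`mu` in `p`, since ranks only drop when a condition is extended. -/
theorem exists_mem_front (hlam : lam.IsRegular) (hp : IsMillerCondition lam p)
    (hr : IsMillerCondition lam r) (h : r ⊆ p) (hmu : mu < lam.ord) :
    ∃ t ∈ front lam mu p, t ∈ r := by
  obtain ⟨s, hs, hle⟩ := exists_le_tau hlam hr (hlam.isSuccLimit_ord.add_one_lt hmu)
  obtain ⟨t, ht, hts⟩ := exists_mem_front_subset hp.isTree (h hs)
    ((Order.add_one_le_iff.1 hle).trans_le (tau_le_tau_of_subset hlam hp h))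
  exact ⟨t, ht, hr.tree s hs t _ (hp.isTree.isSeq ht.1) hts⟩

/-! ### Agreement of conditions up to a level -/

/-- `p' ⊆ p`, and `p'` contains all nodes of `p` whose proper initial segments have splitting rank
less than `mu`. -/
def Agree (lam : Cardinal.{u}) (mu : Ordinal.{u}) (p' p : ZFSet.{u}) : Prop :=
  p' ⊆ p ∧ ∀ s ∈ p, (∀ b < len s, tau lam p (res s b) < mu) → s ∈ p'

theorem Agree.refl (lam : Cardinal.{u}) (mu : Ordinal.{u}) (p : ZFSet.{u}) : Agree lam mu p p :=
  ⟨fun _ h => h, fun _ h _ => h⟩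

theorem Agree.mono {nu : Ordinal.{u}} (h : Agree lam mu p' p) (hn : nu ≤ mu) :
    Agree lam nu p' p :=
  ⟨h.1, fun s hs hs' => h.2 s hs fun b hb => (hs' b hb).trans_le hn⟩

/-- The proper initial segments of a successor of `s` are initial segments of `s`, so they have rank
below `mu` and the successor survives. -/
theorem Agree.nextSet_eq (hp : IsTree lam p) (h : Agree lam mu p' p) (hs : s ∈ p)
    (hlt : tau lam p s < mu) : nextSet lam p' s = nextSet lam p s := by
  have hs' := hp.isSeq hs
  refine nextSet_congr hs' fun c => ⟨fun hc => h.1 hc, fun hc => h.2 _ hc fun b hb => ?_⟩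
  rw [hp.len_snoc hs hc, Order.lt_add_one_iff] at hb
  refine lt_of_le_of_lt ?_ hlt
  rw [← (hp.isSeq hc).res_eq_of_subset hs' (subset_snoc _ _) hb]
  exact tau_mono hs' (hs'.res hb) (res_subset _ _)

theorem Agree.mem_of_tau_lt (hp : IsTree lam p) (h : Agree lam mu p' p) (hs : s ∈ p)
    (hlt : tau lam p s < mu) : s ∈ p' :=
  h.2 s hs fun _ hb =>
    (tau_mono (hp.isSeq hs) ((hp.isSeq hs).res hb.le) (res_subset _ _)).trans_lt hlt

theorem Agree.isSplitting_iff (hp : IsTree lam p) (h : Agree lam mu p' p) (hs : s ∈ p)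
    (hlt : tau lam p s < mu) : IsSplitting lam p' s ↔ IsSplitting lam p s := by
  rw [IsSplitting, IsSplitting, h.nextSet_eq hp hs hlt, and_iff_right hs,
    and_iff_right (h.mem_of_tau_lt hp hs hlt)]

theorem Agree.tau_eq (hp : IsTree lam p) (h : Agree lam mu p' p) (hs : s ∈ p)
    (hlow : ∀ b < len s, tau lam p (res s b) < mu) (hb : b ≤ len s) :
    tau lam p' (res s b) = tau lam p (res s b) := by
  rw [tau_res (hp.isSeq hs) hb, tau_res (hp.isSeq hs) hb]
  exact cnt_congr fun c hc => h.isSplitting_iff hp (hp.res_mem hs (hc.le.trans hb))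
    (hlow c (hc.trans_le hb))

/-- Below level `mu` the ranks computed in `p'` and in `p` are the same, so the two survival
conditions can be chained. -/
theorem Agree.trans (hp : IsTree lam p) (h' : Agree lam mu p'' p') (h : Agree lam mu p' p) :
    Agree lam mu p'' p :=
  ⟨fun _ hz => h.1 (h'.1 hz), fun s hs hlow => h'.2 s (h.2 s hs hlow) fun b hb => by
    rw [h.tau_eq hp hs hlow hb.le]
    exact hlow b hb⟩

theorem Agree.isMinNode (hp : IsTree lam p) (h : Agree lam mu p' p) (hs : IsMinNode lam mu p s) :
    IsMinNode lam mu p' s := by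
  have hself := (hp.isSeq hs.1).res_self
  refine ⟨h.2 s hs.1 hs.2.2, ?_, fun b hb => ?_⟩
  · rw [← hself, h.tau_eq hp hs.1 hs.2.2 le_rfl, hself]
    exact hs.2.1
  · rw [h.tau_eq hp hs.1 hs.2.2 hb.le]
    exact hs.2.2 b hb

/-- Minimal nodes of `p` remain minimal in `p'`. Conversely, a minimal node of `p'` has rank at
least `mu` in `p`, hence lies above a minimal node of `p`, and minimality in `p'` makes the two
equal. -/
theorem Agree.split_eq (hlam : lam.IsRegular) (hp : IsMillerCondition lam p)
    (hp' : IsMillerCondition lam p') (h : Agree lam mu p' p) :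
    split lam mu p' = split lam mu p := by
  ext s
  rw [mem_split_iff hp.isTree, mem_split_iff hp'.isTree]
  refine ⟨fun hs => ?_, fun hs => h.isMinNode hp.isTree hs⟩
  have hsp := h.1 hs.1
  obtain ⟨b, hb, hmin⟩ := exists_isMinNode hp.isTree hsp
    (hs.2.1.trans (tau_le_tau_of_subset hlam hp h.1))
  have := hs.eq_of_subset hp'.isTree (h.isMinNode hp.isTree hmin) (res_subset _ _)
  rwa [this] at hmin

theorem Agree.extendsAt (hlam : lam.IsRegular) (hp : IsMillerCondition lam p)
    (hp' : IsMillerCondition lam p') (h : Agree lam mu p' p) : ExtendsAt lam mu p' p :=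
  ⟨h.1, h.split_eq hlam hp hp'⟩

end

section

variable {lam : Cardinal.{u}} {p p' r s t : ZFSet.{u}} {a b c mu : Ordinal.{u}}
  {T : Set ZFSet.{u}} {q : ZFSet.{u} → ZFSet.{u}}

/-! ### Amalgamation along an antichain -/

/-- The tree obtained from `p` by replacing, for each `t ∈ T`, the part of `p` above `t` by
`q t`. -/
def amalg (p : ZFSet.{u}) (T : Set ZFSet.{u}) (q : ZFSet.{u} → ZFSet.{u}) : ZFSet.{u} :=
  ZFSet.sep (fun u => ∀ t ∈ T, t ⊆ u → u ∈ q t) p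

theorem mem_amalg : s ∈ amalg p T q ↔ s ∈ p ∧ ∀ t ∈ T, t ⊆ s → s ∈ q t := ZFSet.mem_sep

/-- The data for an amalgamation: an antichain `T` of nodes of `p`, whose nodes of limit length do
not split, and conditions `q t` extending `restr p t`. -/
structure IsAmalgData (lam : Cardinal.{u}) (p : ZFSet.{u}) (T : Set ZFSet.{u})
    (q : ZFSet.{u} → ZFSet.{u}) : Prop where
  mem : ∀ t ∈ T, t ∈ p
  antichain : ∀ t ∈ T, ∀ t' ∈ T, ∀ u ∈ p, t ⊆ u → t' ⊆ u → t = t'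
  limit : ∀ t ∈ T, Order.IsSuccLimit (len t) → ¬ IsSplitting lam p t
  cond : ∀ t ∈ T, IsMillerCondition lam (q t)
  sub : ∀ t ∈ T, q t ⊆ restr p t

/-- All nodes of `q t` are comparable with `t`, so a sufficiently long one extends `t`. -/
theorem IsAmalgData.self_mem (hlam : lam.IsRegular) (hp : IsTree lam p)
    (h : IsAmalgData lam p T q) (ht : t ∈ T) : t ∈ q t := by
  obtain ⟨s, hs⟩ := (h.cond t ht).nonempty
  exact (h.cond t ht).isTree.mem_of_comparable hlam hs (hp.isSeq (h.mem t ht))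
    (hp.len_lt (h.mem t ht)) fun u hu => (mem_restr.1 (h.sub t ht hu)).2

theorem IsAmalgData.mem_iff (h : IsAmalgData lam p T q) (ht : t ∈ T) (hts : t ⊆ s) :
    s ∈ amalg p T q ↔ s ∈ q t := by
  rw [mem_amalg]
  refine ⟨fun hs => hs.2 t ht hts, fun hs => ?_⟩
  have hsp := (mem_restr.1 (h.sub t ht hs)).1
  refine ⟨hsp, fun t' ht' hts' => ?_⟩
  rwa [← h.antichain t ht t' ht' s hsp hts hts']

theorem IsAmalgData.nextSet_eq (h : IsAmalgData lam p T q) (ht : t ∈ T) (hs : IsSeq lam a s)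
    (hts : t ⊆ s) : nextSet lam (amalg p T q) s = nextSet lam (q t) s :=
  nextSet_congr hs fun c => h.mem_iff ht fun _ hz => subset_snoc s c (hts hz)

theorem IsAmalgData.nextSet_eq_of_not (hlam : lam.IsRegular) (hp : IsTree lam p)
    (h : IsAmalgData lam p T q) (hs : s ∈ p) (hno : ∀ t ∈ T, ¬ t ⊆ s) :
    nextSet lam (amalg p T q) s = nextSet lam p s := by
  refine nextSet_congr (hp.isSeq hs) fun c => ?_
  rw [mem_amalg]
  refine ⟨fun h => h.1, fun hc => ⟨hc, fun t ht htc => ?_⟩⟩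
  -- A successor of `s` can come to lie above a node of `T` only by being that node, and then it is
  -- kept.
  have hle : len (snoc s c) ≤ len t := by
    by_contra! hlt
    rw [hp.len_snoc hs hc, Order.lt_add_one_iff] at hlt
    exact hno t ht ((hp.isSeq hc).subset_of_len_le (hp.isSeq (h.mem t ht)) (hp.isSeq hs) htc
      (subset_snoc _ _) hlt)
  rw [← hp.eq_of_subset hc (h.mem t ht) htc hle]
  exact h.self_mem hlam hp ht

theorem IsAmalgData.isSplitting_iff (h : IsAmalgData lam p T q) (ht : t ∈ T)
    (hs : IsSeq lam a s) (hts : t ⊆ s) :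
    IsSplitting lam (amalg p T q) s ↔ IsSplitting lam (q t) s := by
  rw [IsSplitting, IsSplitting, h.nextSet_eq ht hs hts, h.mem_iff ht hts]

theorem IsAmalgData.restr_eq (hlam : lam.IsRegular) (hp : IsTree lam p)
    (h : IsAmalgData lam p T q) (ht : t ∈ T) : restr (amalg p T q) t = q t := by
  have htq := h.self_mem hlam hp ht
  ext s
  rw [mem_restr]
  constructor
  · rintro ⟨hs, hst | hts⟩
    · exact (h.cond t ht).tree t htq s _ (hp.isSeq (mem_amalg.1 hs).1) hst
    · exact (h.mem_iff ht hts).1 hs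
  · intro hs
    obtain ⟨hsp, hst⟩ := mem_restr.1 (h.sub t ht hs)
    refine ⟨mem_amalg.2 ⟨hsp, fun t' ht' hts' => ?_⟩, hst⟩
    rcases hst with hst | hts
    · rwa [← h.antichain t ht t' ht' t (h.mem t ht) (fun _ h => h) fun z hz => hst (hts' hz)]
    · rwa [← h.antichain t ht t' ht' s hsp hts hts']

/-- Each node has its successors either from `p` or from the unique `q t` with `t` below it, so most
clauses are inherited. Only clause (5) needs the assumption on nodes of `T` of limit length. -/
theorem IsAmalgData.isMillerCondition (hlam : lam.IsRegular) (hp : IsMillerCondition lam p)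
    (h : IsAmalgData lam p T q) : IsMillerCondition lam (amalg p T q) := by
  have hT := hp.isTree
  have hsub : amalg p T q ⊆ p := fun z hz => (mem_amalg.1 hz).1
  refine ⟨⟨∅, ?_⟩, fun s hs => hp.seq s (hsub hs), ?_, ?_, ?_, ?_, ?_, ?_⟩
  · obtain ⟨s, hs⟩ := hp.nonempty
    refine mem_amalg.2 ⟨hT.empty_mem hs, fun t ht _ => ?_⟩
    exact (h.cond t ht).isTree.empty_mem (h.self_mem hlam hT ht)
  · intro s hs v a hv hvs
    obtain ⟨hsp, hs⟩ := mem_amalg.1 hs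
    exact mem_amalg.2 ⟨hp.tree s hsp v a hv hvs, fun t ht htv =>
      (h.cond t ht).tree s (hs t ht fun z hz => hvs (htv hz)) v a hv hvs⟩
  · intro a ha hl s hs hall
    have hsp : s ∈ p := hp.closure a ha hl s hs fun v b hb hv hvs => hsub (hall v b hb hv hvs)
    refine mem_amalg.2 ⟨hsp, fun t ht hts => ?_⟩
    have ht' := hT.isSeq (h.mem t ht)
    by_cases hne : t = s
    · rw [← hne]
      exact h.self_mem hlam hT ht
    have hlt := hs.lt_of_ssubset ht' hts hne
    refine (h.cond t ht).closure a ha hl s hs fun v b hb hv hvs => ?_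
    rcases le_total (len t) b with hle | hle
    · have htv := hs.subset_of_len_le ht' hv hts hvs hle
      exact (h.mem_iff ht htv).1 (hall v b hb hv hvs)
    · exact (h.cond t ht).tree t (h.self_mem hlam hT ht) v b hv
        (hs.subset_of_len_le hv ht' hvs hts hle)
  · intro s hs
    have hs' := hT.isSeq (hsub hs)
    by_cases hex : ∃ t ∈ T, t ⊆ s
    · obtain ⟨t, ht, hts⟩ := hex
      rw [h.nextSet_eq ht hs' hts]
      exact (h.cond t ht).splitting s ((h.mem_iff ht hts).1 hs)
    · push Not at hex
      rw [h.nextSet_eq_of_not hlam hT (hsub hs) hex]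
      exact hp.splitting s (hsub hs)
  · intro s hs a ha hsa
    by_cases hex : ∃ t ∈ T, t ⊆ s
    · obtain ⟨t, ht, hts⟩ := hex
      rw [h.nextSet_eq ht hsa hts]
      exact (h.cond t ht).regular s ((h.mem_iff ht hts).1 hs) a ha hsa
    · push Not at hex
      rw [h.nextSet_eq_of_not hlam hT (hsub hs) hex]
      exact hp.regular s (hsub hs) a ha hsa
  · intro s hs
    have key : ∀ t ∈ T, ∀ w ∈ q t, t ⊆ w → ∃ v, w ⊆ v ∧ IsSplitting lam (amalg p T q) v := by
      intro t ht w hw htw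
      obtain ⟨v, hwv, hv⟩ := (h.cond t ht).dense w hw
      exact ⟨v, hwv, (h.isSplitting_iff ht ((h.cond t ht).isTree.isSeq hv.1)
        fun z hz => hwv (htw hz)).2 hv⟩
    by_cases hex : ∃ t ∈ T, t ⊆ s
    · obtain ⟨t, ht, hts⟩ := hex
      exact key t ht s ((h.mem_iff ht hts).1 hs) hts
    · push Not at hex
      obtain ⟨v, hsv, hv⟩ := hp.dense s (hsub hs)
      by_cases hex' : ∃ t ∈ T, t ⊆ v
      · obtain ⟨t, ht, htv⟩ := hex'
        have hst : s ⊆ t :=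
          (hT.subset_or_subset (hsub hs) (h.mem t ht) hv.1 hsv htv).resolve_right (hex t ht)
        obtain ⟨w, hw1, hw2⟩ := key t ht t (h.self_mem hlam hT ht) fun _ h => h
        exact ⟨w, fun z hz => hw1 (hst hz), hw2⟩
      · push Not at hex'
        refine ⟨v, hsv, mem_amalg.2 ⟨hv.1, fun t ht htv => (hex' t ht htv).elim⟩, ?_⟩
        rw [h.nextSet_eq_of_not hlam hT hv.1 hex']
        exact hv.2
  · intro a ha hsing s hs hsa hall
    have hsp := hsub hs
    have hs' := hT.isSeq hsp
    have hsplit : IsSplitting lam p s := by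
      refine hp.singular a ha hsing s hsp hsa fun b hb => ?_
      obtain ⟨c, hbc, hca, v, hv, hvs, hv'⟩ := hall b hb
      exact ⟨c, hbc, hca, v, hv, hvs, hv'.of_subset hlam hp hsub⟩
    by_cases hex : ∃ t ∈ T, t ⊆ s
    · obtain ⟨t, ht, hts⟩ := hex
      have hsq : IsSeq lam a s := by
        refine ⟨fun z hz => ?_, hsa.2⟩
        obtain ⟨x, hx, y, hy, rfl⟩ := ZFSet.mem_prod.1 (hsa.1 hz)
        exact ZFSet.pair_mem_prod.2 ⟨hx, Ordinal.toZFSet_monotone ha.le hy⟩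
      -- At `s ∈ T` the successors would come from `q s`, which need not split there; but `p` splits
      -- at `s`, and `T` has no splitting nodes of limit length.
      have hne : t ≠ s := by
        rintro rfl
        refine h.limit t ht ?_ hsplit
        rw [hsq.len_eq]
        exact hsing.1
      have ht' := hT.isSeq (h.mem t ht)
      have hlt := hsq.lt_of_ssubset ht' hts hne
      refine (h.isSplitting_iff ht hs' hts).2 ?_
      refine (h.cond t ht).singular a ha hsing s ((h.mem_iff ht hts).1 hs) hsa fun b hb => ?_
      -- Past the length of `t`, splitting nodes of the amalgamation are splitting nodes of `q t`,
      -- so they are cofinal there too.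
      obtain ⟨c, hbc, hca, v, hv, hvs, hv'⟩ := hall (max b (len t)) (max_lt hb hlt)
      refine ⟨c, (le_max_left _ _).trans hbc, hca, v, hv, hvs, ?_⟩
      exact (h.isSplitting_iff ht hv
        (hsq.subset_of_len_le ht' hv hts hvs ((le_max_right _ _).trans hbc))).1 hv'
    · push Not at hex
      refine ⟨hs, ?_⟩
      rw [h.nextSet_eq_of_not hlam hT hsp hex]
      exact hsplit.2

/-- A node with all proper initial segments of rank below `mu` can lie above a front node only by
being equal to it, and front nodes are kept. -/
theorem IsAmalgData.agree (hlam : lam.IsRegular) (hp : IsTree lam p)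
    (h : IsAmalgData lam p (front lam mu p) q) : Agree lam mu (amalg p (front lam mu p) q) p := by
  refine ⟨fun z hz => (mem_amalg.1 hz).1, fun s hs hlow => mem_amalg.2 ⟨hs, fun t ht hts => ?_⟩⟩
  obtain ⟨w, hwt, hw⟩ := exists_isMinNode_subset_of_mem_front ht
  have hws : w ⊆ s := fun z hz => hts (hwt hz)
  have hle : len s ≤ len w := by
    by_contra! hlt
    have := hlow _ hlt
    rw [← (hp.isSeq hs).eq_res (hp.isSeq hw.1) hws] at this
    exact this.not_ge hw.2.1
  have heq := hp.eq_of_subset hs (h.mem t ht) hts (hle.trans (hp.len_le (h.mem t ht) hw.1 hwt))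
  rw [← heq]
  exact h.self_mem hlam hp ht

/-! ### Distributivity -/

/-- Fewer than `lam` dense open sets of conditions have dense intersection. -/
theorem exists_mem_all (hlam : lam.IsRegular) (hlam' : ℵ₀ < lam) {d : Ordinal.{u}}
    (hd : d < lam.ord) (E : Ordinal.{u} → ZFSet.{u} → Prop)
    (hopen : ∀ i < d, ∀ r r', IsMillerCondition lam r → IsMillerCondition lam r' → r' ⊆ r →
      E i r → E i r')
    (hdense : ∀ i < d, ∀ r, IsMillerCondition lam r →
      ∃ r', IsMillerCondition lam r' ∧ r' ⊆ r ∧ E i r')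
    (hp : IsMillerCondition lam p) :
    ∃ r, IsMillerCondition lam r ∧ r ⊆ p ∧ ∀ i < d, E i r := by
  -- In the dual of inclusion, upper bounds of chains are the intersections supplied by
  -- `isMillerCondition_inter`.
  obtain ⟨y, hy, h⟩ := exists_le_forall (P := {r // IsMillerCondition lam r}ᵒᵈ)
    (OrderDual.toDual ⟨p, hp⟩) d (fun i r => i < d → E i (OrderDual.ofDual r).1)
    (fun i x y hxy hx hi => hopen i hi _ _ x.2 y.2 hxy (hx hi))
    (fun i hi x _ _ => by
      obtain ⟨r', h1, h2, h3⟩ := hdense i hi (OrderDual.ofDual x).1 (OrderDual.ofDual x).2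
      exact ⟨OrderDual.toDual ⟨r', h1⟩, h2, fun _ => h3⟩)
    (fun i hi f h0 hf => by
      rcases eq_or_ne i 0 with rfl | hi0
      · exact ⟨_, le_rfl, fun j hj => (not_lt_bot hj).elim⟩
      have hpos : 0 < i := pos_iff_ne_zero.2 hi0
      have : Nonempty (Set.Iio i) := ⟨⟨0, hpos⟩⟩
      let g : Ordinal.{u} → ZFSet.{u} := fun j => (OrderDual.ofDual (f j)).1
      let m := ZFSet.sep (fun s => ∀ j < i, s ∈ g j) (g 0)
      have hmg : ∀ j < i, m ⊆ g j := fun j hj s hs => (ZFSet.mem_sep.1 hs).2 j hj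
      have hm : IsMillerCondition lam m := by
        refine isMillerCondition_inter (f := fun j : Set.Iio i => g j.1) hlam hlam' ?_
          (fun j => (OrderDual.ofDual (f j.1)).2) (fun j k => ?_) fun s => ?_
        · simpa [Cardinal.lt_ord, ← Ordinal.lift_card] using hi.trans_lt hd
        · have hle : ∀ j k : Ordinal.{u}, f j ≤ f k → g k ⊆ g j := fun j k h => h
          rcases le_total j.1 k.1 with h | h
          · exact Or.inr (hle _ _ (hf j.1 k.1 h k.2))
          · exact Or.inl (hle _ _ (hf k.1 j.1 h j.2))
        · exact ⟨fun hs j => hmg j.1 j.2 hs, fun hs =>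
            ZFSet.mem_sep.2 ⟨hs ⟨0, hpos⟩, fun j hj => hs ⟨j, hj⟩⟩⟩
      have h0' : g 0 ⊆ p := h0 0 hpos
      exact ⟨OrderDual.toDual ⟨m, hm⟩, fun s hs => h0' (hmg 0 hpos hs), fun j hj => hmg j hj⟩)
  exact ⟨(OrderDual.ofDual y).1, (OrderDual.ofDual y).2, hy, fun i hi => h i hi hi⟩

theorem exists_mem_all_of_mem (hlam : lam.IsRegular) (hlam' : ℵ₀ < lam) {X : ZFSet.{u}}
    (hX : X.card < lam) (E : ZFSet.{u} → ZFSet.{u} → Prop)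
    (hopen : ∀ x ∈ X, ∀ r r', IsMillerCondition lam r → IsMillerCondition lam r' → r' ⊆ r →
      E x r → E x r')
    (hdense : ∀ x ∈ X, ∀ r, IsMillerCondition lam r →
      ∃ r', IsMillerCondition lam r' ∧ r' ⊆ r ∧ E x r')
    (hp : IsMillerCondition lam p) :
    ∃ r, IsMillerCondition lam r ∧ r ⊆ p ∧ ∀ x ∈ X, E x r := by
  obtain ⟨e⟩ : Nonempty (Set.Iio X.card.ord ≃ X) := by
    rw [← Cardinal.eq, Cardinal.mk_Iio_ordinal, Cardinal.card_ord, ZFSet.cardinalMk_coe_sort]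
  obtain ⟨r, h1, h2, h3⟩ := exists_mem_all hlam hlam' (Cardinal.ord_lt_ord.2 hX)
    (fun i r => ∀ h : i < X.card.ord, E (e ⟨i, h⟩).1 r)
    (fun i hi r r' hr hr' hle h _ => hopen _ (e ⟨i, hi⟩).2 r r' hr hr' hle (h hi))
    (fun i hi r hr => by
      obtain ⟨r', h1, h2, h3⟩ := hdense _ (e ⟨i, hi⟩).2 r hr
      exact ⟨r', h1, h2, fun _ => h3⟩) hp
  refine ⟨r, h1, h2, fun x hx => ?_⟩
  have := h3 (e.symm ⟨x, hx⟩).1 (e.symm ⟨x, hx⟩).2 (e.symm ⟨x, hx⟩).2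
  simpa using this

/-! ### Conditions meeting all dense sets of a small set -/

/-- `r` belongs to `E`, decides every condition in `X`, and extends an element of every dense set
in `X`. -/
def IsGood (lam : Cardinal.{u}) (X E r : ZFSet.{u}) : Prop :=
  r ∈ E ∧ ∀ x ∈ X,
    (IsMillerCondition lam x → r ⊆ x ∨ ¬ (millerForcing lam).Compatible r x) ∧
    ((millerForcing lam).IsDense x → ∃ d ∈ x, r ⊆ d)

/-- For each `x` in `X` the demands are dense open: first pass below `x` if compatible with it, then
below an element of `x` if `x` is dense. Distributivity meets them together, and a final extension
enters `E`. -/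
theorem exists_isGood (hlam : lam.IsRegular) (hlam' : ℵ₀ < lam) {X E : ZFSet.{u}}
    (hX : X.card < lam) (hE : (millerForcing lam).IsDenseOpen E) (hp : IsMillerCondition lam p) :
    ∃ r, IsMillerCondition lam r ∧ r ⊆ p ∧ IsGood lam X E r := by
  obtain ⟨r, hr, hrp, h⟩ := exists_mem_all_of_mem hlam hlam' hX
    (fun x r => (IsMillerCondition lam x → r ⊆ x ∨ ¬ (millerForcing lam).Compatible r x) ∧
      ((millerForcing lam).IsDense x → ∃ d ∈ x, r ⊆ d))
    (fun x _ r r' _ _ hle h => ⟨fun hx => (h.1 hx).imp (fun h z hz => h (hle hz))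
      fun h ⟨w, hw, h1, h2⟩ => h ⟨w, hw, fun z hz => hle (h1 hz), h2⟩, fun hx => by
        obtain ⟨d, hd, h'⟩ := h.2 hx
        exact ⟨d, hd, fun z hz => h' (hle hz)⟩⟩)
    (fun x _ r hr => by
      obtain ⟨r₁, hr₁, hle₁, h₁⟩ : ∃ r₁, IsMillerCondition lam r₁ ∧ r₁ ⊆ r ∧
          (IsMillerCondition lam x → r₁ ⊆ x ∨ ¬ (millerForcing lam).Compatible r₁ x) := by
        by_cases hc : (millerForcing lam).Compatible r x
        · obtain ⟨w, hw, h1, h2⟩ := hc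
          exact ⟨w, mem_millerForcing_carrier.1 hw, h1, fun _ => Or.inl h2⟩
        · exact ⟨r, hr, fun _ h => h, fun _ => Or.inr hc⟩
      by_cases hx : (millerForcing lam).IsDense x
      · obtain ⟨d, hd, hle⟩ := hx.2 r₁ (mem_millerForcing_carrier.2 hr₁)
        refine ⟨d, mem_millerForcing_carrier.1 (hx.1 hd), fun z hz => hle₁ (hle hz), fun hx' => ?_,
          fun _ => ⟨d, hd, fun _ h => h⟩⟩
        exact (h₁ hx').imp (fun h z hz => h (hle hz))
          fun h ⟨w, hw, h1, h2⟩ => h ⟨w, hw, fun z hz => hle (h1 hz), h2⟩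
      · exact ⟨r₁, hr₁, hle₁, h₁, fun h => (hx h).elim⟩) hp
  obtain ⟨d, hd, hle⟩ := hE.1.2 r (mem_millerForcing_carrier.2 hr)
  refine ⟨d, mem_millerForcing_carrier.1 (hE.1.1 hd), fun z hz => hrp (hle hz), hd,
    fun x hx => ⟨fun hx' => ?_, fun hx' => ?_⟩⟩
  · exact ((h x hx).1 hx').imp (fun h z hz => h (hle hz))
      fun h ⟨w, hw, h1, h2⟩ => h ⟨w, hw, fun z hz => hle (h1 hz), h2⟩
  · obtain ⟨e, he, h'⟩ := (h x hx).2 hx'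
    exact ⟨e, he, fun z hz => h' (hle hz)⟩

/-- The successor step of the fusion. -/
theorem exists_fusion_step (hlam : lam.IsRegular) (hlam' : ℵ₀ < lam) {X E : ZFSet.{u}}
    (hX : X.card < lam) (hE : (millerForcing lam).IsDenseOpen E) (mu : Ordinal.{u})
    (hp : IsMillerCondition lam p) :
    ∃ p', IsMillerCondition lam p' ∧ Agree lam mu p' p ∧
      ∀ t ∈ front lam mu p, IsGood lam X E (restr p' t) := by
  have : ∀ t, ∃ q, t ∈ front lam mu p →
      IsMillerCondition lam q ∧ q ⊆ restr p t ∧ IsGood lam X E q := by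
    intro t
    by_cases ht : t ∈ front lam mu p
    · obtain ⟨q, hq⟩ := exists_isGood hlam hlam' hX hE (isMillerCondition_restr hlam hp ht.1)
      exact ⟨q, fun _ => hq⟩
    · exact ⟨∅, fun h => (ht h).elim⟩
  choose q hq using this
  have hdata : IsAmalgData lam p (front lam mu p) q :=
    { mem := fun t ht => ht.1
      antichain := fun t ht t' ht' u hu => front_antichain hp.isTree hu ht ht'
      limit := fun t ht => not_isSplitting_of_mem_front hp.isTree ht
      cond := fun t ht => (hq t ht).1
      sub := fun t ht => (hq t ht).2.1 }
  refine ⟨_, hdata.isMillerCondition hlam hp, hdata.agree hlam hp.isTree, fun t ht => ?_⟩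
  rw [hdata.restr_eq hlam hp.isTree ht]
  exact (hq t ht).2.2

end

section

variable {lam : Cardinal.{u}} {p p' q r s t : ZFSet.{u}} {a b c n : Ordinal.{u}}
  {P : Ordinal.{u} → ZFSet.{u}}

/-! ### Fusion sequences -/

/-- A decreasing sequence of conditions, continuous at limits, whose successor steps agree up to
the levels `n + a`. -/
structure IsAgreeSeq (lam : Cardinal.{u}) (n : Ordinal.{u}) (P : Ordinal.{u} → ZFSet.{u}) :
    Prop where
  cond : ∀ a < lam.ord, IsMillerCondition lam (P a)
  anti : ∀ b < lam.ord, ∀ a ≤ b, P b ⊆ P a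
  succ : ∀ a < lam.ord, Agree lam (n + a) (P (a + 1)) (P a)
  limit : ∀ d < lam.ord, Order.IsSuccLimit d → ∀ s, s ∈ P d ↔ ∀ a < d, s ∈ P a

theorem IsAgreeSeq.isFusionSeq (hlam : lam.IsRegular) (h : IsAgreeSeq lam n P) :
    IsFusionSeq lam n P where
  mem a ha := mem_millerForcing_carrier.2 (h.cond a ha)
  increasing := h.anti
  succ a ha := (h.succ a ha).extendsAt hlam (h.cond a ha)
    (h.cond _ (hlam.isSuccLimit_ord.add_one_lt ha))
  limit := h.limit

/-- The protected levels `n + c` increase with `c`, so later steps preserve whatever level `n + a`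
protects, and intersections at limits lose nothing of it. -/
theorem IsAgreeSeq.agree (h : IsAgreeSeq lam n P) (hb : b < lam.ord) (hab : a ≤ b) :
    Agree lam (n + a) (P b) (P a) := by
  induction b using Ordinal.limitRecOn with
  | zero =>
    obtain rfl : a = 0 := le_antisymm hab bot_le
    exact Agree.refl _ _ _
  | add_one c ih =>
    rcases hab.eq_or_lt with rfl | hlt
    · exact Agree.refl _ _ _
    have hac := Order.lt_add_one_iff.1 hlt
    have hc : c < lam.ord := (Order.lt_add_one_iff.2 le_rfl).trans hb
    exact ((h.succ c hc).mono (by gcongr)).trans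
      (h.cond a (hac.trans_lt hc)).isTree (ih hc hac)
  | limit b hl ih =>
    refine ⟨h.anti b hb a hab, fun s hs hlow => ?_⟩
    rcases hab.eq_or_lt with rfl | hlt
    · exact hs
    refine (h.limit b hb hl s).2 fun c hc => ?_
    rcases le_total a c with hac | hca
    · exact (ih c hc (hc.trans hb) hac).2 s hs hlow
    · exact h.anti a (hlt.trans hb) c hca hs

theorem IsAgreeSeq.agree_inter (h : IsAgreeSeq lam n P) (hq : ∀ s, s ∈ q ↔ ∀ a < lam.ord, s ∈ P a)
    (ha : a < lam.ord) : Agree lam (n + a) q (P a) := by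
  refine ⟨fun s hs => (hq s).1 hs a ha, fun s hs hlow => (hq s).2 fun c hc => ?_⟩
  rcases le_total a c with hac | hca
  · exact (h.agree hc hac).2 s hs hlow
  · exact h.anti a ha c hca hs

/-- The intersection of a fusion sequence is a condition. -/
theorem IsAgreeSeq.isMillerCondition_inter (hlam : lam.IsRegular) (h : IsAgreeSeq lam n P)
    (hq : ∀ s, s ∈ q ↔ ∀ a < lam.ord, s ∈ P a) : IsMillerCondition lam q := by
  have h0 : (0 : Ordinal.{u}) < lam.ord := hlam.ord_pos
  have hsub : ∀ a < lam.ord, q ⊆ P a := fun a ha s hs => (hq s).1 hs a ha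
  have hT : ∀ a < lam.ord, IsTree lam (P a) := fun a ha => (h.cond a ha).isTree
  have hsuc : ∀ s ∈ q, len s + 1 < lam.ord := fun s hs =>
    hlam.isSuccLimit_ord.add_one_lt ((hT 0 h0).len_lt (hsub 0 h0 hs))
  have hlow : ∀ s, len s < n + (len s + 1) := fun s =>
    (Order.lt_add_one_iff.2 le_rfl).trans_le (le_add_self)
  -- The rank of a node is at most its length, so stage `len s + 1` is late enough to settle the
  -- successors and the splitting status of `s` for good.
  have htau : ∀ s ∈ q, tau lam (P (len s + 1)) s < n + (len s + 1) := fun s hs =>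
    (tau_le_len ((hT 0 h0).isSeq (hsub 0 h0 hs))).trans_lt (hlow s)
  have hnext : ∀ s ∈ q, nextSet lam q s = nextSet lam (P (len s + 1)) s := fun s hs =>
    (h.agree_inter hq (hsuc s hs)).nextSet_eq (hT _ (hsuc s hs)) (hsub _ (hsuc s hs) hs)
      (htau s hs)
  refine ⟨⟨∅, (hq _).2 fun a ha => ?_⟩, fun s hs => (h.cond 0 h0).seq s (hsub 0 h0 hs),
    fun s hs t a ht hts => (hq t).2 fun c hc => (h.cond c hc).tree s (hsub c hc hs) t a ht hts,
    fun a ha hl s hs hall => (hq s).2 fun c hc => (h.cond c hc).closure a ha hl s hs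
      fun t b hb ht hts => hsub c hc (hall t b hb ht hts), fun s hs => ?_,
    fun s hs a ha hsa => ?_, fun s hs => ?_, fun a ha hsing s hs hsa hall => ?_⟩
  · obtain ⟨s, hs⟩ := (h.cond a ha).nonempty
    exact (hT a ha).empty_mem hs
  · rw [hnext s hs]
    exact (h.cond _ (hsuc s hs)).splitting s (hsub _ (hsuc s hs) hs)
  · rw [hnext s hs]
    exact (h.cond _ (hsuc s hs)).regular s (hsub _ (hsuc s hs) hs) a ha hsa
  · have hc := hsuc s hs
    have hsc := hsub _ hc hs
    obtain ⟨v, hsv, hv, hmin, -⟩ := (h.cond _ hc).exists_next_splitting hsc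
    have hv' := (hT _ hc).isSeq hv.1
    -- No splitting node lies strictly below `v` and at or above `s`, so the rank of `v` is at most
    -- `len s`, however long `v` is.
    have hlt : tau lam (P (len s + 1)) v < n + (len s + 1) := by
      refine lt_of_le_of_lt (cnt_le_iff.2 fun c hcv hcs => ?_) (hlow s)
      refine (cnt_le_self _ _).trans_lt ?_
      by_contra! hle
      have hsub' : s ⊆ res v c := by
        rw [hv'.eq_res ((hT _ hc).isSeq hsc) hsv]
        exact res_mono _ hle
      have heq := hmin _ hcs hsub' (res_subset _ _)
      have hl := (hv'.res hcv.le).len_eq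
      rw [heq] at hl
      exact hcv.ne hl.symm
    exact ⟨v, hsv, ((h.agree_inter hq hc).isSplitting_iff (hT _ hc) hv.1 hlt).2 hv⟩
  · have hc := hsuc s hs
    refine ((h.agree_inter hq hc).isSplitting_iff (hT _ hc) (hsub _ hc hs) (htau s hs)).2 ?_
    refine (h.cond _ hc).singular a ha hsing s (hsub _ hc hs) hsa fun b hb => ?_
    obtain ⟨d, h1, h2, t, ht, hts, hspl⟩ := hall b hb
    exact ⟨d, h1, h2, t, ht, hts, hspl.of_subset hlam (h.cond _ hc) (hsub _ hc)⟩

/-! ### Transfinite dependent choice -/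

/-- Since `R i` sees only the history below `i`, the recursion may run on a history padded with junk
from `i` on and be transferred back to `h`. -/
theorem exists_transfinite_choice {α : Type*} [Nonempty α] (d : Ordinal.{u})
    (R : Ordinal.{u} → (Ordinal.{u} → α) → α → Prop)
    (hcongr : ∀ i h h' y, (∀ j < i, h j = h' j) → R i h y → R i h' y)
    (hex : ∀ i < d, ∀ h, (∀ j < i, R j h (h j)) → ∃ y, R i h y) :
    ∃ h : Ordinal.{u} → α, ∀ i < d, R i h (h i) := by
  classical
  let ext : ∀ i : Ordinal.{u}, (∀ j, j < i → α) → Ordinal.{u} → α := fun i F j =>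
    if hj : j < i then F j hj else Classical.arbitrary α
  let h : Ordinal.{u} → α := WellFounded.fix (C := fun _ => α) (wellFounded_lt)
    fun i F => Classical.epsilon (R i (ext i F))
  have hh : ∀ i, h i = Classical.epsilon (R i (ext i fun j _ => h j)) := fun i =>
    WellFounded.fix_eq _ _ i
  have hext : ∀ i j, j < i → ext i (fun j _ => h j) j = h j := fun i j hj => dif_pos hj
  refine ⟨h, fun i => ?_⟩
  induction i using WellFoundedLT.induction with
  | ind i ih =>
    intro hi
    obtain ⟨y, hy⟩ := hex i hi h fun j hj => ih j hj (hj.trans hi)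
    have hy' := hcongr i _ _ y (fun j hj => (hext i j hj).symm) hy
    have := Classical.epsilon_spec (p := R i (ext i fun j _ => h j)) ⟨y, hy'⟩
    rw [← hh i] at this
    exact hcongr i _ _ _ (hext i) this

end

section

/-! ### Cardinalities of sets -/

theorem card_iUnion_lt {c : Cardinal.{u}} (hc : c.IsRegular) {ι : Type u} (hι : #ι < c)
    {f : ι → ZFSet.{u}} (hf : ∀ i, (f i).card < c) : (ZFSet.iUnion f).card < c := by
  have := ZFSet.lift_card_iUnion_le_sum_card (f := f)
  rw [Cardinal.lift_id] at this
  exact this.trans_lt (sum_lt_of_isRegular hc hι hf)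

theorem card_iUnion_le {c : Cardinal.{u}} (hc : ℵ₀ ≤ c) {ι : Type u} (hι : #ι ≤ c)
    {f : ι → ZFSet.{u}} (hf : ∀ i, (f i).card ≤ c) : (ZFSet.iUnion f).card ≤ c := by
  have := ZFSet.lift_card_iUnion_le_sum_card (f := f)
  rw [Cardinal.lift_id] at this
  refine this.trans ((Cardinal.sum_le_sum _ (fun _ => c) hf).trans ?_)
  rw [Cardinal.sum_const']
  exact Cardinal.mul_le_of_le hc hι le_rfl

theorem card_range_le {ι : Type u} (f : ι → ZFSet.{u}) : (ZFSet.range f).card ≤ #ι := by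
  simpa using ZFSet.lift_card_range_le (f := f)

theorem card_prod_le (x y : ZFSet.{u}) : (ZFSet.prod x y).card ≤ x.card * y.card := by
  let f : Shrink x × Shrink y → ZFSet.{u} := fun i =>
    ZFSet.pair ((equivShrink x).symm i.1).1 ((equivShrink y).symm i.2).1
  have hsub : ZFSet.prod x y ⊆ ZFSet.range f := by
    intro z hz
    obtain ⟨a, ha, b, hb, rfl⟩ := ZFSet.mem_prod.1 hz
    exact ZFSet.mem_range.2 ⟨(equivShrink x ⟨a, ha⟩, equivShrink y ⟨b, hb⟩), by simp [f]⟩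
  refine (ZFSet.card_mono hsub).trans ((card_range_le f).trans ?_)
  simp [ZFSet.card]

theorem card_pair_lt {c : Cardinal.{u}} (hc : ℵ₀ ≤ c) (x y : ZFSet.{u}) :
    ({x, y} : ZFSet.{u}).card < c := by
  refine lt_of_le_of_lt ZFSet.card_insert_le ?_
  rw [ZFSet.card_singleton]
  exact lt_of_lt_of_le (Cardinal.add_lt_aleph0 Cardinal.one_lt_aleph0 Cardinal.one_lt_aleph0) hc

/-! ### The sets `HSet c` -/

variable {c : Cardinal.{u}}

/-- The union of `x` with transitive sets covering its elements is transitive, and regularity keeps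
it small. -/
theorem mem_HSet_of_forall (hc : c.IsRegular) {x : ZFSet.{u}} (hx : ∀ y ∈ x, y ∈ HSet c)
    (hcard : x.card < c) : x ∈ HSet c := by
  choose! t ht1 ht2 ht3 using hx
  let f : Shrink x → ZFSet.{u} := fun i => t ((equivShrink x).symm i).1
  have hsub : ∀ y ∈ x, t y ⊆ ZFSet.iUnion f := fun y hy z hz =>
    ZFSet.mem_iUnion.2 ⟨equivShrink x ⟨y, hy⟩, by simpa [f] using hz⟩
  refine ⟨x ∪ ZFSet.iUnion f, fun y hy z hz => ZFSet.mem_union.2 (Or.inr ?_),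
    fun y hy => ZFSet.mem_union.2 (Or.inl hy), ?_⟩
  · rcases ZFSet.mem_union.1 hy with hy | hy
    · exact hsub y hy (ht2 y hy hz)
    · obtain ⟨i, hi⟩ := ZFSet.mem_iUnion.1 hy
      exact ZFSet.mem_iUnion.2 ⟨i, ht1 _ ((equivShrink x).symm i).2 y hi hz⟩
  · refine ZFSet.card_union_le.trans_lt (Cardinal.add_lt_of_lt hc.aleph0_le hcard ?_)
    exact card_iUnion_lt hc hcard fun i => ht3 _ ((equivShrink x).symm i).2

theorem toZFSet_mem_HSet {a : Ordinal.{u}} (ha : a.card < c) : a.toZFSet ∈ HSet c :=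
  ⟨a.toZFSet, (ZFSet.isOrdinal_toZFSet a).isTransitive, fun _ h => h, by rwa [Ordinal.card_toZFSet]⟩

theorem pair_mem_HSet (hc : c.IsRegular) {x y : ZFSet.{u}} (hx : x ∈ HSet c) (hy : y ∈ HSet c) :
    ZFSet.pair x y ∈ HSet c := by
  have h : ∀ x y : ZFSet.{u}, x ∈ HSet c → y ∈ HSet c → ({x, y} : ZFSet.{u}) ∈ HSet c := by
    intro x y hx hy
    refine mem_HSet_of_forall hc (fun z hz => ?_) (card_pair_lt hc.aleph0_le x y)
    rcases ZFSet.mem_pair.1 hz with rfl | rfl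
    · exact hx
    · exact hy
  refine h _ _ ?_ (h x y hx hy)
  rw [← ZFSet.pair_eq_singleton]
  exact h x x hx hx

variable {lam : Cardinal.{u}} {p s : ZFSet.{u}} {a : Ordinal.{u}}

theorem exists_subset_prod (hlam : lam.IsRegular) (hs : IsSeq lam a s) (ha : a < lam.ord) :
    ∃ b < lam.ord, s ⊆ ZFSet.prod b.toZFSet b.toZFSet := by
  obtain ⟨b, hb, h⟩ := hs.exists_value_bound hlam ha
  refine ⟨max a b, max_lt ha hb, fun z hz => ?_⟩
  obtain ⟨x, hx, y, hy, rfl⟩ := hs.exists_eq_pair hz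
  exact ZFSet.pair_mem_prod.2 ⟨Ordinal.toZFSet_mem_toZFSet_iff.2 (lt_max_of_lt_left hx),
    Ordinal.toZFSet_mem_toZFSet_iff.2 (lt_max_of_lt_right (h x y hz))⟩

theorem card_powerset_prod_lt (hlam : lam.IsInaccessible) (ha : a < lam.ord) :
    (ZFSet.powerset (ZFSet.prod a.toZFSet a.toZFSet)).card < lam := by
  rw [ZFSet.card_powerset]
  refine hlam.isStrongPrelimit ((card_prod_le _ _).trans_lt ?_)
  rw [Ordinal.card_toZFSet]
  exact Cardinal.mul_lt_of_lt hlam.aleph0_lt.le (Cardinal.lt_ord.1 ha) (Cardinal.lt_ord.1 ha)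

/-- A condition has at most `lam` nodes. -/
theorem IsMillerCondition.card_le (hlam : lam.IsInaccessible) (hp : IsMillerCondition lam p) :
    p.card ≤ lam := by
  let f : lam.ord.ToType → ZFSet.{u} := fun i =>
    let b := (Ordinal.ToType.mk.symm i).1
    ZFSet.powerset (ZFSet.prod b.toZFSet b.toZFSet)
  have hsub : p ⊆ ZFSet.iUnion f := by
    intro s hs
    obtain ⟨b, hb, h⟩ := exists_subset_prod hlam.isRegular (hp.isTree.isSeq hs)
      (hp.isTree.len_lt hs)
    exact ZFSet.mem_iUnion.2 ⟨Ordinal.ToType.mk ⟨b, hb⟩, by simpa [f] using h⟩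
  refine (ZFSet.card_mono hsub).trans (card_iUnion_le hlam.aleph0_lt.le (by simp) fun i => ?_)
  exact (card_powerset_prod_lt hlam (Ordinal.ToType.mk.symm i).2).le

theorem IsMillerCondition.mem_HSet (hlam : lam.IsInaccessible) (hc : c.IsRegular) (h : lam < c)
    (hp : IsMillerCondition lam p) : p ∈ HSet c := by
  refine mem_HSet_of_forall hc (fun s hs => ?_) ((hp.card_le hlam).trans_lt h)
  have hs' := hp.isTree.isSeq hs
  have hord : ∀ a < lam.ord, a.toZFSet ∈ HSet c := fun a ha =>
    toZFSet_mem_HSet ((Cardinal.lt_ord.1 ha).trans h)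
  refine mem_HSet_of_forall hc (fun z hz => ?_) ?_
  · obtain ⟨x, hx, y, hy, rfl⟩ := hs'.exists_eq_pair hz
    exact pair_mem_HSet hc (hord x (hx.trans (hp.isTree.len_lt hs))) (hord y hy)
  · obtain ⟨b, hb, hsb⟩ := exists_subset_prod hlam.isRegular hs' (hp.isTree.len_lt hs)
    refine ((ZFSet.card_mono hsb).trans_lt ?_).trans h
    refine lt_of_le_of_lt ?_ (card_powerset_prod_lt hlam hb)
    rw [ZFSet.card_powerset]
    exact (Cardinal.cantor _).le

/-! ### Elementary subsets -/

theorem fusionLang_card_le : fusionLang.card ≤ ℵ₀ := by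
  have h1 : ∀ n, Countable (fusionLang.Functions n) := fun n =>
    inferInstanceAs (Countable Empty)
  have h2 : ∀ n, Countable (FusionRel n) := fun n => by
    let f : FusionRel n → ℕ := fun r => match r with
      | .mem => 0
      | .wo => 1
      | .poset => 2
      | .ext => 3
      | .dense => 4
      | .extra => 5
    refine ⟨f, fun x y h => ?_⟩
    cases x <;> cases y <;> simp_all [f]
  have h3 : ∀ n, Countable (fusionLang.Relations n) := h2
  exact Cardinal.mk_le_aleph0_iff.2 inferInstance

variable {H : Set ZFSet.{u}}

/-- The downward Löwenheim–Skolem theorem for subsets of `H`. -/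
theorem exists_isElementarySubset (S : fusionLang.Structure H) (hH : Infinite H)
    (hlam : ℵ₀ < lam) {Z : Set ZFSet.{u}} (hZ : Z ⊆ H)
    (hcard : #Z < Cardinal.lift.{u + 1} lam) :
    ∃ X : ZFSet.{u}, IsElementarySubset S X ∧ (∀ z ∈ Z, z ∈ X) ∧ X.card < lam := by
  let Z' : Set H := {x | x.1 ∈ Z}
  have hZ' : #Z' ≤ #Z := Cardinal.mk_le_of_injective (f := fun x => (⟨x.1.1, x.2⟩ : Z))
    fun x y h => Subtype.ext (Subtype.ext (congrArg (fun z : Z => z.1) h))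
  have hk : max #Z' ℵ₀ < Cardinal.lift.{u + 1} lam := max_lt (hZ'.trans_lt hcard) (by simpa using hlam)
  obtain ⟨N, hN1, hN2⟩ := FirstOrder.Language.exists_elementarySubstructure_card_eq fusionLang
    Z' (max #Z' ℵ₀) (le_max_right _ _) (by simp) (by
      refine (Cardinal.lift_le.2 fusionLang_card_le).trans ?_
      simp)
    (by
      rw [Cardinal.lift_id, Cardinal.lift_id]
      exact max_le (Cardinal.mk_set_le _) (Cardinal.aleph0_le_mk H))
  rw [Cardinal.lift_id, Cardinal.lift_id] at hN2
  -- Having fewer than `lam` elements, the submodel can be collected into a set of the universe.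
  have hsm : Small.{u} N := by
    rw [small_iff_lift_mk_lt_univ, Cardinal.lift_id, hN2]
    exact hk.trans (Cardinal.lift_lt_univ' lam)
  let X : ZFSet.{u} := ZFSet.range fun i : N => i.1.1
  have hX : ∀ x : H, x ∈ N ↔ x.1 ∈ X := fun x => by
    rw [ZFSet.mem_range]
    constructor
    · intro h
      exact ⟨⟨x, h⟩, rfl⟩
    · rintro ⟨i, hi⟩
      rw [← Subtype.ext hi]
      exact i.2
  refine ⟨X, ⟨fun x hx => ?_, N, hX⟩, fun z hz => ?_, ?_⟩
  · obtain ⟨i, rfl⟩ := ZFSet.mem_range.1 hx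
    exact i.1.2
  · exact (hX ⟨z, hZ hz⟩).1 (hN1 hz)
  · have h1 := ZFSet.lift_card_range_le (f := fun i : N => i.1.1)
    rw [hN2, Cardinal.lift_id'.{u, u + 1}] at h1
    exact Cardinal.lift_lt.1 (h1.trans_lt hk)

/-- The union of a chain of elementary subsets is an elementary subset. -/
theorem isElementarySubset_union (S : fusionLang.Structure H) {d : Ordinal.{u}} (hd : 0 < d)
    {X : Ordinal.{u} → ZFSet.{u}} {Y : ZFSet.{u}} (hX : ∀ a < d, IsElementarySubset S (X a))
    (hmono : ∀ b < d, ∀ a ≤ b, X a ⊆ X b) (hY : ∀ x, x ∈ Y ↔ ∃ a < d, x ∈ X a) :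
    IsElementarySubset S Y := by
  let N : fusionLang.Substructure H := ⟨{x | x.1 ∈ Y}, fun f => Empty.elim f⟩
  refine ⟨fun x hx => ?_, N.toElementarySubstructure fun n φ x a h => ?_, fun x => Iff.rfl⟩
  · obtain ⟨a, ha, h⟩ := (hY x).1 hx
    exact (hX a ha).1 x h
  -- Tarski–Vaught test: the finitely many parameters lie in one member of the chain, whose
  -- elementarity gives a witness.
  · have hx : ∀ i, ∃ a < d, (x i).1.1 ∈ X a := fun i => (hY _).1 (x i).2
    choose e he hxe using hx
    obtain ⟨m, hm, hem⟩ : ∃ m < d, ∀ i, e i ≤ m := by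
      rcases isEmpty_or_nonempty (Fin n) with hn | hn
      · exact ⟨0, hd, fun i => (hn.false i).elim⟩
      · obtain ⟨i, hi⟩ := Finite.exists_max e
        exact ⟨e i, he i, hi⟩
    obtain ⟨M, hM⟩ := (hX m hm).2
    have hxM : ∀ i, (x i).1 ∈ M := fun i => (hM _).2 (hmono m hm _ (hem i) (hxe i))
    let y : Fin n → M := fun i => ⟨(x i).1, hxM i⟩
    have h1 : φ.ex.Realize (default : Empty → H) (M.subtype ∘ y) :=
      FirstOrder.Language.BoundedFormula.realize_ex.2 ⟨a, h⟩
    have hdef : (default : Empty → H) = M.subtype ∘ (default : Empty → M) :=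
      Subsingleton.elim _ _
    rw [hdef, M.subtype.map_boundedFormula, FirstOrder.Language.BoundedFormula.realize_ex] at h1
    obtain ⟨b, hb⟩ := h1
    rw [← M.subtype.map_boundedFormula, ← hdef, Fin.comp_snoc] at hb
    exact ⟨⟨b.1, (hY _).2 ⟨m, hm, (hM _).1 b.2⟩⟩, hb⟩

end

section

variable {lam : Cardinal.{u}} {p q r s t : ZFSet.{u}} {a b c n : Ordinal.{u}}

/-! ### The full tree -/

/-- The largest condition. -/
def fullTree (lam : Cardinal.{u}) : ZFSet.{u} :=
  ZFSet.sep (fun s => (∃ a < lam.ord, IsSeq lam a s) ∧ IsIncreasingSeq s ∧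
    ∀ b y : Ordinal.{u}, IsRegularOrd b → ZFSet.pair b.toZFSet y.toZFSet ∈ s → y = 0)
    (ZFSet.powerset (ZFSet.prod lam.ord.toZFSet lam.ord.toZFSet))

theorem mem_fullTree : s ∈ fullTree lam ↔ (∃ a < lam.ord, IsSeq lam a s) ∧ IsIncreasingSeq s ∧
    ∀ b y : Ordinal.{u}, IsRegularOrd b → ZFSet.pair b.toZFSet y.toZFSet ∈ s → y = 0 := by
  rw [fullTree, ZFSet.mem_sep, and_iff_right_iff_imp, ZFSet.mem_powerset]
  rintro ⟨⟨a, ha, hs⟩, -⟩ z hz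
  obtain ⟨x, hx, y, hy, rfl⟩ := hs.exists_eq_pair hz
  exact ZFSet.pair_mem_prod.2 ⟨Ordinal.toZFSet_mem_toZFSet_iff.2 (hx.trans ha),
    Ordinal.toZFSet_mem_toZFSet_iff.2 hy⟩

theorem pair_mem_snoc_iff (hs : IsSeq lam a s) {x y : Ordinal.{u}} :
    ZFSet.pair x.toZFSet y.toZFSet ∈ snoc s c ↔
      (x = a ∧ y = c) ∨ ZFSet.pair x.toZFSet y.toZFSet ∈ s := by
  rw [snoc, hs.len_eq, ZFSet.mem_insert_iff, ZFSet.pair_inj, Ordinal.toZFSet_injective.eq_iff,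
    Ordinal.toZFSet_injective.eq_iff]

theorem nextSet_fullTree_of_regular (hlam : lam.IsRegular) (hs : s ∈ fullTree lam)
    (hsa : IsSeq lam a s) (ha : IsRegularOrd a) : nextSet lam (fullTree lam) s = {0} := by
  obtain ⟨⟨a', ha', hs'⟩, hinc, hreg⟩ := mem_fullTree.1 hs
  obtain rfl : a = a' := hsa.len_eq.symm.trans hs'.len_eq
  ext c
  rw [mem_nextSet hsa, Set.mem_singleton_iff]
  constructor
  · intro hc
    exact (mem_fullTree.1 hc).2.2 a c ha (pair_mem_snoc hsa c)
  · rintro rfl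
    refine mem_fullTree.2 ⟨⟨a + 1, hlam.isSuccLimit_ord.add_one_lt ha', hsa.snoc hlam.ord_pos⟩,
      fun b d x y hbd hb hd hx hy => ?_, fun b y hb hy => ?_⟩
    · rw [pair_mem_snoc_iff hsa] at hx hy
      rcases hx with ⟨rfl, -⟩ | hx
      · exact (hb ha).elim
      rcases hy with ⟨rfl, -⟩ | hy
      · exact (hd ha).elim
      exact hinc b d x y hbd hb hd hx hy
    · rcases (pair_mem_snoc_iff hsa).1 hy with ⟨-, rfl⟩ | hy
      · rfl
      · exact hreg b y hb hy

theorem isCobounded_nextSet_fullTree (hlam : lam.IsRegular) (hs : s ∈ fullTree lam)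
    (hsa : IsSeq lam a s) (ha : ¬ IsRegularOrd a) :
    IsCobounded lam (nextSet lam (fullTree lam) s) := by
  obtain ⟨⟨a', ha', hs'⟩, hinc, hreg⟩ := mem_fullTree.1 hs
  obtain rfl : a = a' := hsa.len_eq.symm.trans hs'.len_eq
  obtain ⟨d, hd, hbd⟩ := hsa.exists_value_bound hlam ha'
  refine ⟨fun c hc => ?_, d, hd, fun c hdc hc => ?_⟩
  · obtain ⟨⟨e, -, he⟩, -⟩ := mem_fullTree.1 ((mem_nextSet hsa).1 hc)
    exact hsa.lt_of_snoc he
  · refine (mem_nextSet hsa).2 (mem_fullTree.2 ⟨⟨a + 1, hlam.isSuccLimit_ord.add_one_lt ha',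
      hsa.snoc hc⟩, fun b e x y hbe hb he hx hy => ?_, fun b y hb hy => ?_⟩)
    · rw [pair_mem_snoc_iff hsa] at hx hy
      rcases hx with ⟨rfl, -⟩ | hx
      · rcases hy with ⟨rfl, -⟩ | hy
        · exact hbe.false.elim
        · exact ((hsa.lt hy).1.trans hbe).false.elim
      rcases hy with ⟨rfl, rfl⟩ | hy
      · exact (hbd b x hx).trans_le hdc
      · exact hinc b e x y hbe hb he hx hy
    · rcases (pair_mem_snoc_iff hsa).1 hy with ⟨rfl, -⟩ | hy
      · exact (ha hb).elim
      · exact hreg b y hb hy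

theorem isMillerCondition_fullTree (hlam : lam.IsRegular) :
    IsMillerCondition lam (fullTree lam) := by
  have hsub : ∀ s ∈ fullTree lam, ∀ t a, a < lam.ord → IsSeq lam a t → t ⊆ s →
      t ∈ fullTree lam := by
    intro s hs t a ha ht hts
    obtain ⟨-, hinc, hreg⟩ := mem_fullTree.1 hs
    exact mem_fullTree.2 ⟨⟨a, ha, ht⟩, fun b c x y hbc hb hc hx hy =>
      hinc b c x y hbc hb hc (hts hx) (hts hy), fun b y hb hy => hreg b y hb (hts hy)⟩
  refine ⟨⟨∅, mem_fullTree.2 ⟨⟨0, hlam.ord_pos, isSeq_zero_empty⟩,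
      fun _ _ _ _ _ _ _ h => (ZFSet.notMem_empty _ h).elim,
      fun _ _ _ h => (ZFSet.notMem_empty _ h).elim⟩⟩, fun s hs => ?_, fun s hs t a ht hts => ?_,
    fun a ha hl s hs hall => ?_, fun s hs => ?_, fun s hs a ha hsa => ?_, fun s hs => ?_,
    fun a ha hsing s hs hsa _ => ⟨hs, ?_⟩⟩
  · obtain ⟨⟨a, ha, hsa⟩, hinc, -⟩ := mem_fullTree.1 hs
    exact ⟨a, ha, hsa, hinc⟩
  · obtain ⟨⟨b, hb, hsb⟩, -⟩ := mem_fullTree.1 hs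
    exact hsub s hs t a ((hsb.le_of_subset ht hts).trans_lt hb) ht hts
  · have hres : ∀ c < a, res s (c + 1) ∈ fullTree lam := fun c hc =>
      hall _ (c + 1) (hl.add_one_lt hc) (hs.res (Order.add_one_le_iff.2 hc)) (res_subset _ _)
    have hmem : ∀ c d x : Ordinal.{u}, c ≤ d → ZFSet.pair c.toZFSet x.toZFSet ∈ s →
        ZFSet.pair c.toZFSet x.toZFSet ∈ res s (d + 1) := fun c d x hcd hx =>
      pair_mem_res.2 ⟨Order.lt_add_one_iff.2 hcd, hx⟩
    refine mem_fullTree.2 ⟨⟨a, ha, hs⟩, fun b c x y hbc hb hc hx hy => ?_, fun b y hb hy => ?_⟩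
    · exact (mem_fullTree.1 (hres c (hs.lt hy).1)).2.1 b c x y hbc hb hc (hmem b c x hbc.le hx)
        (hmem c c y le_rfl hy)
    · exact (mem_fullTree.1 (hres b (hs.lt hy).1)).2.2 b y hb (hmem b b y le_rfl hy)
  · obtain ⟨⟨a, ha, hsa⟩, -⟩ := mem_fullTree.1 hs
    by_cases hreg : IsRegularOrd a
    · exact Or.inl ⟨0, nextSet_fullTree_of_regular hlam hs hsa hreg⟩
    · exact Or.inr (isCobounded_nextSet_fullTree hlam hs hsa hreg)
  · exact nextSet_fullTree_of_regular hlam hs hsa ha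
  · obtain ⟨⟨a, ha, hsa⟩, -⟩ := mem_fullTree.1 hs
    by_cases hreg : IsRegularOrd a
    -- A node of regular length does not split, but its only successor has successor length and
    -- does.
    · have h0 : (0 : Ordinal.{u}) ∈ nextSet lam (fullTree lam) s := by
        rw [nextSet_fullTree_of_regular hlam hs hsa hreg]
        rfl
      have hmem := (mem_nextSet hsa).1 h0
      refine ⟨_, subset_snoc s 0, hmem, isCobounded_nextSet_fullTree hlam hmem
        (hsa.snoc hlam.ord_pos) fun h => ?_⟩
      exact (h.isSuccLimit.add_one_lt (Order.lt_add_one_iff.2 le_rfl)).false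
    · exact ⟨s, fun _ h => h, hs, isCobounded_nextSet_fullTree hlam hs hsa hreg⟩
  · obtain ⟨⟨b, -, hsb⟩, -⟩ := mem_fullTree.1 hs
    have hsa' : IsSeq lam a s := by
      refine ⟨fun z hz => ?_, hsa.2⟩
      obtain ⟨x, hx, y, hy, rfl⟩ := ZFSet.mem_prod.1 (hsa.1 hz)
      exact ZFSet.pair_mem_prod.2 ⟨hx, Ordinal.toZFSet_monotone ha.le hy⟩
    exact isCobounded_nextSet_fullTree hlam hs hsa' hsing.2

/-- Restricting the full tree to the one-term sequences `⟨c⟩` gives `lam` distinct conditions. -/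
theorem le_card_millerForcing (hlam : lam.IsRegular) :
    lam ≤ (millerForcing lam).carrier.card := by
  have hF := isMillerCondition_fullTree hlam
  have hmem : ∀ c < lam.ord, snoc ∅ c ∈ fullTree lam := fun c hc => by
    refine mem_fullTree.2 ⟨⟨0 + 1, hlam.isSuccLimit_ord.add_one_lt hlam.ord_pos,
      isSeq_zero_empty.snoc hc⟩, fun b d x y hbd hb hd hx hy => ?_, fun b y hb hy => ?_⟩
    · rw [pair_mem_snoc_iff (isSeq_zero_empty (lam := lam))] at hx hy
      rcases hx with ⟨rfl, -⟩ | hx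
      · rcases hy with ⟨rfl, -⟩ | hy
        · exact hbd.false.elim
        · exact (ZFSet.notMem_empty _ hy).elim
      · exact (ZFSet.notMem_empty _ hx).elim
    · rcases (pair_mem_snoc_iff (isSeq_zero_empty (lam := lam))).1 hy with ⟨rfl, -⟩ | hy
      · exact (not_lt_bot hb.isSuccLimit.bot_lt).elim
      · exact (ZFSet.notMem_empty _ hy).elim
  let f : Set.Iio lam.ord → (millerForcing lam).carrier := fun c =>
    ⟨restr (fullTree lam) (snoc ∅ c.1),
      mem_millerForcing_carrier.2 (isMillerCondition_restr hlam hF (hmem c.1 c.2))⟩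
  have hf : Function.Injective f := by
    intro c d hcd
    have h1 : restr (fullTree lam) (snoc ∅ c.1) = restr (fullTree lam) (snoc ∅ d.1) :=
      congrArg Subtype.val hcd
    have h2 := (mem_restr.1 (h1 ▸ self_mem_restr (hmem c.1 c.2))).2
    have hc := isSeq_zero_empty.snoc c.2
    have hd := isSeq_zero_empty.snoc d.2
    have heq : snoc ∅ c.1 = snoc ∅ d.1 := by
      rcases h2 with h | h
      · exact hd.eq_of_subset hc h
      · exact (hc.eq_of_subset hd h).symm
    exact Subtype.ext (isSeq_zero_empty.snoc_injective c.2 heq)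
  have := Cardinal.mk_le_of_injective hf
  rw [Cardinal.mk_Iio_ordinal, Cardinal.card_ord, ZFSet.cardinalMk_coe_sort] at this
  exact Cardinal.lift_le.1 this

theorem isRegular_succCard (hlam : lam.IsRegular) : (millerForcing lam).succCard.IsRegular :=
  isRegular_succ (hlam.aleph0_le.trans (le_card_millerForcing hlam))

theorem lt_succCard (hlam : lam.IsRegular) : lam < (millerForcing lam).succCard :=
  Order.lt_succ_of_le (le_card_millerForcing hlam)

theorem mem_HSet_of_subset_carrier (hlam : lam.IsInaccessible)
    (h : r ⊆ (millerForcing lam).carrier) : r ∈ HSet (millerForcing lam).succCard :=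
  mem_HSet_of_forall (isRegular_succCard hlam.isRegular)
    (fun _ hp => (mem_millerForcing_carrier.1 (h hp)).mem_HSet hlam
      (isRegular_succCard hlam.isRegular) (lt_succCard hlam.isRegular))
    (Order.lt_succ_of_le (ZFSet.card_mono h))

theorem infinite_HSet {c : Cardinal.{u}} (hc : ℵ₀ ≤ c) : Infinite (HSet c) := by
  refine Infinite.of_injective (fun n : ℕ => (⟨(n : Ordinal.{u}).toZFSet, toZFSet_mem_HSet ?_⟩ :
    HSet c)) fun m n h => ?_
  · rw [Ordinal.card_nat]
    exact Cardinal.natCast_lt_aleph0.trans_le hc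
  · exact Nat.cast_injective (Ordinal.toZFSet_injective (congrArg Subtype.val h))

/-! ### The recursive construction -/

/-- `y = (P (a + 1), X (a + 1))` is a successor of the sequence `h` of pairs `(P b, X b)`,
`b ≤ a`. -/
structure IsSuccStage (lam : Cardinal.{u}) (n : Ordinal.{u}) (D : Ordinal.{u} → ZFSet.{u})
    (a : Ordinal.{u}) (h : Ordinal.{u} → ZFSet.{u} × ZFSet.{u}) (y : ZFSet.{u} × ZFSet.{u}) :
    Prop where
  agree : Agree lam (n + a) y.1 (h a).1
  good : ∀ t ∈ front lam (n + a) (h a).1, IsGood lam (h a).2 (D a) (restr y.1 t)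
  sub : (h a).2 ⊆ y.2
  ord_mem : a.toZFSet ∈ y.2
  left_mem : (h a).1 ∈ y.2
  right_mem : y.1 ∈ y.2
  restr_mem : ∀ x ∈ (h a).2, ∀ t ∈ x, IsMillerCondition lam x →
    t ⊆ ZFSet.prod a.toZFSet a.toZFSet → restr x t ∈ y.2
  pick_mem : ∀ x ∈ (h a).2, ∀ E ∈ (h a).2, (millerForcing lam).IsDense E → (∃ d ∈ E, x ⊆ d) →
    ∃ d ∈ E, x ⊆ d ∧ d ∈ y.2
  approach : ∃ f ∈ y.2, ∀ z, z ∈ f ↔ ∃ b ≤ a, z = ZFSet.pair b.toZFSet (h b).2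
  front_mem : ∃ w ∈ y.2, ∀ r, r ∈ w ↔ IsMillerCondition lam r ∧
    (¬ (millerForcing lam).Compatible r y.1 ∨
      ∃ t ∈ front lam (n + a) (h a).1, r ⊆ restr y.1 t)

/-- `y = (P i, X i)` continues the sequence `h` of pairs `(P b, X b)`, `b < i`. -/
structure IsStage (lam : Cardinal.{u}) (n : Ordinal.{u}) (p : ZFSet.{u})
    (D : Ordinal.{u} → ZFSet.{u})
    (S : fusionLang.Structure (HSet (millerForcing lam).succCard)) (i : Ordinal.{u})
    (h : Ordinal.{u} → ZFSet.{u} × ZFSet.{u}) (y : ZFSet.{u} × ZFSet.{u}) : Prop where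
  cond : IsMillerCondition lam y.1
  elem : IsElementarySubset S y.2
  card : y.2.card < lam
  zero : i = 0 → y.1 = p
  succ : ∀ a, i = a + 1 → IsSuccStage lam n D a h y
  limit : Order.IsSuccLimit i → (∀ s, s ∈ y.1 ↔ ∀ a < i, s ∈ (h a).1) ∧
    ∀ x, x ∈ y.2 ↔ ∃ a < i, x ∈ (h a).2

variable {D : Ordinal.{u} → ZFSet.{u}}
  {S : fusionLang.Structure (HSet (millerForcing lam).succCard)} {i d : Ordinal.{u}}
  {h h' : Ordinal.{u} → ZFSet.{u} × ZFSet.{u}} {y : ZFSet.{u} × ZFSet.{u}}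

theorem IsStage.congr (hh : ∀ j < i, h j = h' j) (hy : IsStage lam n p D S i h y) :
    IsStage lam n p D S i h' y := by
  refine ⟨hy.cond, hy.elem, hy.card, hy.zero, ?_, fun hl => ⟨fun s => ?_, fun x => ?_⟩⟩
  · rintro a rfl
    have hle : ∀ b ≤ a, h b = h' b := fun b hb => hh b (Order.lt_add_one_iff.2 hb)
    have ha := hle a le_rfl
    obtain ⟨h1, h2, h3, h4, h5, h6, h7, h8, ⟨f, hf, hf'⟩, h10⟩ := hy.succ a rfl
    rw [ha] at h1 h2 h3 h5 h7 h8 h10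
    refine ⟨h1, h2, h3, h4, h5, h6, h7, h8, ⟨f, hf, fun z => ?_⟩, h10⟩
    rw [hf']
    refine exists_congr fun b => and_congr_right fun hb => ?_
    rw [hle b hb]
  · rw [(hy.limit hl).1]
    exact forall₂_congr fun a ha => by rw [hh a ha]
  · rw [(hy.limit hl).2]
    exact exists_congr fun a => and_congr_right fun ha => by rw [hh a ha]

theorem IsStage.mono (hh : ∀ j < d, IsStage lam n p D S j h (h j)) (hb : b < d) (hab : a ≤ b) :
    (h b).1 ⊆ (h a).1 ∧ (h a).2 ⊆ (h b).2 := by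
  induction b using Ordinal.limitRecOn with
  | zero =>
    obtain rfl : a = 0 := le_antisymm hab bot_le
    exact ⟨fun _ h => h, fun _ h => h⟩
  | add_one c ih =>
    rcases hab.eq_or_lt with rfl | hlt
    · exact ⟨fun _ h => h, fun _ h => h⟩
    have hc : c < d := (Order.lt_add_one_iff.2 le_rfl).trans hb
    have h1 := ih hc (Order.lt_add_one_iff.1 hlt)
    have h2 := (hh _ hb).succ c rfl
    exact ⟨fun z hz => h1.1 (h2.agree.1 hz), fun z hz => h2.sub (h1.2 hz)⟩
  | limit b hl ih =>
    rcases hab.eq_or_lt with rfl | hlt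
    · exact ⟨fun _ h => h, fun _ h => h⟩
    have h1 := (hh b hb).limit hl
    exact ⟨fun z hz => (h1.1 z).1 hz a hlt, fun z hz => (h1.2 z).2 ⟨a, hlt, hz⟩⟩

/-- What the later arguments need from `X (a + 1)` is put in by hand, so `S` may be any structure on
the underlying set. The set `w` lets a generic set choose a front node; the restrictions `restr x t`
and the chosen elements of dense sets serve genericity of the fusion; `f` gives internal
approachability. -/
theorem exists_isStage_succ (hlam : lam.IsInaccessible)
    (hD : ∀ a < lam.ord, (millerForcing lam).IsDenseOpen (D a)) (ha : a < lam.ord)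
    (hh : ∀ j < a + 1, IsStage lam n p D S j h (h j)) : ∃ y, IsStage lam n p D S (a + 1) h y := by
  have hreg := hlam.isRegular
  have hθ := isRegular_succCard hreg
  have hlt := lt_succCard hreg
  have haa : a < a + 1 := Order.lt_add_one_iff.2 le_rfl
  have hsa := hh a haa
  obtain ⟨P, hP, hagree, hgood⟩ := exists_fusion_step hreg hlam.aleph0_lt hsa.card (hD a ha)
    (n + a) hsa.cond
  let pick : ZFSet.{u} → ZFSet.{u} → ZFSet.{u} := fun x E => Classical.epsilon fun d => d ∈ E ∧ x ⊆ d
  let f : ZFSet.{u} := ZFSet.range fun b : Set.Iio (a + 1) => ZFSet.pair b.1.toZFSet (h b.1).2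
  let w : ZFSet.{u} := ZFSet.sep (fun r => ¬ (millerForcing lam).Compatible r P ∨
    ∃ t ∈ front lam (n + a) (h a).1, r ⊆ restr P t) (millerForcing lam).carrier
  have hcondH : ∀ r, IsMillerCondition lam r → r ∈ HSet (millerForcing lam).succCard :=
    fun r hr => hr.mem_HSet hlam hθ hlt
  have hordH : ∀ b < lam.ord, b.toZFSet ∈ HSet (millerForcing lam).succCard := fun b hb =>
    toZFSet_mem_HSet ((Cardinal.lt_ord.1 hb).trans hlt)
  have hfH : f ∈ HSet (millerForcing lam).succCard := by
    refine mem_HSet_of_forall hθ (fun z hz => ?_) ?_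
    · obtain ⟨b, rfl⟩ := ZFSet.mem_range.1 hz
      have hb := hh b.1 b.2
      exact pair_mem_HSet hθ (hordH _ ((Order.lt_add_one_iff.1 b.2).trans_lt ha))
        (mem_HSet_of_forall hθ hb.elem.1 (hb.card.trans hlt))
    · have h1 := ZFSet.lift_card_range_le
        (f := fun b : Set.Iio (a + 1) => ZFSet.pair b.1.toZFSet (h b.1).2)
      rw [Cardinal.mk_Iio_ordinal, Cardinal.lift_id'.{u, u + 1}, Cardinal.lift_le] at h1
      exact (h1.trans_lt (Cardinal.lt_ord.1 (hreg.isSuccLimit_ord.add_one_lt ha))).trans hlt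
  have hwH : w ∈ HSet (millerForcing lam).succCard :=
    mem_HSet_of_subset_carrier hlam ZFSet.sep_subset
  let X : Set ZFSet.{u} := ((h a).2 : Set ZFSet.{u})
  -- The model has fewer than `lam` elements, while conditions may have `lam` nodes. Only nodes
  -- inside `a × a` are treated at this stage; there are few of them because `lam` is a strong
  -- limit, and every node is reached at some stage.
  let Y : Set ZFSet.{u} := (ZFSet.powerset (ZFSet.prod a.toZFSet a.toZFSet) : Set ZFSet.{u})
  -- The intersection with the underlying set discards irrelevant values of `pick` and `restr`.
  let Z : Set ZFSet.{u} := {z | z ∈ HSet (millerForcing lam).succCard ∧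
    z ∈ X ∪ Set.image2 pick X X ∪ Set.image2 restr X Y ∪ {a.toZFSet, (h a).1, P, f, w}}
  have hω : ℵ₀ ≤ Cardinal.lift.{u + 1} lam := by simpa using hlam.aleph0_lt.le
  have hX : #X < Cardinal.lift.{u + 1} lam := by
    have : #X = Cardinal.lift.{u + 1} (h a).2.card := ZFSet.cardinalMk_coe_sort
    rw [this, Cardinal.lift_lt]
    exact hsa.card
  have hY : #Y < Cardinal.lift.{u + 1} lam := by
    have : #Y = Cardinal.lift.{u + 1} (ZFSet.powerset (ZFSet.prod a.toZFSet a.toZFSet)).card :=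
      ZFSet.cardinalMk_coe_sort
    rw [this, Cardinal.lift_lt]
    exact card_powerset_prod_lt hlam ha
  have hZ : #Z < Cardinal.lift.{u + 1} lam := by
    refine (Cardinal.mk_le_mk_of_subset fun z hz => hz.2).trans_lt ?_
    have himg : ∀ (g : ZFSet.{u} → ZFSet.{u} → ZFSet.{u}) (U V : Set ZFSet.{u}),
        #U < Cardinal.lift.{u + 1} lam → #V < Cardinal.lift.{u + 1} lam →
        #(Set.image2 g U V) < Cardinal.lift.{u + 1} lam := fun g U V hU hV => by
      rw [← Set.image_prod]
      refine Cardinal.mk_image_le.trans_lt ?_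
      rw [Cardinal.mk_setProd]
      exact Cardinal.mul_lt_of_lt hω (by simpa using hU) (by simpa using hV)
    have hfin : #({a.toZFSet, (h a).1, P, f, w} : Set ZFSet.{u}) < Cardinal.lift.{u + 1} lam :=
      ((Set.toFinite _).lt_aleph0).trans_le hω
    exact (Cardinal.mk_union_le _ _).trans_lt (Cardinal.add_lt_of_lt hω
      ((Cardinal.mk_union_le _ _).trans_lt (Cardinal.add_lt_of_lt hω
        ((Cardinal.mk_union_le _ _).trans_lt (Cardinal.add_lt_of_lt hω hX (himg _ _ _ hX hX)))
        (himg _ _ _ hX hY))) hfin)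
  obtain ⟨N, hN1, hN2, hN3⟩ := exists_isElementarySubset S (infinite_HSet hθ.aleph0_le)
    hlam.aleph0_lt (Z := Z) (fun z hz => hz.1) hZ
  have hfin : ∀ z ∈ HSet (millerForcing lam).succCard,
      z ∈ ({a.toZFSet, (h a).1, P, f, w} : Set ZFSet.{u}) → z ∈ N := fun z hz hz' =>
    hN2 z ⟨hz, Or.inr hz'⟩
  refine ⟨(P, N), hP, hN1, hN3, fun h0 => ?_, ?_, fun hl => ?_⟩
  · exact (h0 ▸ haa).not_ge bot_le |>.elim
  · intro a' ha'
    obtain rfl : a = a' := by simpa using ha'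
    refine ⟨hagree, hgood, fun z hz => hN2 z ⟨hsa.elem.1 z hz, Or.inl (Or.inl (Or.inl hz))⟩,
      hfin _ (hordH a ha) (by simp), hfin _ (hcondH _ hsa.cond) (by simp),
      hfin _ (hcondH _ hP) (by simp), fun x hx t ht hxc hta => ?_, fun x hx E hE hEd hex => ?_,
      ⟨f, hfin _ hfH (by simp), fun z => ?_⟩, ⟨w, hfin _ hwH (by simp), fun r => ?_⟩⟩
    · refine hN2 _ ⟨hcondH _ (isMillerCondition_restr hreg hxc ht), Or.inl (Or.inr ?_)⟩
      exact ⟨x, hx, t, ZFSet.mem_powerset.2 hta, rfl⟩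
    · obtain ⟨h1, h2⟩ : pick x E ∈ E ∧ x ⊆ pick x E := Classical.epsilon_spec hex
      refine ⟨pick x E, h1, h2, hN2 _ ⟨hcondH _ (mem_millerForcing_carrier.1 (hEd.1 h1)),
        Or.inl (Or.inl (Or.inr ⟨x, hx, E, hE, rfl⟩))⟩⟩
    · rw [ZFSet.mem_range]
      constructor
      · rintro ⟨b, rfl⟩
        exact ⟨b.1, Order.lt_add_one_iff.1 b.2, rfl⟩
      · rintro ⟨b, hb, rfl⟩
        exact ⟨⟨b, Order.lt_add_one_iff.2 hb⟩, rfl⟩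
    · rw [ZFSet.mem_sep, mem_millerForcing_carrier]
  · exact (hl.add_one_lt haa).false.elim

theorem exists_isStage (hlam : lam.IsInaccessible) (hp : IsMillerCondition lam p)
    (hD : ∀ a < lam.ord, (millerForcing lam).IsDenseOpen (D a)) (hi : i < lam.ord)
    (hh : ∀ j < i, IsStage lam n p D S j h (h j)) : ∃ y, IsStage lam n p D S i h y := by
  have hreg := hlam.isRegular
  induction i using Ordinal.limitRecOn with
  | zero =>
    obtain ⟨N, hN1, -, hN3⟩ := exists_isElementarySubset S
      (infinite_HSet (isRegular_succCard hreg).aleph0_le) hlam.aleph0_lt (Z := ∅)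
      (Set.empty_subset _) (by simpa using hlam.pos)
    refine ⟨(p, N), hp, hN1, hN3, fun _ => rfl, fun a ha => ?_, fun hl => ?_⟩
    · exact ((Order.lt_add_one_iff.2 le_rfl).trans_eq ha.symm : a < 0).not_ge bot_le |>.elim
    · exact (not_lt_bot hl.bot_lt).elim
  | add_one a _ => exact exists_isStage_succ hlam hD ((Order.lt_add_one_iff.2 le_rfl).trans hi) hh
  | limit i hl _ =>
    have hpos : 0 < i := hl.bot_lt
    let P : ZFSet.{u} := ZFSet.sep (fun s => ∀ a < i, s ∈ (h a).1) (h 0).1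
    have hP : ∀ s, s ∈ P ↔ ∀ a < i, s ∈ (h a).1 := fun s =>
      ⟨fun hs => (ZFSet.mem_sep.1 hs).2, fun hs => ZFSet.mem_sep.2 ⟨hs 0 hpos, hs⟩⟩
    let f : i.ToType → ZFSet.{u} := fun a => (h (Ordinal.ToType.mk.symm a).1).2
    have hX : ∀ x, x ∈ ZFSet.iUnion f ↔ ∃ a < i, x ∈ (h a).2 := fun x => by
      rw [ZFSet.mem_iUnion]
      constructor
      · rintro ⟨a, ha⟩
        exact ⟨_, (Ordinal.ToType.mk.symm a).2, ha⟩
      · rintro ⟨a, ha, hx⟩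
        exact ⟨Ordinal.ToType.mk ⟨a, ha⟩, by simpa [f] using hx⟩
    refine ⟨(P, ZFSet.iUnion f), ?_, ?_, ?_, fun h0 => (hpos.ne' h0).elim, ?_,
      fun _ => ⟨hP, hX⟩⟩
    · have : Nonempty (Set.Iio i) := ⟨⟨0, hpos⟩⟩
      refine isMillerCondition_inter (ι := Set.Iio i) (f := fun a => (h a.1).1) hreg
        hlam.aleph0_lt (by simpa [Cardinal.lt_ord, ← Ordinal.lift_card] using hi)
        (fun a => (hh a.1 a.2).cond) (fun a b => ?_) fun s => ?_
      · rcases le_total a.1 b.1 with hab | hab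
        · exact Or.inr (IsStage.mono hh b.2 hab).1
        · exact Or.inl (IsStage.mono hh a.2 hab).1
      · rw [hP]
        exact ⟨fun hs a => hs a.1 a.2, fun hs a ha => hs ⟨a, ha⟩⟩
    · exact isElementarySubset_union S hpos (fun a ha => (hh a ha).elem)
        (fun b hb a hab => (IsStage.mono hh hb hab).2) hX
    · refine card_iUnion_lt hreg ?_ fun a => (hh _ (Ordinal.ToType.mk.symm a).2).card
      simpa [Cardinal.lt_ord] using hi
    · rintro a rfl
      exact (hl.add_one_lt (Order.lt_add_one_iff.2 le_rfl)).false.elim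

theorem exists_stages (hlam : lam.IsInaccessible) (hp : IsMillerCondition lam p)
    (hD : ∀ a < lam.ord, (millerForcing lam).IsDenseOpen (D a)) :
    ∃ h, ∀ i < lam.ord, IsStage lam n p D S i h (h i) :=
  exists_transfinite_choice lam.ord (IsStage lam n p D S) (fun _ _ _ _ => IsStage.congr)
    fun _ hi _ => exists_isStage hlam hp hD hi

end

section

variable {lam : Cardinal.{u}} {p p' q r s t : ZFSet.{u}} {a b c n d mu : Ordinal.{u}}
  {D : Ordinal.{u} → ZFSet.{u}}
  {S : fusionLang.Structure (HSet (millerForcing lam).succCard)}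
  {h : Ordinal.{u} → ZFSet.{u} × ZFSet.{u}} {X : Ordinal.{u} → ZFSet.{u}}

/-! ### The chain of models and the fusion sequence -/

theorem isAgreeSeq_of_isStage (hlam : lam.IsRegular)
    (hh : ∀ i < lam.ord, IsStage lam n p D S i h (h i)) : IsAgreeSeq lam n fun a => (h a).1 where
  cond a ha := (hh a ha).cond
  anti _ hb _ hab := (IsStage.mono hh hb hab).1
  succ a ha := ((hh _ (hlam.isSuccLimit_ord.add_one_lt ha)).succ a rfl).agree
  limit d hd hl := ((hh d hd).limit hl).1

theorem isContinuousElementaryChain_of_isStage (hlam : lam.IsRegular)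
    (hh : ∀ i < lam.ord, IsStage lam n p D S i h (h i)) :
    IsContinuousElementaryChain S lam fun a => (h a).2 := by
  refine ⟨fun a ha => (hh a ha).elem, fun a ha z hz => ?_,
    fun b hb a hab => (IsStage.mono hh hb hab.le).2, fun d hd hl => ((hh d hd).limit hl).2⟩
  obtain ⟨b, hb, rfl⟩ := Ordinal.mem_toZFSet_iff.1 hz
  have hb1 := hlam.isSuccLimit_ord.add_one_lt (hb.trans ha)
  exact (IsStage.mono hh ha (Order.add_one_le_iff.2 hb)).2 ((hh _ hb1).succ b rfl).ord_mem

/-! ### The club of closure points -/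

/-- The ordinals `α > n` such that every condition in `X β`, `β < α`, has a splitting node of
length less than `α`. -/
def splittingClub (lam : Cardinal.{u}) (n : Ordinal.{u}) (X : Ordinal.{u} → ZFSet.{u}) :
    Set (Set.Iio lam.ord) :=
  {α | n < α.1 ∧ ∀ β < α.1, ∀ r ∈ X β, IsMillerCondition lam r →
    ∃ u, IsSplitting lam r u ∧ len u < α.1}

/-- Each model is small, so the lengths of one chosen splitting node per condition in it are bounded
below `lam`; closure points of this bounding function, taken above `n`, lie in the set. -/
theorem isClub_splittingClub (hlam : lam.IsRegular) (hlam' : ℵ₀ < lam) (hn : n < lam.ord)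
    (hX : ∀ a < lam.ord, (X a).card < lam) : IsClub (splittingClub lam n X) := by
  refine ⟨fun s hs hne _ α hα => ⟨?_, fun β hβ r hr hrc => ?_⟩, fun x => ?_⟩
  · obtain ⟨γ, hγ⟩ := hne
    exact (hs hγ).1.trans_le (hα.1 hγ)
  · obtain ⟨γ, hγ, hβγ⟩ : ∃ γ ∈ s, β < γ.1 := by
      by_contra! hle
      have hub : α ≤ ⟨β, Set.mem_Iio.2 (hβ.trans α.2)⟩ := hα.2 fun γ hγ => hle γ hγ
      exact hβ.not_ge hub
    obtain ⟨u, hu, hl⟩ := (hs hγ).2 β hβγ r hr hrc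
    exact ⟨u, hu, hl.trans_le (hα.1 hγ)⟩
  · have hsplit : ∀ r, ∃ u, IsMillerCondition lam r → IsSplitting lam r u := fun r => by
      by_cases hr : IsMillerCondition lam r
      · obtain ⟨s, hs⟩ := hr.nonempty
        obtain ⟨u, -, hu⟩ := hr.dense s hs
        exact ⟨u, fun _ => hu⟩
      · exact ⟨∅, fun h => (hr h).elim⟩
    choose u hu using hsplit
    have hbd : ∀ β, ∃ b < lam.ord, β < lam.ord → ∀ r ∈ X β, IsMillerCondition lam r →
        len (u r) < b := fun β => by
      by_cases hβ : β < lam.ord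
      · classical
        obtain ⟨b, hb, hb'⟩ := exists_bound_mem hlam (hX β hβ)
          (fun r => if IsMillerCondition lam r then len (u r) else 0) fun r _ => by
            split_ifs with hr
            · exact hr.isTree.len_lt (hu r hr).1
            · exact hlam.ord_pos
        refine ⟨b, hb, fun _ r hr hrc => ?_⟩
        have := hb' r hr
        rwa [if_pos hrc] at this
      · exact ⟨0, hlam.ord_pos, fun h => (hβ h).elim⟩
    choose g hg hg' using hbd
    obtain ⟨α, hα, hlt, hcl⟩ := exists_closure_point hlam hlam' g (fun β _ => hg β)
      (max_lt hn x.2)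
    refine ⟨⟨α, hα⟩, ⟨(le_max_left _ _).trans_lt hlt, fun β hβ r hr hrc => ?_⟩,
      ((le_max_right _ _).trans_lt hlt).le⟩
    exact ⟨u r, hu r hrc, (hg' β (hβ.trans hα) r hr hrc).trans (hcl β hβ)⟩

/-! ### Generic sets over the models of the chain -/

/-- A common extension of `r` and `p'` meets the front of `p` at some `t`, and its restriction to
`t` is in `w`. -/
theorem isDense_of_front (hlam : lam.IsRegular) (hp : IsMillerCondition lam p)
    (hpp : p' ⊆ p) (hmu : mu < lam.ord) {w : ZFSet.{u}}
    (hw : ∀ r, r ∈ w ↔ IsMillerCondition lam r ∧ (¬ (millerForcing lam).Compatible r p' ∨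
      ∃ t ∈ front lam mu p, r ⊆ restr p' t)) : (millerForcing lam).IsDense w := by
  refine ⟨fun r hr => mem_millerForcing_carrier.2 ((hw r).1 hr).1, fun r hr => ?_⟩
  have hr' := mem_millerForcing_carrier.1 hr
  by_cases hc : (millerForcing lam).Compatible r p'
  · obtain ⟨e, he, her, hep⟩ := hc
    have he' := mem_millerForcing_carrier.1 he
    obtain ⟨t, ht, hte⟩ := exists_mem_front hlam hp he' (fun z hz => hpp (hep hz)) hmu
    exact ⟨restr e t, (hw _).2 ⟨isMillerCondition_restr hlam he' hte, Or.inr ⟨t, ht,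
      restr_mono hep⟩⟩, fun z hz => her (restr_subset hz)⟩
  · exact ⟨r, (hw r).2 ⟨hr', Or.inl hc⟩, fun _ h => h⟩

/-- An `X_α`-generic set compatible with the fusion determines, for each `β < α`, a node of the
front of the `β`-th condition. -/
theorem exists_front_node (hlam : lam.IsRegular)
    (hh : ∀ i < lam.ord, IsStage lam n p D S i h (h i)) (hn : n < lam.ord)
    (hq : ∀ s, s ∈ q ↔ ∀ a < lam.ord, s ∈ (h a).1) (ha : a < lam.ord) {G : Set ZFSet.{u}}
    (hG : (millerForcing lam).IsGenericSet {x | x ∈ (h a).2} G)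
    (hGq : ∀ g ∈ G, (millerForcing lam).Compatible g q) (hb : b < a) :
    ∃ t ∈ front lam (n + b) (h b).1, ∃ g ∈ G, g ⊆ restr (h (b + 1)).1 t := by
  have hb' := hb.trans ha
  have hb1 := hlam.isSuccLimit_ord.add_one_lt hb'
  have hst := (hh _ hb1).succ b rfl
  obtain ⟨w, hwX, hw⟩ := hst.front_mem
  have hnb : n + b < lam.ord := Ordinal.isPrincipal_add_ord hlam.aleph0_le hn hb'
  obtain ⟨g, hg, hgw⟩ := hG.2.2 w ((IsStage.mono hh ha (Order.add_one_le_iff.2 hb)).2 hwX)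
    (isDense_of_front hlam (hh b hb').cond hst.agree.1 hnb hw)
  rcases ((hw g).1 hgw).2 with hno | ⟨t, ht, hgt⟩
  -- Incompatibility with `h (b + 1)` is impossible, because `g` is compatible with `q`, which
  -- extends that condition.
  · obtain ⟨e, he, h1, h2⟩ := hGq g hg
    exact (hno ⟨e, he, h1, fun z hz => (hq z).1 (h2 hz) _ hb1⟩).elim
  · exact ⟨t, ht, g, hg, hgt⟩

/-- The front nodes selected by `G` are pairwise comparable because `G` is directed. They have
lengths cofinal in `a`, so their union is a branch of length exactly `a`. -/
theorem exists_generic_branch (hlam : lam.IsRegular)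
    (hh : ∀ i < lam.ord, IsStage lam n p D S i h (h i)) (hn : n < lam.ord)
    (hq : ∀ s, s ∈ q ↔ ∀ a < lam.ord, s ∈ (h a).1) (ha : a < lam.ord) (hl : Order.IsSuccLimit a)
    (hcl : ∀ β < a, ∀ r ∈ (h β).2, IsMillerCondition lam r →
      ∃ u, IsSplitting lam r u ∧ len u < a) {G : Set ZFSet.{u}}
    (hG : (millerForcing lam).IsGenericSet {x | x ∈ (h a).2} G)
    (hGq : ∀ g ∈ G, (millerForcing lam).Compatible g q) :
    ∃ s ∈ q, len s = a ∧ ∀ b < a, ∃ t ∈ front lam (n + b) (h b).1, t ⊆ s ∧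
      ∃ g ∈ G, g ⊆ restr (h (b + 1)).1 t := by
  have hqc := (isAgreeSeq_of_isStage hlam hh).isMillerCondition_inter hlam hq
  have hcond : ∀ g ∈ G, IsMillerCondition lam g := fun g hg =>
    mem_millerForcing_carrier.1 (hG.1 g hg).2
  have hnode : ∀ b : Set.Iio a, ∃ t, t ∈ front lam (n + b.1) (h b.1).1 ∧
      ∃ g ∈ G, g ⊆ restr (h (b.1 + 1)).1 t := fun b =>
    exists_front_node hlam hh hn hq ha hG hGq b.2
  choose t ht g hg hgt using hnode
  have hcomp : ∀ b : Set.Iio a, ∀ v ∈ g b, v ⊆ t b ∨ t b ⊆ v := fun b v hv => (mem_restr.1 (hgt b hv)).2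
  have hT : ∀ b : Set.Iio a, IsTree lam (h b.1).1 := fun b => (hh b.1 (b.2.trans ha)).cond.isTree
  have hmem : ∀ b r, IsMillerCondition lam r → r ⊆ g b → t b ∈ r := fun b r hr hrg => by
    obtain ⟨s, hs⟩ := hr.nonempty
    exact hr.isTree.mem_of_comparable hlam hs ((hT b).isSeq (ht b).1) ((hT b).len_lt (ht b).1)
      fun v hv => hcomp b v (hrg hv)
  have hself : ∀ b, t b ∈ g b := fun b => hmem b _ (hcond _ (hg b)) fun _ h => h
  have htq : ∀ b, t b ∈ q := fun b => by
    obtain ⟨e, he, h1, h2⟩ := hGq _ (hg b)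
    exact h2 (hmem b e (mem_millerForcing_carrier.1 he) h1)
  -- Here the closure of `a` is used: `g b` appears in an earlier model, so it has a splitting node
  -- of length below `a`, and `t b`, being comparable with all of `g b`, is no longer than that
  -- node.
  have hlen : ∀ b, len (t b) < a := fun b => by
    obtain ⟨c, hc, hgc⟩ := (((hh a ha).limit hl).2 _).1 (hG.1 _ (hg b)).1
    obtain ⟨v, hv, hva⟩ := hcl c hc _ hgc (hcond _ (hg b))
    exact (hv.len_le_of_comparable hlam (hcond _ (hg b)).isTree (hself b) (hcomp b)).trans_lt hva
  -- `b ≤ n + b`, which is at most the rank of `t b`, hence at most its length.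
  have hle : ∀ b : Set.Iio a, b.1 ≤ len (t b) := fun b =>
    le_add_self.trans ((le_tau_of_mem_front (hT b) (ht b)).trans
      (tau_le_len ((hT b).isSeq (ht b).1)))
  have hchain : ∀ b c, t b ⊆ t c ∨ t c ⊆ t b := fun b c => by
    obtain ⟨e, he, h1, h2⟩ := hG.2.1 _ (hg b) _ (hg c)
    exact (hcomp c _ (h2 (hmem b e (hcond e he) h1)))
  have : Nonempty (Set.Iio a) := ⟨⟨0, hl.bot_lt⟩⟩
  have hcof : ∀ x < a, ∃ b, x < len (t b) := fun x hx =>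
    ⟨⟨x + 1, hl.add_one_lt hx⟩, (Order.lt_add_one_iff.2 le_rfl).trans_le (hle _)⟩
  refine ⟨ZFSet.iUnion t, hqc.isTree.iUnion_mem htq hchain (fun b => (hlen b).le) hcof ha,
    (isSeq_iUnion (fun b => hqc.isTree.isSeq (htq b)) hchain (fun b => (hlen b).le) hcof).len_eq,
    fun b hb => ⟨t ⟨b, hb⟩, ht ⟨b, hb⟩, fun z hz => ZFSet.mem_iUnion.2 ⟨_, hz⟩,
      g ⟨b, hb⟩, hg _, hgt _⟩⟩

/-- Since `a` is additively indecomposable, `n + a = a`. The branch passes minimal nodes of every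
level `n + b` with `b < a`, so its rank is at least `a`, while proper initial segments have rank at
most their length, below `a`. Being of regular length, it does not split and is its own front node.
-/
theorem mem_front_of_branch (hlam : lam.IsRegular)
    (hh : ∀ i < lam.ord, IsStage lam n p D S i h (h i)) (ha : a < lam.ord)
    (hreg : IsRegularOrd a) (hna : n < a) (hs : s ∈ (h a).1) (hlen : len s = a)
    (hbr : ∀ b < a, ∃ t ∈ front lam (n + b) (h b).1, t ⊆ s) : s ∈ front lam (n + a) (h a).1 := by
  have hc := (hh a ha).cond
  have hT := hc.isTree
  have hsq := hT.isSeq hs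
  have hadd : n + a = a := by
    obtain ⟨c, hcr, rfl⟩ := hreg
    exact (Ordinal.isPrincipal_add_ord hcr.aleph0_le).add_eq_right hna
  rw [hadd]
  refine ⟨hs, s, ⟨hs, ?_, fun b hb => ?_⟩, Or.inl ⟨rfl, fun hspl => ?_⟩⟩
  · by_contra! hlt
    have hb := hreg.isSuccLimit.add_one_lt hlt
    obtain ⟨t, ht, hts⟩ := hbr _ hb
    obtain ⟨w, hwt, hw⟩ := exists_isMinNode_subset_of_mem_front ht
    have hb' := hb.trans ha
    have hw' := ((isAgreeSeq_of_isStage hlam hh).agree ha hb.le).isMinNode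
      (hh _ hb').cond.isTree hw
    have h1 := hw'.2.1.trans (tau_mono hsq (hT.isSeq hw'.1) fun z hz => hts (hwt hz))
    exact ((Order.lt_add_one_iff.2 le_rfl).trans_le (le_add_self.trans h1)).false
  · exact (tau_le_len (hsq.res hb.le)).trans_lt (hb.trans_eq hlen)
  · exact hc.not_isRegularOrd_len hlam hspl (hlen ▸ hreg)

/-- The bound is `restr q s` for the generic branch `s`: being an upper bound comes from goodness at
the stages below `a`, exactness from the branch being determined by `G`, and membership in `D a`
from goodness at stage `a` itself. -/
theorem exists_isExactUpperBound (hlam : lam.IsRegular)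
    (hD : ∀ a < lam.ord, (millerForcing lam).IsDenseOpen (D a))
    (hh : ∀ i < lam.ord, IsStage lam n p D S i h (h i)) (hn : n < lam.ord)
    (hq : ∀ s, s ∈ q ↔ ∀ a < lam.ord, s ∈ (h a).1) (ha : a < lam.ord) (hreg : IsRegularOrd a)
    (hna : n < a) (hcl : ∀ β < a, ∀ r ∈ (h β).2, IsMillerCondition lam r →
      ∃ u, IsSplitting lam r u ∧ len u < a) {G : Set ZFSet.{u}}
    (hG : (millerForcing lam).IsGenericSet {x | x ∈ (h a).2} G)
    (hGq : ∀ g ∈ G, (millerForcing lam).Compatible g q) :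
    ∃ r, (millerForcing lam).IsExactUpperBound (insert q G) r ∧ r ∈ D a := by
  have hqc := (isAgreeSeq_of_isStage hlam hh).isMillerCondition_inter hlam hq
  have hqT := hqc.isTree
  have hsub : ∀ a < lam.ord, q ⊆ (h a).1 := fun a ha s hs => (hq s).1 hs a ha
  have hl := hreg.isSuccLimit
  obtain ⟨s, hs, hlen, hbr⟩ := exists_generic_branch hlam hh hn hq ha hl hcl hG hGq
  have hgood : ∀ b < lam.ord, ∀ t ∈ front lam (n + b) (h b).1,
      IsGood lam (h b).2 (D b) (restr (h (b + 1)).1 t) := fun b hb =>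
    ((hh _ (hlam.isSuccLimit_ord.add_one_lt hb)).succ b rfl).good
  have hrc := isMillerCondition_restr hlam hqc hs
  have hfront : s ∈ front lam (n + a) (h a).1 :=
    mem_front_of_branch hlam hh ha hreg hna (hsub a ha hs) hlen fun b hb => by
      obtain ⟨t, ht, hts, -⟩ := hbr b hb
      exact ⟨t, ht, hts⟩
  refine ⟨restr q s, ⟨⟨mem_millerForcing_carrier.2 hrc, ?_⟩, fun r ⟨hr, hrG⟩ u hu => ?_⟩, ?_⟩
  · rintro z (rfl | hz)
    · exact restr_subset
    · obtain ⟨b, hb, hzb⟩ := (((hh a ha).limit hl).2 _).1 (hG.1 _ hz).1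
      obtain ⟨t, ht, hts, g, hg, hgt⟩ := hbr b hb
      have hb' := hb.trans ha
      -- The element `z` of an earlier model `X b` is decided by the part of `P (b + 1)` above the
      -- front node `t`. A negative decision is excluded, since `G` contains a condition below that
      -- part which is compatible with `z`.
      rcases ((hgood b hb' t ht).2 z hzb).1 (mem_millerForcing_carrier.1 (hG.1 _ hz).2)
        with hsz | hno
      · intro v hv
        obtain ⟨hvq, hvs⟩ := mem_restr.1 hv
        refine hsz (mem_restr.2 ⟨hsub _ (hlam.isSuccLimit_ord.add_one_lt hb') hvq, ?_⟩)
        rcases hvs with hvs | hsv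
        · exact hqT.subset_or_subset hvq (hqT.tree s hs t _
            ((hh b hb').cond.isTree.isSeq ht.1) hts) hs hvs hts
        · exact Or.inr fun y hy => hsv (hts hy)
      · obtain ⟨e, he, h1, h2⟩ := hG.2.1 g hg z hz
        exact (hno ⟨e, (hG.1 e he).2, fun y hy => hgt (h1 hy), h2⟩).elim
  · have huq : u ∈ q := hrG q (Set.mem_insert _ _) hu
    refine mem_restr.2 ⟨huq, ?_⟩
    -- A node of an upper bound is comparable with every front node on `s`. If it is not below `s`,
    -- it extends all of them, and each pair of `s` already occurs in one of them.
    refine or_iff_not_imp_left.2 fun hno z hz => ?_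
    have hsq := hqT.isSeq hs
    obtain ⟨x, hx, y, -, rfl⟩ := hsq.exists_eq_pair hz
    rw [hlen] at hx
    have hx1 := hl.add_one_lt hx
    obtain ⟨t, ht, hts, g, hg, hgt⟩ := hbr _ hx1
    have htq := (hh _ (hx1.trans ha)).cond.isTree.isSeq ht.1
    rcases (mem_restr.1 (hgt (hrG g (Set.mem_insert_of_mem _ hg) hu))).2 with hut | htu
    · exact (hno fun y hy => hts (hut hy)).elim
    · refine htu ?_
      rw [hsq.eq_res htq hts]
      refine pair_mem_res.2 ⟨?_, hz⟩
      exact (Order.lt_add_one_iff.2 le_rfl).trans_le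
        (le_add_self.trans ((le_tau_of_mem_front (hh _ (hx1.trans ha)).cond.isTree ht).trans
          (tau_le_len htq)))
  · have hs1 := hlam.isSuccLimit_ord.add_one_lt ha
    exact (hD a ha).2 _ (hgood a ha s hfront).1 _ (mem_millerForcing_carrier.2 hrc)
      (restr_mono (hsub _ hs1))

/-! ### The fusion is a generic condition -/

/-- Below any condition extending the fusion there is a condition extending an element of the union
of the chain which is good for a given model of the chain. -/
theorem exists_isGood_mem_chain (hlam : lam.IsRegular)
    (hh : ∀ i < lam.ord, IsStage lam n p D S i h (h i)) (hn : n < lam.ord)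
    (hq : ∀ s, s ∈ q ↔ ∀ a < lam.ord, s ∈ (h a).1) (hb : b < lam.ord)
    (hr : IsMillerCondition lam r) (hrq : r ⊆ q) :
    ∃ s, IsMillerCondition lam s ∧ s ⊆ r ∧ ∃ c, IsMillerCondition lam c ∧ s ⊆ c ∧
      IsGood lam (h b).2 (D b) c ∧ ∃ e < lam.ord, b ≤ e ∧ c ∈ (h e).2 := by
  have hlim := hlam.isSuccLimit_ord
  have hb1 := hlim.add_one_lt hb
  have hsub : ∀ a < lam.ord, r ⊆ (h a).1 := fun a ha s hs => (hq s).1 (hrq hs) a ha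
  have hst := (hh _ hb1).succ b rfl
  have hnb : n + b < lam.ord := Ordinal.isPrincipal_add_ord hlam.aleph0_le hn hb
  obtain ⟨t, ht, htr⟩ := exists_mem_front hlam (hh b hb).cond hr (hsub b hb) hnb
  have htb := hsub _ hb1 htr
  have hT := hr.isTree
  obtain ⟨e, he, hte⟩ := exists_subset_prod hlam (hT.isSeq htr) (hT.len_lt htr)
  -- From this stage on `h (b + 1)` is in the model and `t` is among the nodes treated, so the next
  -- model contains the restriction.
  have hm : max (b + 1) e < lam.ord := max_lt hb1 he
  have hm1 := hlim.add_one_lt hm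
  refine ⟨restr r t, isMillerCondition_restr hlam hr htr, restr_subset,
    restr (h (b + 1)).1 t, isMillerCondition_restr hlam (hh _ hb1).cond htb,
    restr_mono (hsub _ hb1), hst.good t ht, max (b + 1) e + 1, hm1, ?_, ?_⟩
  · exact (Order.le_succ b).trans ((le_max_left _ _).trans (Order.le_succ _))
  · refine ((hh _ hm1).succ _ rfl).restr_mem _
      ((IsStage.mono hh hm (le_max_left _ _)).2 hst.right_mem) t htb (hh _ hb1).cond ?_
    intro z hz
    obtain ⟨x, hx, y, hy, rfl⟩ := ZFSet.mem_prod.1 (hte hz)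
    have hle := Ordinal.toZFSet_monotone (le_max_right (b + 1) e)
    exact ZFSet.pair_mem_prod.2 ⟨hle hx, hle hy⟩

/-- Below any extension of `q` there is a condition extending some `z` in the chain that is good for
a prescribed model. For compatibility, `z` itself is the common extension; for a dense set `E`, the
next model contains an element of `E` extended by `z`. -/
theorem isGenericCondition_of_isStage (hlam : lam.IsRegular)
    (hh : ∀ i < lam.ord, IsStage lam n p D S i h (h i)) (hn : n < lam.ord)
    (hq : ∀ s, s ∈ q ↔ ∀ a < lam.ord, s ∈ (h a).1) :
    (millerForcing lam).IsGenericCondition {x | ∃ a < lam.ord, x ∈ (h a).2} q := by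
  have hforce : ∀ c s, s ⊆ c → (millerForcing lam).forcesMem c s := fun c s hsc r hr hrs =>
    ⟨r, hr, fun _ h => h, fun z hz => hsc (hrs hz)⟩
  refine ⟨?_, ?_⟩
  · rintro x ⟨b, hb, hxb⟩ hx y ⟨c, hc, hyc⟩ hy r hr hrq ⟨hrx, hry⟩ r' hr' hrr
    have hbc := max_lt hb hc
    obtain ⟨s, hs, hsr, z, hz, hsz, hgood, e, he, -, hze⟩ := exists_isGood_mem_chain hlam hh hn hq
      hbc (mem_millerForcing_carrier.1 hr') fun v hv => hrq (hrr hv)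
    -- `z` decides `x`, and it cannot be incompatible with `x`, because `s` lies below `z` and
    -- forces `x` into the generic filter.
    have hdec : ∀ x ∈ (millerForcing lam).carrier, x ∈ (h (max b c)).2 →
        (millerForcing lam).forcesMem x r → z ⊆ x := fun x hx hxm hrx => by
      refine ((hgood.2 x hxm).1 (mem_millerForcing_carrier.1 hx)).resolve_right fun hno => hno ?_
      obtain ⟨v, hv, hvs, hvx⟩ := hrx s (mem_millerForcing_carrier.2 hs) fun y hy => hrr (hsr hy)
      exact ⟨v, hv, fun y hy => hsz (hvs hy), hvx⟩
    exact ⟨s, mem_millerForcing_carrier.2 hs, hsr, z, ⟨⟨e, he, hze⟩, mem_millerForcing_carrier.2 hz,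
      hdec x hx ((IsStage.mono hh hbc (le_max_left _ _)).2 hxb) hrx,
      hdec y hy ((IsStage.mono hh hbc (le_max_right _ _)).2 hyc) hry⟩, hforce z s hsz⟩
  · rintro E ⟨b, hb, hEb⟩ hE r hr hrq
    obtain ⟨s, hs, hsr, z, hz, hsz, hgood, e, he, hbe, hze⟩ := exists_isGood_mem_chain hlam hh hn hq
      hb (mem_millerForcing_carrier.1 hr) hrq
    have he1 := hlam.isSuccLimit_ord.add_one_lt he
    obtain ⟨d, hd, hzd, hdX⟩ := ((hh _ he1).succ e rfl).pick_mem z hze E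
      ((IsStage.mono hh he hbe).2 hEb) hE ((hgood.2 E hEb).2 hE)
    exact ⟨s, mem_millerForcing_carrier.2 hs, hsr, d, ⟨⟨_, he1, hdX⟩, hd⟩,
      hforce d s fun v hv => hzd (hsz hv)⟩

/-- The continuous fusion of generalized Miller forcing at an inaccessible cardinal. -/
theorem exists_continuous_fusion (hlam : lam.IsInaccessible) (hn : n < lam.ord)
    (hp : IsMillerCondition lam p)
    (hD : ∀ a < lam.ord, (millerForcing lam).IsDenseOpen (D a))
    (S : fusionLang.Structure (HSet (millerForcing lam).succCard)) :
    ∃ q ∈ (millerForcing lam).carrier, ExtendsAt lam n q p ∧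
      ∃ C : Set (Set.Iio lam.ord), IsClub C ∧
      ∃ X : Ordinal.{u} → ZFSet.{u}, IsContinuousElementaryChain S lam X ∧
        IsInternallyApproachable lam X ∧
        IsFusionWitness (millerForcing lam) lam (regularsBelow lam) D X C q ∧
        ∃ P : Ordinal.{u} → ZFSet.{u}, IsFusionSeq lam n P ∧ P 0 = p ∧
          (∀ a < lam.ord, P a ∈ X (a + 1) ∧ P (a + 1) ∈ X (a + 1)) ∧
          ∀ s, s ∈ q ↔ ∀ a < lam.ord, s ∈ P a := by
  have hreg := hlam.isRegular
  obtain ⟨h, hh⟩ := exists_stages (n := n) (S := S) hlam hp hD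
  have hseq := isAgreeSeq_of_isStage hreg hh
  have h0 : (h 0).1 = p := (hh 0 hreg.ord_pos).zero rfl
  have hq : ∀ s, s ∈ ZFSet.sep (fun s => ∀ a < lam.ord, s ∈ (h a).1) p ↔
      ∀ a < lam.ord, s ∈ (h a).1 := fun s => by
    rw [ZFSet.mem_sep, and_iff_right_iff_imp]
    exact fun hs => h0 ▸ hs 0 hreg.ord_pos
  have hqc := hseq.isMillerCondition_inter hreg hq
  have hagree := hseq.agree_inter hq hreg.ord_pos
  rw [add_zero, h0] at hagree
  have hsucc : ∀ a < lam.ord, IsSuccStage lam n D a h (h (a + 1)) := fun a ha =>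
    (hh _ (hreg.isSuccLimit_ord.add_one_lt ha)).succ a rfl
  refine ⟨_, mem_millerForcing_carrier.2 hqc, hagree.extendsAt hreg hp hqc,
    splittingClub lam n fun a => (h a).2,
    isClub_splittingClub hreg hlam.aleph0_lt hn fun a ha => (hh a ha).card, fun a => (h a).2,
    isContinuousElementaryChain_of_isStage hreg hh,
    fun d hd => ((hh _ hd).succ d rfl).approach,
    ⟨fun a ha => (hh a ha).card, fun a ha G hG hGq => ?_,
      isGenericCondition_of_isStage hreg hh hn hq⟩,
    fun a => (h a).1, hseq.isFusionSeq hreg, h0,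
    fun a ha => ⟨(hsucc a ha).left_mem, (hsucc a ha).right_mem⟩, hq⟩
  exact exists_isExactUpperBound hreg hD hh hn hq a.2 ha.1 ha.2.1 ha.2.2 hG hGq

end

end MillerFusion

end

theorem lemma4 (lam : Cardinal.{u}) (hlam : MillerFusion.IsMahlo lam) :
    MillerFusion.HasContinuousFusion (MillerFusion.millerForcing lam) lam
      (MillerFusion.regularsBelow lam) ∧
    ∀ n < lam.ord, ∀ p ∈ (MillerFusion.millerForcing lam).carrier,
    ∀ D : Ordinal.{u} → ZFSet.{u},
      (∀ a < lam.ord, (MillerFusion.millerForcing lam).IsDenseOpen (D a)) →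
    ∀ wo : MillerFusion.HSet (MillerFusion.millerForcing lam).succCard →
        MillerFusion.HSet (MillerFusion.millerForcing lam).succCard → Prop, IsWellOrder _ wo →
    ∀ A : Set (MillerFusion.HSet (MillerFusion.millerForcing lam).succCard),
      ∃ q ∈ (MillerFusion.millerForcing lam).carrier, MillerFusion.ExtendsAt lam n q p ∧
      ∃ C : Set (Set.Iio lam.ord), IsClub C ∧
      ∃ X : Ordinal.{u} → ZFSet.{u},
        MillerFusion.IsContinuousElementaryChain
          (MillerFusion.fusionStructure (MillerFusion.millerForcing lam) lam D wo A) lam X ∧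
        MillerFusion.IsInternallyApproachable lam X ∧
        MillerFusion.IsFusionWitness (MillerFusion.millerForcing lam) lam
          (MillerFusion.regularsBelow lam) D X C q ∧
        ∃ P : Ordinal.{u} → ZFSet.{u}, MillerFusion.IsFusionSeq lam n P ∧ P 0 = p ∧
          (∀ a < lam.ord, P a ∈ X (a + 1) ∧ P (a + 1) ∈ X (a + 1)) ∧
          ∀ s, s ∈ q ↔ ∀ a < lam.ord, s ∈ P a := by
  have key := fun n hn p hp D hD wo (_ : IsWellOrder _ wo) A =>
    MillerFusion.exists_continuous_fusion (n := n) (p := p) (D := D) hlam.1 hn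
      (MillerFusion.mem_millerForcing_carrier.1 hp) hD
      (MillerFusion.fusionStructure (MillerFusion.millerForcing lam) lam D wo A)
  refine ⟨⟨MillerFusion.le_card_millerForcing hlam.1.isRegular, fun p hp D hD wo hwo A => ?_⟩, key⟩
  -- The plain fusion property preserves no splitting level, so level `0` serves.
  obtain ⟨q, hq, hqp, C, hC, X, hX, -, hw, -⟩ :=
    key 0 hlam.1.isRegular.ord_pos p hp D hD wo hwo A
  exact ⟨q, hq, hqp.1, C, hC, X, hX, hw⟩
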